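/- **Setting.** Let $d\in\{2,3\}$ and let $\Omega\subset\mathbb R^d$ be a bounded connected open polygon ($d=2$) or polyhedron ($d=3$) with $\operatorname{int}\overline\Omega=\Omega$ (for instance one with Lipschitz boundary), $\Gamma=\partial\Omega$. Put $X=H^1(\Omega)^d$, $X_0=H^1_0(\Omega)^d$, with $\|\cdot\|_X$ the $H^1$-norm and $|\cdot|_X$ the $L^2$-norm of the gradient; $\|\mathbf f\|_{X_0'}$ is the dual norm with respect to $|\cdot|_X$, and $\|\mathbf g\|_{H^{1/2}(\Gamma)^d}$ is the infimum of $\|\mathbf v\|_X$ over all $\mathbf v\in X$ with trace $\mathbf g$. Let $Re>0$, $\varepsilon_0>0$, $r>d$, $\varepsilon\in W^{1,r}(\Omega)$ with $\varepsilon_0\le\varepsilon\le1$, and let $\alpha,\beta$ be positive on $[\varepsilon_0,1]$, differentiable on $]\varepsilon_0,1[$ with non-negative bounded derivatives; let $\alpha\le\alpha_M$ and $\beta\le\beta_M$ on $[\varepsilon_0,1]$. For a conforming triangulation $\mathcal T_h$ of $\overline\Omega$ into non-degenerate closed simplices with largest diameter $h$, let $$X_h=\{\mathbf v\in C^0(\overline\Omega)^d:\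 \mathbf v|_\kappa\in(\mathbb P_1\oplus\operatorname{span}\{b_\kappa\})^d\ \forall\kappa\in\mathcal T_h\},\quad M_h=\{q\in C^0(\overline\Omega):\ q|_\kappa\in\mathbb P_1\ \forall\kappa\in\mathcal T_h\},$$ where $b_\kappa$ is the product of the barycentric coordinates of $\kappa$, and let $X_{0h}=X_h\cap X_0$, $M_{0h}=M_h\cap L^2_0(\Omega)$. Let $\varepsilon_h\in M_h$ with $\varepsilon_0\le\varepsilon_h\le1$ in $\Omega$ and, for a constant $C_\varepsilon$, $$\|\varepsilon-\varepsilon_h\|_{L^\infty(\Omega)}\le C_\varepsilon h,\qquad \|\nabla\varepsilon-\nabla\varepsilon_h\|_{L^r(\Omega)}\le C_\varepsilon h .$$ With the scalar products of $L^2(\Omega)$, put $$a_h(\mathbf u,\mathbf v)=\tfrac1{Re}(\varepsilon_h\nabla\mathbf u,\nabla\mathbf v)+(\alpha(\varepsilon_h)\mathbf u,\mathbf v),\quad b_h(\mathbf v,q)=(\operatorname{div}(\varepsilon_h\mathbf v),q),\quad \ell_h(\mathbf v)=(\varepsilon_h\mathbf f,\mathbf v),$$ $$c_h(\mathbf u,\mathbf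 v,\mathbf w)=(\varepsilon_h(\mathbf u\cdot\nabla)\mathbf v,\mathbf w)+\tfrac12(\operatorname{div}(\varepsilon_h\mathbf u)\mathbf v,\mathbf w)+(\beta(\varepsilon_h)|\mathbf u|\mathbf v,\mathbf w).$$ Let $\mathbf f\in L^2(\Omega)^d$, let $\mathbf g$ be given on $\Gamma$, and let $\mathbf G\in X$ be a lifting with trace $\mathbf g$, $\operatorname{div}(\varepsilon\mathbf G)=0$ and $\|\mathbf G\|_X\le C_G\|\mathbf g\|_{H^{1/2}(\Gamma)^d}$ for a constant $C_G$. *Discrete problem:* find $(\mathbf w_h,p_h)\in X_{0h}\times M_{0h}$ such that for all $(\mathbf v,q)\in X_{0h}\times M_{0h}$ $$a_h(\mathbf w_h,\mathbf v)+c_h(\mathbf w_h+\mathbf G,\mathbf w_h+\mathbf G,\mathbf v)-b_h(\mathbf v,p_h)=\ell_h(\mathbf v)-a_h(\mathbf G,\mathbf v),\qquad b_h(\mathbf w_h,q)=0.\tag{D}$$ *Iteration:* given $\mathbf w_h^i\in X_{0h}$, find $(\mathbf w_h^{i+1},p_h^{i+1})\in X_{0h}\times M_{0h}$ such that for all $(\mathbf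 v,q)\in X_{0h}\times M_{0h}$ $$a_h(\mathbf w_h^{i+1},\mathbf v)+c_h(\mathbf w_h^i+\mathbf G,\mathbf w_h^{i+1},\mathbf v)-b_h(\mathbf v,p_h^{i+1})=\ell_h(\mathbf v)-a_h(\mathbf G,\mathbf v)-c_h(\mathbf w_h^i+\mathbf G,\mathbf G,\mathbf v),\quad b_h(\mathbf w_h^{i+1},q)=0.\tag{I}$$ Set $\mathbf u_h=\mathbf w_h+\mathcal I\mathbf G$ and $\mathbf u_h^i=\mathbf w_h^i+\mathcal I\mathbf G$, where $\mathcal I:X\to X_h$ is any interpolation operator. For positive constants $C_2,S_2,C_4,S_4,c_d,c_v$ (in particular the constants of the embeddings of $X_0$ and $X$ into $L^2$ and $L^4$ and of the bounds of the trilinear forms), and with $\|\mathbf g\|=\|\mathbf g\|_{H^{1/2}(\Gamma)^d}$, put $$R_1=\tfrac{2Re}{\varepsilon_0}\big(\varepsilon_0\|\mathbf f\|_{X_0'}+c_v\|\mathbf g\|^2+(\tfrac1{Re}+\alpha_MC_2^2)\|\mathbf g\|\big),\qquad F_1=\tfrac{2Re}{\varepsilon_0}\big(\|\mathbf f\|_{X_0'}+(\tfrac1{Re}+\alpha_MS_2)\|\mathbf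 g\|+c_v\|\mathbf g\|^2\big).$$ **Theorem.** There is a constant $c_1>0$, depending only on $d,\Omega,Re,\varepsilon_0,\alpha,\beta,\alpha_M,\beta_M,r,\varepsilon,C_\varepsilon,C_G$ and $C_2,S_2,C_4,S_4,c_d,c_v$ (not on $\mathcal T_h,\varepsilon_h,\mathbf f,\mathbf g,\mathbf G$), such that the following holds whenever $$\|\mathbf g\|<\frac{\varepsilon_0}{2c_vRe},\qquad \varepsilon_0\|\mathbf f\|_{X_0'}+c_v\|\mathbf g\|^2+\Big(\frac{\varepsilon_0+2}{2Re}+\alpha_MC_2^2\Big)\|\mathbf g\|<\frac{\varepsilon_0^2}{2Re^2(c_d+\beta_MC_2C_4S_4)},$$ $$c_1\big(R_1+\|\mathbf g\|\big)<\frac{\varepsilon_0}{2Re}.$$ Problem (D) has exactly one solution $(\mathbf w_h,p_h)$, every step (I) has exactly one solution, and for every initial guess $\mathbf w_h^0\in X_{0h}$ with $|\mathbf w_h^0|_X\le F_1$ the iterates satisfy $$\mathbf u_h^{i+1}\to\mathbf u_h\ \text{ in } L^2(\Omega)^d,\qquad p_h^{i+1}\to p_h\ \text{ in } L^2(\Omega)\qquad(i\to\infty).$$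 -/

import Mathlib

open MeasureTheory Set Filter Topology
open scoped ENNReal ContDiff

noncomputable section

namespace BDF

/-- The Euclidean space `ℝ^d`. -/
abbrev E (d : ℕ) : Type := EuclideanSpace ℝ (Fin d)

variable {d : ℕ}

/-! ### Sobolev spaces on an open set `Ω`, through weak derivatives -/

/-- `φ` belongs to `C_c^∞(Ω)`. -/
def IsTest (Ω : Set (E d)) {F : Type} [NormedAddCommGroup F] [NormedSpace ℝ F]
    (φ : E d → F) : Prop :=
  ContDiff ℝ ∞ φ ∧ HasCompactSupport φ ∧ tsupport φ ⊆ Ω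

/-- `g` is the weak derivative `∂_i u` on `Ω`. -/
def HasWeakPartial (Ω : Set (E d)) (i : Fin d) (u g : E d → ℝ) : Prop :=
  LocallyIntegrableOn u Ω volume ∧ LocallyIntegrableOn g Ω volume ∧
  ∀ φ : E d → ℝ, IsTest Ω φ →
    ∫ x in Ω, u x * fderiv ℝ φ x (EuclideanSpace.single i 1) = -∫ x in Ω, g x * φ x

open Classical in
/-- A representative of the weak derivative `∂_i u` on `Ω`; it is determined almost everywhere
(and is `0` by convention if `u` has no weak derivative). -/
def weakPartial (Ω : Set (E d)) (i : Fin d) (u : E d → ℝ) : E d → ℝ :=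
  if h : ∃ g, HasWeakPartial Ω i u g then h.choose else 0

/-- The weak gradient of a scalar function. -/
def weakGrad (Ω : Set (E d)) (u : E d → ℝ) (x : E d) : E d :=
  WithLp.toLp 2 fun i => weakPartial Ω i u x

/-- The weak divergence of a vector field. -/
def weakDiv (Ω : Set (E d)) (u : E d → E d) (x : E d) : ℝ :=
  ∑ i, weakPartial Ω i (fun y => u y i) x

/-- `u ∈ W^{1,q}(Ω)`. -/
def MemW1 (Ω : Set (E d)) (q : ℝ≥0∞) (u : E d → ℝ) : Prop :=
  MemLp u q (volume.restrict Ω) ∧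
  ∀ i, ∃ g, HasWeakPartial Ω i u g ∧ MemLp g q (volume.restrict Ω)

/-- `X = H^1(Ω)^d`. -/
def MemX (Ω : Set (E d)) (v : E d → E d) : Prop :=
  ∀ j, MemW1 Ω 2 fun x => v x j

/-- The norm of `L^2(Ω)` or `L^2(Ω)^d`. -/
def l2norm (Ω : Set (E d)) {F : Type} [NormedAddCommGroup F] (v : E d → F) : ℝ :=
  (eLpNorm v 2 (volume.restrict Ω)).toReal

/-- The seminorm `|v|_X`. -/
def seminormX (Ω : Set (E d)) (v : E d → E d) : ℝ :=
  Real.sqrt (∑ j, ∑ i, ∫ x in Ω, weakPartial Ω i (fun y => v y j) x ^ 2)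

/-- The norm `‖v‖_X`. -/
def normX (Ω : Set (E d)) (v : E d → E d) : ℝ :=
  Real.sqrt (l2norm Ω v ^ 2 + seminormX Ω v ^ 2)

/-- `X_0 = H^1_0(Ω)^d`, the closure of `C_c^∞(Ω)^d` in `X`. -/
def MemX0 (Ω : Set (E d)) (v : E d → E d) : Prop :=
  MemX Ω v ∧ ∃ φ : ℕ → E d → E d, (∀ n, IsTest Ω (φ n)) ∧
    Tendsto (fun n => normX Ω (φ n - v)) atTop (𝓝 0)

/-- The norm of `f ∈ L^2(Ω)^d` in the dual of `X_0`, where `X_0` is normed by `|·|_X`. -/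
def dualNorm (Ω : Set (E d)) (f : E d → E d) : ℝ :=
  sSup {t | ∃ v, MemX0 Ω v ∧ seminormX Ω v ≤ 1 ∧ t = ∫ x in Ω, inner ℝ (f x) (v x)}

/-- `v ∈ X` has trace `g` on `Γ = ∂Ω`: `v` is the limit in `X` of smooth fields whose restrictions
to `Γ` converge to `g` in `L^2(Γ)^d` (surface measure). -/
def HasTrace (Ω : Set (E d)) (v g : E d → E d) : Prop :=
  MemX Ω v ∧ ∃ φ : ℕ → E d → E d, (∀ n, ContDiff ℝ ∞ (φ n)) ∧
    Tendsto (fun n => normX Ω (φ n - v)) atTop (𝓝 0) ∧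
    Tendsto (fun n => eLpNorm (φ n - g) 2
      ((Measure.hausdorffMeasure ((d : ℝ) - 1)).restrict (frontier Ω))) atTop (𝓝 0)

/-- The norm of `g` in the trace space `H^{1/2}(Γ)^d`. -/
def normTrace (Ω : Set (E d)) (g : E d → E d) : ℝ :=
  sInf {t | ∃ v, HasTrace Ω v g ∧ t = normX Ω v}

/-! ### Triangulations and the mini-element -/

/-- A conforming triangulation of `closure Ω` by non degenerate closed simplices. Each element is
given by its vertices, an affine basis, whose coordinates are the barycentric coordinates. -/
structure Triangulation (Ω : Set (E d)) where
  N : ℕ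
  vert : Fin N → AffineBasis (Fin (d + 1)) ℝ (E d)
  cover : closure Ω = ⋃ k, convexHull ℝ (range (vert k))
  distinct : ∀ k l, k ≠ l → range (vert k) ≠ range (vert l)
  conforming : ∀ k l, k ≠ l →
    convexHull ℝ (range (vert k)) ∩ convexHull ℝ (range (vert l)) =
      convexHull ℝ (range (vert k) ∩ range (vert l))

namespace Triangulation

variable {Ω : Set (E d)} (T : Triangulation Ω)

/-- The `k`-th element. -/
def elem (k : Fin T.N) : Set (E d) := convexHull ℝ (range (T.vert k))

/-- The mesh size `h`. -/
def size : ℝ := ⨆ k, Metric.diam (T.elem k)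

/-- The bubble function of the `k`-th element. -/
def bubble (k : Fin T.N) (x : E d) : ℝ := ∏ i, (T.vert k).coord i x

/-- The discrete space `X_h`. -/
def MemXh (v : E d → E d) : Prop :=
  ContinuousOn v (closure Ω) ∧ ∀ k, ∀ j, ∃ (A : E d →ᵃ[ℝ] ℝ) (c : ℝ),
    ∀ x ∈ T.elem k, v x j = A x + c * T.bubble k x

/-- The discrete space `X_{0h} = X_h ∩ X_0`. -/
def MemX0h (v : E d → E d) : Prop := T.MemXh v ∧ MemX0 Ω v

/-- The discrete space `M_h`. -/
def MemMh (q : E d → ℝ) : Prop :=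
  ContinuousOn q (closure Ω) ∧ ∀ k, ∃ A : E d →ᵃ[ℝ] ℝ, ∀ x ∈ T.elem k, q x = A x

/-- The discrete space `M_{0h} = M_h ∩ L^2_0(Ω)`. -/
def MemM0h (q : E d → ℝ) : Prop := T.MemMh q ∧ ∫ x in Ω, q x = 0

end Triangulation

/-! ### The coefficients, the discrete forms and the discrete problems -/

/-- The assumption on the Darcy and Forchheimer functions `α` and `β`. -/
structure IsCoefficient (ε₀ : ℝ) (α : ℝ → ℝ) : Prop where
  pos : ∀ t ∈ Icc ε₀ 1, 0 < α t
  diff : ∀ t ∈ Ioo ε₀ 1, DifferentiableAt ℝ α t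
  deriv_nonneg : ∀ t ∈ Ioo ε₀ 1, 0 ≤ deriv α t
  deriv_bdd : ∃ B, ∀ t ∈ Ioo ε₀ 1, deriv α t ≤ B

/-- `a_h(u,v)`. -/
def formA (Ω : Set (E d)) (Re : ℝ) (α : ℝ → ℝ) (εh : E d → ℝ) (u v : E d → E d) : ℝ :=
  1 / Re * (∫ x in Ω, εh x * ∑ j, ∑ i,
      weakPartial Ω i (fun y => u y j) x * weakPartial Ω i (fun y => v y j) x)
    + ∫ x in Ω, α (εh x) * inner ℝ (u x) (v x)

/-- `d_h(u,v,w)`. -/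
def formD (Ω : Set (E d)) (εh : E d → ℝ) (u v w : E d → E d) : ℝ :=
  (∫ x in Ω, εh x * ∑ j, (∑ i, u x i * weakPartial Ω i (fun y => v y j) x) * w x j)
    + 1 / 2 * ∫ x in Ω, weakDiv Ω (fun y => εh y • u y) x * inner ℝ (v x) (w x)

/-- `c_h(u,v,w)`. -/
def formC (Ω : Set (E d)) (β : ℝ → ℝ) (εh : E d → ℝ) (u v w : E d → E d) : ℝ :=
  formD Ω εh u v w + ∫ x in Ω, β (εh x) * ‖u x‖ * inner ℝ (v x) (w x)

/-- `b_h(v,q)`. -/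
def formB (Ω : Set (E d)) (εh : E d → ℝ) (v : E d → E d) (q : E d → ℝ) : ℝ :=
  ∫ x in Ω, weakDiv Ω (fun y => εh y • v y) x * q x

/-- `ℓ_h(v)`. -/
def formL (Ω : Set (E d)) (εh : E d → ℝ) (f v : E d → E d) : ℝ :=
  ∫ x in Ω, εh x * inner ℝ (f x) (v x)

/-- `(w, p)` solves the nonlinear discrete problem. -/
def IsDiscreteSolution {Ω : Set (E d)} (T : Triangulation Ω) (Re : ℝ) (α β : ℝ → ℝ)
    (εh : E d → ℝ) (f G : E d → E d) (w : E d → E d) (p : E d → ℝ) : Prop :=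
  T.MemX0h w ∧ T.MemM0h p ∧
  (∀ v, T.MemX0h v →
    formA Ω Re α εh w v + formC Ω β εh (w + G) (w + G) v - formB Ω εh v p
      = formL Ω εh f v - formA Ω Re α εh G v) ∧
  ∀ q, T.MemM0h q → formB Ω εh w q = 0

/-- `(w', p')` solves the linear problem that defines one step of the iteration from `w`. -/
def IsStep {Ω : Set (E d)} (T : Triangulation Ω) (Re : ℝ) (α β : ℝ → ℝ)
    (εh : E d → ℝ) (f G : E d → E d) (w w' : E d → E d) (p' : E d → ℝ) : Prop :=
  T.MemX0h w' ∧ T.MemM0h p' ∧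
  (∀ v, T.MemX0h v →
    formA Ω Re α εh w' v + formC Ω β εh (w + G) w' v - formB Ω εh v p'
      = formL Ω εh f v - formA Ω Re α εh G v - formC Ω β εh (w + G) G v) ∧
  ∀ q, T.MemM0h q → formB Ω εh w' q = 0

/-- `R_1(f,g)`, with `nf` and `ng` the norms of `f` and `g`. -/
def R₁ (Re ε₀ αM C₂ cv nf ng : ℝ) : ℝ :=
  2 * Re / ε₀ * (ε₀ * nf + cv * ng ^ 2 + (1 / Re + αM * C₂ ^ 2) * ng)

/-- `F_1(f,g)`, with `nf` and `ng` the norms of `f` and `g`. -/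
def F₁ (Re ε₀ αM S₂ cv nf ng : ℝ) : ℝ :=
  2 * Re / ε₀ * (nf + (1 / Re + αM * S₂) * ng + cv * ng ^ 2)

end BDF

end

open BDF

open scoped Convolution NNReal

noncomputable section

namespace BDF

variable {d : ℕ}

/-- The `i`-th vector of the standard basis. -/
abbrev basisVec (i : Fin d) : E d := EuclideanSpace.single i 1

section Mollification

open ContinuousLinearMap in
theorem abs_mollify_le {ρ : ContDiffBump (0 : E d)} {f : E d → ℝ} {C : ℝ}
    (hC : ∀ x, |f x| ≤ C) (x : E d) :
    |(ρ.normed volume ⋆[lsmul ℝ ℝ, volume] f) x| ≤ C := by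
  have hi : ∫ t, ρ.normed volume (x - t) = 1 := by
    rw [integral_sub_left_eq_self (fun t => ρ.normed volume t) volume x]
    exact ρ.integral_normed
  have hint : Integrable (fun t => ρ.normed volume (x - t)) :=
    (ρ.integrable_normed (μ := volume)).comp_sub_left x
  rw [convolution_eq_swap]
  calc |∫ t, (lsmul ℝ ℝ (ρ.normed volume (x - t))) (f t)|
      ≤ ∫ t, C * ρ.normed volume (x - t) := by
        rw [← Real.norm_eq_abs]
        refine norm_integral_le_of_norm_le (hint.const_mul C) (ae_of_all _ fun t => ?_)
        simp only [lsmul_apply, smul_eq_mul, norm_mul, Real.norm_eq_abs]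
        rw [abs_of_nonneg (ρ.nonneg_normed _), mul_comm]
        exact mul_le_mul_of_nonneg_right (hC t) (ρ.nonneg_normed _)
    _ = C := by rw [integral_const_mul, hi, mul_one]

open ContinuousLinearMap in
theorem contDiff_mollify {ρ : ContDiffBump (0 : E d)} {f : E d → ℝ} (hf : Continuous f) :
    ContDiff ℝ ∞ (ρ.normed volume ⋆[lsmul ℝ ℝ, volume] f) :=
  HasCompactSupport.contDiff_convolution_left _ ρ.hasCompactSupport_normed
    ρ.contDiff_normed hf.locallyIntegrable

open ContinuousLinearMap in
theorem fderiv_mollify {ρ : ContDiffBump (0 : E d)} {f : E d → ℝ} {C : ℝ≥0}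
    (hf : LipschitzWith C f) (x e : E d) :
    fderiv ℝ (ρ.normed volume ⋆[lsmul ℝ ℝ, volume] f) x e =
      (ρ.normed volume ⋆[lsmul ℝ ℝ, volume] fun y => lineDeriv ℝ f y e) x := by
  have hd : DifferentiableAt ℝ (ρ.normed volume ⋆[lsmul ℝ ℝ, volume] f) x :=
    (contDiff_mollify hf.continuous).contDiffAt.differentiableAt (by simp)
  have h1 := (hd.hasFDerivAt.hasLineDerivAt e).tendsto_slope_zero_right
  have hint : Integrable (fun t => ρ.normed volume (x - t)) :=
    (ρ.integrable_normed (μ := volume)).comp_sub_left x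
  have h2 := hf.integral_inv_smul_sub_mul_tendsto_integral_lineDeriv_mul hint e
  have key : ∀ z, Integrable (fun y => ρ.normed volume (x - y) * f (y + z)) := by
    intro z
    refine Continuous.integrable_of_hasCompactSupport ?_ ?_
    · exact (ρ.continuous_normed.comp (continuous_const.sub continuous_id)).mul
        (hf.continuous.comp (continuous_id.add continuous_const))
    · exact HasCompactSupport.mul_right
        (ρ.hasCompactSupport_normed.comp_homeomorph (Homeomorph.subLeft x))
  refine tendsto_nhds_unique h1 ?_
  have he : (ρ.normed volume ⋆[lsmul ℝ ℝ, volume] fun y => lineDeriv ℝ f y e) x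
      = ∫ y, lineDeriv ℝ f y e * ρ.normed volume (x - y) := by
    rw [convolution_eq_swap]
    simp only [lsmul_apply, smul_eq_mul, mul_comm]
  rw [he]
  refine h2.congr fun t => ?_
  rw [convolution_eq_swap, convolution_eq_swap]
  simp only [lsmul_apply, smul_eq_mul]
  have : ∫ y, ρ.normed volume (x + t • e - y) * f y
      = ∫ y, ρ.normed volume (x - y) * f (y + t • e) := by
    rw [← integral_add_right_eq_self _ (t • e)]
    congr 1; ext y; congr 2; abel
  rw [this]
  have h0 := key 0
  simp only [add_zero] at h0
  rw [← integral_sub (key _) h0, ← integral_const_mul]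
  congr 1; ext y; ring

/-- A Lipschitz function with compact support in `Ω` is a limit of test functions which stay in a
compact part of `Ω`, are bounded together with their derivatives and converge with them. -/
theorem exists_test_approx {Ω : Set (E d)} (hΩ : IsOpen Ω) {ψ : E d → ℝ} {C : ℝ≥0}
    (hψ : LipschitzWith C ψ) (hc : HasCompactSupport ψ) (hs : tsupport ψ ⊆ Ω) :
    ∃ (φ : ℕ → E d → ℝ) (K : Set (E d)) (M : ℝ), IsCompact K ∧ K ⊆ Ω ∧ tsupport ψ ⊆ K ∧
      (∀ n, IsTest Ω (φ n)) ∧ (∀ n, tsupport (φ n) ⊆ K) ∧ (∀ n x, |φ n x| ≤ M) ∧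
      (∀ n x i, |fderiv ℝ (φ n) x (basisVec i)| ≤ M) ∧
      (∀ x, Tendsto (fun n => φ n x) atTop (𝓝 (ψ x))) ∧
      ∀ i, ∀ᵐ x, Tendsto (fun n => fderiv ℝ (φ n) x (basisVec i)) atTop
        (𝓝 (lineDeriv ℝ ψ x (basisVec i))) := by
  obtain ⟨δ, hδ, hδΩ⟩ := hc.isCompact.exists_cthickening_subset_open hΩ hs
  obtain ⟨M₀, hM₀⟩ := hc.exists_bound_of_continuous hψ.continuous
  let ρ : ℕ → ContDiffBump (0 : E d) := fun n =>
    ⟨δ / (n + 2) / 2, δ / (n + 2), by positivity, half_lt_self (by positivity)⟩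
  have hr : Tendsto (fun n => (ρ n).rOut) atTop (𝓝 0) := by
    have h2 : Tendsto (fun n : ℕ => (n : ℝ) + 2) atTop atTop :=
      tendsto_atTop_add_const_right _ _ tendsto_natCast_atTop_atTop
    exact h2.const_div_atTop δ
  have hsupp : ∀ n, tsupport ((ρ n).normed volume ⋆[ContinuousLinearMap.lsmul ℝ ℝ, volume] ψ)
      ⊆ Metric.cthickening δ (tsupport ψ) := by
    intro n
    refine closure_minimal ?_ Metric.isClosed_cthickening
    refine (support_convolution_subset _).trans ?_
    rintro _ ⟨a, ha, b, hb, rfl⟩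
    refine Metric.mem_cthickening_of_dist_le _ b _ _ (subset_tsupport _ hb) ?_
    rw [(ρ n).support_normed_eq, Metric.mem_ball, dist_zero_right] at ha
    have : (ρ n).rOut ≤ δ := by
      change δ / (n + 2) ≤ δ
      refine div_le_self hδ.le ?_
      have : (0 : ℝ) ≤ n := by positivity
      linarith
    simpa [dist_eq_norm] using ha.le.trans this
  refine ⟨fun n => (ρ n).normed volume ⋆[ContinuousLinearMap.lsmul ℝ ℝ, volume] ψ,
    Metric.cthickening δ (tsupport ψ), max M₀ C, hc.isCompact.cthickening, hδΩ,
    Metric.self_subset_cthickening _, fun n => ⟨contDiff_mollify hψ.continuous,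
      HasCompactSupport.of_support_subset_isCompact hc.isCompact.cthickening
        ((subset_tsupport _).trans (hsupp n)), (hsupp n).trans hδΩ⟩, hsupp, ?_, ?_, ?_, ?_⟩
  · intro n x
    exact abs_mollify_le (fun y => (hM₀ y).trans (le_max_left _ _)) x
  · intro n x i
    rw [fderiv_mollify hψ]
    refine abs_mollify_le (fun y => ?_) x
    have := norm_lineDeriv_le_of_lipschitz ℝ hψ (x₀ := y) (v := basisVec i)
    refine le_trans ?_ (le_max_right _ _)
    simpa using this
  · intro x
    exact ContDiffBump.convolution_tendsto_right_of_continuous hr hψ.continuous x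
  · intro i
    have h2 : ∀ᶠ n in atTop, (ρ n).rOut ≤ 2 * (ρ n).rIn :=
      Eventually.of_forall fun n => by
        change δ / (n + 2) ≤ 2 * (δ / (n + 2) / 2); linarith
    filter_upwards [ContDiffBump.ae_convolution_tendsto_right_of_locallyIntegrable hr h2
      (hψ.locallyIntegrable_lineDeriv (μ := volume) (basisVec i))] with x hx
    refine hx.congr fun n => ?_
    rw [fderiv_mollify hψ]

end Mollification

section WeakDerivatives

/-- `v` is bounded on `Ω` and locally Lipschitz on `Ω` with a uniform constant. -/
structure IsW1Lip (Ω : Set (E d)) (v : E d → ℝ) : Prop where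
  bdd : ∃ C, ∀ x ∈ Ω, |v x| ≤ C
  lip : ∃ K : ℝ≥0, ∀ x ∈ Ω, ∃ t ∈ 𝓝 x, LipschitzOnWith K v t

variable {Ω : Set (E d)} {u v g g' : E d → ℝ} {i : Fin d}

theorem IsW1Lip.continuousOn (hv : IsW1Lip Ω v) : ContinuousOn v Ω := by
  obtain ⟨K, hK⟩ := hv.lip
  intro x hx
  obtain ⟨t, ht, hl⟩ := hK x hx
  exact (hl.continuousOn.continuousAt ht).continuousWithinAt

theorem IsW1Lip.aestronglyMeasurable (hΩ : IsOpen Ω) (hv : IsW1Lip Ω v) :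
    AEStronglyMeasurable v (volume.restrict Ω) :=
  hv.continuousOn.aestronglyMeasurable hΩ.measurableSet

theorem IsW1Lip.memLp_top (hΩ : IsOpen Ω) (hv : IsW1Lip Ω v) :
    MemLp v ⊤ (volume.restrict Ω) := by
  obtain ⟨C, hC⟩ := hv.bdd
  exact memLp_top_of_bound (hv.aestronglyMeasurable hΩ) C
    ((ae_restrict_iff' hΩ.measurableSet).2 (ae_of_all _ hC))

theorem IsW1Lip.ae_differentiableAt (hΩ : IsOpen Ω) (hv : IsW1Lip Ω v) :
    ∀ᵐ x ∂(volume.restrict Ω), DifferentiableAt ℝ v x := by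
  obtain ⟨K, hK⟩ := hv.lip
  rw [ae_restrict_iff' hΩ.measurableSet, ae_iff]
  refine measure_null_of_locally_null _ fun x hx => ?_
  simp only [mem_ofPred_eq, Classical.not_imp] at hx
  obtain ⟨t, ht, hl⟩ := hK x hx.1
  refine ⟨{x | ¬(x ∈ Ω → DifferentiableAt ℝ v x)} ∩ interior t,
    inter_mem_nhdsWithin _ (interior_mem_nhds.2 ht), ?_⟩
  refine measure_mono_null ?_ (ae_iff.1 (hl.ae_differentiableWithinAt_of_mem (μ := volume)))
  rintro y ⟨hy, hyt⟩
  simp only [mem_ofPred_eq, Classical.not_imp] at hy ⊢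
  exact ⟨interior_subset hyt, fun h => hy.2 (h.differentiableAt (mem_interior_iff_mem_nhds.1 hyt))⟩

theorem IsW1Lip.exists_abs_lineDeriv_le (hv : IsW1Lip Ω v) :
    ∃ K, ∀ x ∈ Ω, ∀ i, |lineDeriv ℝ v x (basisVec i)| ≤ K := by
  obtain ⟨K, hK⟩ := hv.lip
  refine ⟨K, fun x hx i => ?_⟩
  obtain ⟨t, ht, hl⟩ := hK x hx
  simpa using norm_lineDeriv_le_of_lipschitzOn ℝ ht hl (v := basisVec i)

theorem IsW1Lip.aestronglyMeasurable_lineDeriv (hΩ : IsOpen Ω) (hv : IsW1Lip Ω v) (e : E d) :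
    AEStronglyMeasurable (fun x => lineDeriv ℝ v x e) (volume.restrict Ω) := by
  have hm : Measurable (Ω.indicator v) := by
    classical
    rw [← piecewise_eq_indicator]
    exact hv.continuousOn.measurable_piecewise continuousOn_const hΩ.measurableSet
  have ht : Tendsto (fun n : ℕ => ((n : ℝ) + 1)⁻¹) atTop (𝓝[>] 0) :=
    tendsto_inv_atTop_nhdsGT_zero.comp
      (tendsto_atTop_add_const_right _ _ tendsto_natCast_atTop_atTop)
  refine aestronglyMeasurable_of_tendsto_ae atTop
    (f := fun (n : ℕ) x => (((n : ℝ) + 1)⁻¹)⁻¹ •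
      (Ω.indicator v (x + ((n : ℝ) + 1)⁻¹ • e) - Ω.indicator v x)) (fun n => ?_) ?_
  · refine Measurable.aestronglyMeasurable ?_
    exact ((hm.comp (measurable_id.add_const _)).sub hm).const_smul (((n : ℝ) + 1)⁻¹)⁻¹
  · filter_upwards [hv.ae_differentiableAt hΩ, ae_restrict_mem hΩ.measurableSet] with x hx hxΩ
    have h1 := ((hx.lineDifferentiableAt (v := e)).hasLineDerivAt.tendsto_slope_zero_right).comp ht
    refine h1.congr' ?_
    have h2 : Tendsto (fun n : ℕ => x + ((n : ℝ) + 1)⁻¹ • e) atTop (𝓝 x) := by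
      have := (tendsto_nhds_of_tendsto_nhdsWithin ht).smul_const e
      simpa using this.const_add x
    filter_upwards [h2.eventually_mem (hΩ.mem_nhds hxΩ)] with n hn
    simp [indicator_of_mem hn, indicator_of_mem hxΩ]

theorem IsW1Lip.memLp_top_lineDeriv (hΩ : IsOpen Ω) (hv : IsW1Lip Ω v) (i : Fin d) :
    MemLp (fun x => lineDeriv ℝ v x (basisVec i)) ⊤ (volume.restrict Ω) := by
  obtain ⟨K, hK⟩ := hv.exists_abs_lineDeriv_le
  exact memLp_top_of_bound (hv.aestronglyMeasurable_lineDeriv hΩ _) K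
    ((ae_restrict_iff' hΩ.measurableSet).2 (ae_of_all _ fun x hx => hK x hx i))

/-- A function which is Lipschitz near every point, with compact support, is Lipschitz. -/
theorem exists_lipschitzWith_of_hasCompactSupport {ψ : E d → ℝ} (hψ : LocallyLipschitz ψ)
    (hc : HasCompactSupport ψ) : ∃ C, LipschitzWith C ψ := by
  obtain ⟨R, hR⟩ := hc.isCompact.isBounded.subset_closedBall (0 : E d)
  obtain ⟨M, hM⟩ := hc.exists_bound_of_continuous hψ.continuous
  obtain ⟨K, hK⟩ := (hψ.locallyLipschitzOn (s := Metric.closedBall (0 : E d) (R + 1)))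
    |>.exists_lipschitzOnWith_of_compact (isCompact_closedBall _ _)
  have hz : ∀ x, x ∉ Metric.closedBall (0 : E d) R → ψ x = 0 := fun x hx =>
    image_eq_zero_of_notMem_tsupport fun h => hx (hR h)
  have hM0 : 0 ≤ M := (norm_nonneg _).trans (hM 0)
  refine ⟨max K M.toNNReal, LipschitzWith.of_dist_le_mul fun x y => ?_⟩
  have hKM : (K : ℝ) ≤ (max K M.toNNReal : ℝ≥0) := by exact_mod_cast le_max_left _ _
  have hMM : M ≤ (max K M.toNNReal : ℝ≥0) := by
    refine (Real.coe_toNNReal M hM0).symm.le.trans ?_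
    exact_mod_cast le_max_right _ _
  have hcl : ∀ x ∈ Metric.closedBall (0 : E d) R, ∀ y,
      dist (ψ x) (ψ y) ≤ (max K M.toNNReal : ℝ≥0) * dist x y := by
    intro x hx y
    by_cases hy : y ∈ Metric.closedBall (0 : E d) (R + 1)
    · refine (hK.dist_le_mul x (Metric.closedBall_subset_closedBall (by linarith) hx) y hy).trans ?_
      gcongr
    · have hy0 : ψ y = 0 := hz y fun h => hy (Metric.closedBall_subset_closedBall (by linarith) h)
      have h1 : 1 ≤ dist x y := by
        rw [Metric.mem_closedBall] at hx hy
        have := dist_triangle y x 0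
        rw [dist_comm x y]; linarith
      rw [hy0, dist_zero_right]
      calc ‖ψ x‖ ≤ M * 1 := by simpa using hM x
        _ ≤ _ := mul_le_mul hMM h1 zero_le_one (by positivity)
  by_cases hx : x ∈ Metric.closedBall (0 : E d) R
  · exact hcl x hx y
  · by_cases hy : y ∈ Metric.closedBall (0 : E d) R
    · rw [dist_comm, dist_comm x y]; exact hcl y hy x
    · rw [hz x hx, hz y hy, dist_self]; positivity

theorem IsTest.locallyLipschitz {F : Type} [NormedAddCommGroup F] [NormedSpace ℝ F]
    {φ : E d → F} (hφ : IsTest Ω φ) : LocallyLipschitz φ :=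
  (hφ.1.of_le (by simp)).locallyLipschitz

theorem IsW1Lip.exists_lipschitzWith_mul_test (hv : IsW1Lip Ω v) {φ : E d → ℝ}
    (hφ : IsTest Ω φ) : (∃ C, LipschitzWith C fun x => v x * φ x) ∧
      HasCompactSupport (fun x => v x * φ x) ∧ tsupport (fun x => v x * φ x) ⊆ Ω := by
  have hc : HasCompactSupport (fun x => v x * φ x) := hφ.2.1.mul_left
  have hs : tsupport (fun x => v x * φ x) ⊆ tsupport φ := tsupport_mul_subset_right
  refine ⟨exists_lipschitzWith_of_hasCompactSupport ?_ hc, hc, hs.trans hφ.2.2⟩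
  intro x
  by_cases hx : x ∈ tsupport φ
  · obtain ⟨K, hK⟩ := hv.lip
    obtain ⟨t, ht, hl⟩ := hK x (hφ.2.2 hx)
    obtain ⟨K', t', ht', hl'⟩ := hφ.locallyLipschitz x
    obtain ⟨A, hA⟩ := hv.bdd
    obtain ⟨B, hB⟩ := hφ.2.1.exists_bound_of_continuous hφ.1.continuous
    have hcont : ContinuousAt v x := hl.continuousOn.continuousAt ht
    have hA' : {y | |v y| < |v x| + 1} ∈ 𝓝 x :=
      hcont.abs.eventually (gt_mem_nhds (by linarith))
    have hB0 : 0 ≤ B := (norm_nonneg _).trans (hB 0)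
    have hA0 : 0 ≤ |v x| + 1 := by positivity
    refine ⟨(|v x| + 1).toNNReal * K' + K * B.toNNReal, t ∩ t' ∩ {y | |v y| < |v x| + 1},
      inter_mem (inter_mem ht ht') hA', LipschitzOnWith.of_dist_le_mul ?_⟩
    intro y hy z hz
    have h1 := hl.dist_le_mul y hy.1.1 z hz.1.1
    have h2 := hl'.dist_le_mul y hy.1.2 z hz.1.2
    rw [Real.dist_eq] at h1 h2 ⊢
    have e : v y * φ y - v z * φ z = v y * (φ y - φ z) + (v y - v z) * φ z := by ring
    rw [e]
    push_cast
    rw [Real.coe_toNNReal _ hB0, Real.coe_toNNReal _ hA0]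
    calc |v y * (φ y - φ z) + (v y - v z) * φ z|
        ≤ |v y| * |φ y - φ z| + |v y - v z| * |φ z| := by
          rw [← abs_mul, ← abs_mul]; exact abs_add_le _ _
      _ ≤ (|v x| + 1) * (K' * dist y z) + (K * dist y z) * B := by
          have hy2 : |v y| ≤ |v x| + 1 := le_of_lt hy.2
          have hz2 : |φ z| ≤ B := hB z
          gcongr
      _ = _ := by ring
  · refine ⟨0, (tsupport φ)ᶜ, (isClosed_tsupport φ).isOpen_compl.mem_nhds hx, ?_⟩
    refine LipschitzOnWith.of_dist_le_mul fun y hy z hz => ?_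
    simp [image_eq_zero_of_notMem_tsupport hy, image_eq_zero_of_notMem_tsupport hz]

theorem integrable_indicator_of_locallyIntegrableOn (hu : LocallyIntegrableOn u Ω volume)
    {K : Set (E d)} (hK : IsCompact K) (hKΩ : K ⊆ Ω) :
    Integrable (K.indicator u) (volume.restrict Ω) := by
  rw [integrable_indicator_iff hK.measurableSet, IntegrableOn,
    Measure.restrict_restrict_of_subset hKΩ]
  exact hu.integrableOn_compact_subset hKΩ hK

theorem integrable_mul_of_locallyIntegrableOn (hΩ : IsOpen Ω)
    (hu : LocallyIntegrableOn u Ω volume) {φ : E d → ℝ} {K : Set (E d)} {M : ℝ}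
    (hK : IsCompact K) (hKΩ : K ⊆ Ω) (hm : AEStronglyMeasurable φ (volume.restrict Ω))
    (hM : ∀ x ∈ Ω, |φ x| ≤ M) (h0 : ∀ x, x ∉ K → φ x = 0) :
    Integrable (fun x => u x * φ x) (volume.restrict Ω) := by
  refine ((integrable_indicator_of_locallyIntegrableOn hu hK hKΩ).norm.const_mul M).mono'
    ((hu.aestronglyMeasurable).mul hm) ?_
  filter_upwards [ae_restrict_mem hΩ.measurableSet] with x hx
  by_cases hxK : x ∈ K
  · rw [indicator_of_mem hxK, norm_mul, mul_comm]
    exact mul_le_mul_of_nonneg_right (hM x hx) (norm_nonneg _)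
  · simp [h0 x hxK, indicator_of_notMem hxK]

/-- The defining identity of weak derivatives extends to Lipschitz functions with compact
support. -/
theorem HasWeakPartial.integral_lipschitz (hΩ : IsOpen Ω) (h : HasWeakPartial Ω i u g)
    {ψ : E d → ℝ} {C : ℝ≥0} (hψ : LipschitzWith C ψ) (hc : HasCompactSupport ψ)
    (hs : tsupport ψ ⊆ Ω) :
    ∫ x in Ω, u x * lineDeriv ℝ ψ x (basisVec i) = -∫ x in Ω, g x * ψ x := by
  obtain ⟨φ, K, M, hK, hKΩ, -, hφ, hφs, hφM, hdM, hlim, hdlim⟩ :=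
    exists_test_approx hΩ hψ hc hs
  have hb : ∀ {w : E d → ℝ} {χ : E d → ℝ} {n : ℕ} (x : E d), (∀ x ∉ K, χ x = 0) →
      (∀ x, |χ x| ≤ M) → ‖w x * χ x‖ ≤ M * ‖K.indicator w x‖ := by
    intro w χ n x h0 hM
    by_cases hx : x ∈ K
    · rw [indicator_of_mem hx, norm_mul, mul_comm]
      exact mul_le_mul_of_nonneg_right (hM x) (norm_nonneg _)
    · simp [h0 x hx, indicator_of_notMem hx]
  have h1 : Tendsto (fun n => ∫ x in Ω, u x * fderiv ℝ (φ n) x (basisVec i)) atTop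
      (𝓝 (∫ x in Ω, u x * lineDeriv ℝ ψ x (basisVec i))) := by
    refine tendsto_integral_of_dominated_convergence
      (fun x => M * ‖K.indicator u x‖) (fun n => ?_)
      ((integrable_indicator_of_locallyIntegrableOn h.1 hK hKΩ).norm.const_mul M)
      (fun n => ae_of_all _ fun x => ?_) ?_
    · exact (h.1.aestronglyMeasurable).mul
        (((hφ n).1.continuous_fderiv (by simp)).clm_apply continuous_const).aestronglyMeasurable
    · refine hb (n := n) x (fun y hy => ?_) (fun y => hdM n y i)
      rw [image_eq_zero_of_notMem_tsupport fun hh => hy (hφs n (tsupport_fderiv_subset ℝ hh))]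
      simp
    · filter_upwards [ae_restrict_of_ae (hdlim i)] with x hx
      exact hx.const_mul _
  have h2 : Tendsto (fun n => ∫ x in Ω, g x * φ n x) atTop (𝓝 (∫ x in Ω, g x * ψ x)) := by
    refine tendsto_integral_of_dominated_convergence
      (fun x => M * ‖K.indicator g x‖) (fun n => ?_)
      ((integrable_indicator_of_locallyIntegrableOn h.2.1 hK hKΩ).norm.const_mul M)
      (fun n => ae_of_all _ fun x => ?_) ?_
    · exact (h.2.1.aestronglyMeasurable).mul (hφ n).1.continuous.aestronglyMeasurable
    · exact hb (n := n) x (fun y hy => image_eq_zero_of_notMem_tsupport fun hh => hy (hφs n hh))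
        (hφM n)
    · exact ae_of_all _ fun x => (hlim x).const_mul _
  refine tendsto_nhds_unique h1 ?_
  have : (fun n => ∫ x in Ω, u x * fderiv ℝ (φ n) x (basisVec i)) =
      fun n => -∫ x in Ω, g x * φ n x := by
    ext n; exact h.2.2 (φ n) (hφ n)
  rw [this]
  exact h2.neg

theorem locallyIntegrableOn_mul_bounded (hΩ : IsOpen Ω) (hu : LocallyIntegrableOn u Ω volume)
    (hm : AEStronglyMeasurable v (volume.restrict Ω)) {C : ℝ} (hC : ∀ x ∈ Ω, |v x| ≤ C) :
    LocallyIntegrableOn (fun x => u x * v x) Ω volume := by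
  intro x hx
  obtain ⟨t, ht, hi⟩ := hu x hx
  refine ⟨t ∩ Ω, inter_mem ht self_mem_nhdsWithin, ?_⟩
  refine (hi.mono_set inter_subset_left).mul_bdd (c := C)
    (hm.mono_measure (Measure.restrict_mono inter_subset_right le_rfl)) ?_
  refine ae_mono (Measure.restrict_mono inter_subset_right le_rfl) ?_
  exact (ae_restrict_iff' hΩ.measurableSet).2 (ae_of_all _ hC)

/-- The product rule for a weakly differentiable and a Lipschitz function. -/
theorem HasWeakPartial.mul_lip (hΩ : IsOpen Ω) (h : HasWeakPartial Ω i u g) (hv : IsW1Lip Ω v) :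
    HasWeakPartial Ω i (fun x => u x * v x)
      (fun x => g x * v x + u x * lineDeriv ℝ v x (basisVec i)) := by
  obtain ⟨C, hC⟩ := hv.bdd
  obtain ⟨K, hK⟩ := hv.exists_abs_lineDeriv_le
  have hvm := hv.aestronglyMeasurable hΩ
  have hdm := hv.aestronglyMeasurable_lineDeriv hΩ (basisVec i)
  have i1 := locallyIntegrableOn_mul_bounded hΩ h.1 hvm hC
  have i2 := locallyIntegrableOn_mul_bounded hΩ h.2.1 hvm hC
  have i3 := locallyIntegrableOn_mul_bounded hΩ h.1 hdm (fun x hx => hK x hx i)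
  refine ⟨i1, i2.add i3, fun φ hφ => ?_⟩
  obtain ⟨⟨D, hD⟩, hc, hs⟩ := hv.exists_lipschitzWith_mul_test hφ
  have key := h.integral_lipschitz hΩ hD hc hs
  have hφ0 : ∀ x, x ∉ tsupport φ → φ x = 0 := fun x hx => image_eq_zero_of_notMem_tsupport hx
  have hdφ0 : ∀ x, x ∉ tsupport φ → fderiv ℝ φ x (basisVec i) = 0 := fun x hx => by
    rw [image_eq_zero_of_notMem_tsupport fun hh => hx (tsupport_fderiv_subset ℝ hh)]; simp
  obtain ⟨B, hB⟩ := hφ.2.1.exists_bound_of_continuous hφ.1.continuous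
  have hdc : Continuous fun x => fderiv ℝ φ x (basisVec i) :=
    (hφ.1.continuous_fderiv (by simp)).clm_apply continuous_const
  obtain ⟨B', hB'⟩ := (HasCompactSupport.of_support_subset_isCompact hφ.2.1 (f := fun x =>
    fderiv ℝ φ x (basisVec i)) (fun x hx => by_contra fun hh => hx (hdφ0 x hh)))
    |>.exists_bound_of_continuous hdc
  have j1 := integrable_mul_of_locallyIntegrableOn hΩ i1 hφ.2.1 hφ.2.2 hdc.aestronglyMeasurable
    (fun x _ => hB' x) hdφ0
  have j2 := integrable_mul_of_locallyIntegrableOn hΩ i2 hφ.2.1 hφ.2.2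
    hφ.1.continuous.aestronglyMeasurable (fun x _ => hB x) hφ0
  have j3 := integrable_mul_of_locallyIntegrableOn hΩ i3 hφ.2.1 hφ.2.2
    hφ.1.continuous.aestronglyMeasurable (fun x _ => hB x) hφ0
  have e1 : ∫ x in Ω, u x * lineDeriv ℝ (fun x => v x * φ x) x (basisVec i) =
      (∫ x in Ω, u x * v x * fderiv ℝ φ x (basisVec i)) +
        ∫ x in Ω, u x * lineDeriv ℝ v x (basisVec i) * φ x := by
    rw [← integral_add j1 j3]
    refine integral_congr_ae ?_
    filter_upwards [hv.ae_differentiableAt hΩ] with x hx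
    have hφd : DifferentiableAt ℝ φ x := hφ.1.contDiffAt.differentiableAt (by simp)
    rw [(hx.fun_mul hφd).lineDeriv_eq_fderiv, hx.lineDeriv_eq_fderiv, fderiv_fun_mul hx hφd]
    simp; ring
  have e2 : ∫ x in Ω, (g x * v x + u x * lineDeriv ℝ v x (basisVec i)) * φ x =
      (∫ x in Ω, g x * v x * φ x) + ∫ x in Ω, u x * lineDeriv ℝ v x (basisVec i) * φ x := by
    rw [← integral_add j2 j3]
    refine integral_congr_ae (ae_of_all _ fun x => ?_)
    simp only; ring
  rw [e2]
  simp only [mul_assoc] at e1 key ⊢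
  linarith

theorem hasWeakPartial_one (Ω : Set (E d)) (i : Fin d) :
    HasWeakPartial Ω i (fun _ => 1) (fun _ => 0) := by
  refine ⟨(locallyIntegrable_const _).locallyIntegrableOn _,
    (locallyIntegrable_const _).locallyIntegrableOn _, fun φ hφ => ?_⟩
  have h0 : ∀ x, x ∉ Ω → fderiv ℝ φ x (basisVec i) = 0 := fun x hx => by
    rw [image_eq_zero_of_notMem_tsupport fun hh => hx (hφ.2.2 (tsupport_fderiv_subset ℝ hh))]; simp
  obtain ⟨C, hC⟩ := exists_lipschitzWith_of_hasCompactSupport hφ.locallyLipschitz hφ.2.1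
  have hl : LipschitzWith 0 (fun _ : E d => (1 : ℝ)) := LipschitzWith.const 1
  have := hl.integral_lineDeriv_mul_eq (μ := volume) hC hφ.2.1 (-basisVec i)
  have e : ∀ x, lineDeriv ℝ φ x (basisVec i) = fderiv ℝ φ x (basisVec i) := fun x =>
    (hφ.1.contDiffAt.differentiableAt (by simp)).lineDeriv_eq_fderiv
  simp only [neg_neg, e, mul_one] at this
  simp only [one_mul, zero_mul, integral_zero, neg_zero]
  rw [setIntegral_eq_integral_of_forall_compl_eq_zero h0, ← this]
  simp [lineDeriv]

theorem IsW1Lip.hasWeakPartial (hΩ : IsOpen Ω) (hv : IsW1Lip Ω v) (i : Fin d) :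
    HasWeakPartial Ω i v (fun x => lineDeriv ℝ v x (basisVec i)) := by
  simpa using (hasWeakPartial_one Ω i).mul_lip hΩ hv

theorem HasWeakPartial.congr {u' : E d → ℝ} (h : HasWeakPartial Ω i u g)
    (hu : u =ᵐ[volume.restrict Ω] u') (hg : g =ᵐ[volume.restrict Ω] g') :
    HasWeakPartial Ω i u' g' := by
  refine ⟨h.1.congr hu, h.2.1.congr hg, fun φ hφ => ?_⟩
  have e1 := h.2.2 φ hφ
  have e2 : ∫ x in Ω, u' x * fderiv ℝ φ x (EuclideanSpace.single i 1)
      = ∫ x in Ω, u x * fderiv ℝ φ x (EuclideanSpace.single i 1) := by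
    refine integral_congr_ae ?_
    filter_upwards [hu] with x hx; rw [hx]
  have e3 : ∫ x in Ω, g' x * φ x = ∫ x in Ω, g x * φ x := by
    refine integral_congr_ae ?_
    filter_upwards [hg] with x hx; rw [hx]
  rw [e2, e3, e1]

/-- The weak derivative only depends on the almost everywhere class. -/
theorem weakPartial_congr (h : u =ᵐ[volume.restrict Ω] v) :
    weakPartial Ω i u = weakPartial Ω i v := by
  have : HasWeakPartial Ω i u = HasWeakPartial Ω i v := by
    ext g; exact ⟨fun hg => hg.congr h .rfl, fun hg => hg.congr h.symm .rfl⟩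
  unfold weakPartial
  rw [this]

theorem HasWeakPartial.ae_unique (hΩ : IsOpen Ω) (h : HasWeakPartial Ω i u g)
    (h' : HasWeakPartial Ω i u g') : g =ᵐ[volume.restrict Ω] g' := by
  have h0 := hΩ.ae_eq_zero_of_integral_contDiff_smul_eq_zero (f := fun x => g x - g' x)
    (μ := volume) (h.2.1.sub h'.2.1) ?_
  · rw [EventuallyEq, ae_restrict_iff' hΩ.measurableSet]
    filter_upwards [h0] with x hx hxΩ
    linarith [hx hxΩ]
  · intro φ h1 h2 h3
    have e := (h.2.2 φ ⟨h1, h2, h3⟩).symm.trans (h'.2.2 φ ⟨h1, h2, h3⟩)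
    have hφ0 : ∀ x, x ∉ tsupport φ → φ x = 0 := fun x hx => image_eq_zero_of_notMem_tsupport hx
    obtain ⟨B, hB⟩ := h2.exists_bound_of_continuous h1.continuous
    have j := integrable_mul_of_locallyIntegrableOn hΩ h.2.1 h2 h3
      h1.continuous.aestronglyMeasurable (fun x _ => hB x) hφ0
    have j' := integrable_mul_of_locallyIntegrableOn hΩ h'.2.1 h2 h3
      h1.continuous.aestronglyMeasurable (fun x _ => hB x) hφ0
    rw [← setIntegral_eq_integral_of_forall_compl_eq_zero (s := Ω)]
    · have : ∫ x in Ω, φ x • (g x - g' x) = (∫ x in Ω, g x * φ x) - ∫ x in Ω, g' x * φ x := by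
        rw [← integral_sub j j']
        refine integral_congr_ae (ae_of_all _ fun x => ?_)
        simp only [smul_eq_mul]; ring
      rw [this]; linarith
    · intro x hx
      rw [hφ0 x fun hh => hx (h3 hh), zero_smul]

theorem HasWeakPartial.weakPartial (h : HasWeakPartial Ω i u g) :
    HasWeakPartial Ω i u (BDF.weakPartial Ω i u) := by
  have h' : ∃ g, HasWeakPartial Ω i u g := ⟨g, h⟩
  rw [BDF.weakPartial, dif_pos h']
  exact h'.choose_spec

theorem HasWeakPartial.weakPartial_ae (hΩ : IsOpen Ω) (h : HasWeakPartial Ω i u g) :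
    BDF.weakPartial Ω i u =ᵐ[volume.restrict Ω] g :=
  h.weakPartial.ae_unique hΩ h

theorem HasWeakPartial.add {u' : E d → ℝ} (hΩ : IsOpen Ω) (h : HasWeakPartial Ω i u g)
    (h' : HasWeakPartial Ω i u' g') :
    HasWeakPartial Ω i (fun x => u x + u' x) (fun x => g x + g' x) := by
  refine ⟨h.1.add h'.1, h.2.1.add h'.2.1, fun φ hφ => ?_⟩
  have hφ0 : ∀ x, x ∉ tsupport φ → φ x = 0 := fun x hx => image_eq_zero_of_notMem_tsupport hx
  have hdφ0 : ∀ x, x ∉ tsupport φ → fderiv ℝ φ x (basisVec i) = 0 := fun x hx => by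
    rw [image_eq_zero_of_notMem_tsupport fun hh => hx (tsupport_fderiv_subset ℝ hh)]; simp
  obtain ⟨B, hB⟩ := hφ.2.1.exists_bound_of_continuous hφ.1.continuous
  have hdc : Continuous fun x => fderiv ℝ φ x (basisVec i) :=
    (hφ.1.continuous_fderiv (by simp)).clm_apply continuous_const
  obtain ⟨B', hB'⟩ := (HasCompactSupport.of_support_subset_isCompact hφ.2.1 (f := fun x =>
    fderiv ℝ φ x (basisVec i)) (fun x hx => by_contra fun hh => hx (hdφ0 x hh)))
    |>.exists_bound_of_continuous hdc
  have j1 : ∀ {w : E d → ℝ}, LocallyIntegrableOn w Ω volume →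
      Integrable (fun x => w x * fderiv ℝ φ x (basisVec i)) (volume.restrict Ω) := fun hw =>
    integrable_mul_of_locallyIntegrableOn hΩ hw hφ.2.1 hφ.2.2 hdc.aestronglyMeasurable
      (fun x _ => hB' x) hdφ0
  have j2 : ∀ {w : E d → ℝ}, LocallyIntegrableOn w Ω volume →
      Integrable (fun x => w x * φ x) (volume.restrict Ω) := fun hw =>
    integrable_mul_of_locallyIntegrableOn hΩ hw hφ.2.1 hφ.2.2
      hφ.1.continuous.aestronglyMeasurable (fun x _ => hB x) hφ0
  simp only [add_mul]
  rw [integral_add (j1 h.1) (j1 h'.1), integral_add (j2 h.2.1) (j2 h'.2.1), h.2.2 φ hφ,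
    h'.2.2 φ hφ]
  ring

theorem HasWeakPartial.const_mul (h : HasWeakPartial Ω i u g) (c : ℝ) :
    HasWeakPartial Ω i (fun x => c * u x) (fun x => c * g x) := by
  refine ⟨h.1.smul c, h.2.1.smul c, fun φ hφ => ?_⟩
  simp only [mul_assoc, integral_const_mul, h.2.2 φ hφ]
  ring

end WeakDerivatives

section SobolevClasses

variable {Ω : Set (E d)} {u v g g' : E d → ℝ} {i : Fin d} {q : ℝ≥0∞}

theorem isFiniteMeasure_restrict (hb : Bornology.IsBounded Ω) :
    IsFiniteMeasure (volume.restrict Ω) :=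
  ⟨by rw [Measure.restrict_apply_univ]; exact hb.measure_lt_top⟩

theorem MemW1.hasWeakPartial (hu : MemW1 Ω q u) (i : Fin d) :
    HasWeakPartial Ω i u (weakPartial Ω i u) := by
  obtain ⟨g, hg, -⟩ := hu.2 i
  exact hg.weakPartial

theorem MemW1.memLp_weakPartial (hΩ : IsOpen Ω) (hu : MemW1 Ω q u) (i : Fin d) :
    MemLp (weakPartial Ω i u) q (volume.restrict Ω) := by
  obtain ⟨g, hg, hm⟩ := hu.2 i
  exact hm.ae_eq (hg.weakPartial_ae hΩ).symm

theorem weakPartial_add (hΩ : IsOpen Ω) (hu : MemW1 Ω q u) (hv : MemW1 Ω q v) (i : Fin d) :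
    weakPartial Ω i (fun x => u x + v x) =ᵐ[volume.restrict Ω]
      fun x => weakPartial Ω i u x + weakPartial Ω i v x :=
  ((hu.hasWeakPartial i).add hΩ (hv.hasWeakPartial i)).weakPartial_ae hΩ

theorem weakPartial_const_mul (hΩ : IsOpen Ω) (hu : MemW1 Ω q u) (c : ℝ) (i : Fin d) :
    weakPartial Ω i (fun x => c * u x) =ᵐ[volume.restrict Ω]
      fun x => c * weakPartial Ω i u x :=
  ((hu.hasWeakPartial i).const_mul c).weakPartial_ae hΩ

theorem MemW1.add (hΩ : IsOpen Ω) (hu : MemW1 Ω q u) (hv : MemW1 Ω q v) :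
    MemW1 Ω q (fun x => u x + v x) :=
  ⟨hu.1.add hv.1, fun i => ⟨_, (hu.hasWeakPartial i).add hΩ (hv.hasWeakPartial i),
    (hu.memLp_weakPartial hΩ i).add (hv.memLp_weakPartial hΩ i)⟩⟩

theorem MemW1.const_mul (hΩ : IsOpen Ω) (hu : MemW1 Ω q u) (c : ℝ) :
    MemW1 Ω q (fun x => c * u x) :=
  ⟨hu.1.const_mul c, fun i => ⟨_, (hu.hasWeakPartial i).const_mul c,
    (hu.memLp_weakPartial hΩ i).const_mul c⟩⟩

theorem MemW1.sub (hΩ : IsOpen Ω) (hu : MemW1 Ω q u) (hv : MemW1 Ω q v) :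
    MemW1 Ω q (fun x => u x - v x) := by
  simpa [sub_eq_add_neg] using hu.add hΩ (hv.const_mul hΩ (-1))

theorem weakPartial_sub (hΩ : IsOpen Ω) (hu : MemW1 Ω q u) (hv : MemW1 Ω q v) (i : Fin d) :
    weakPartial Ω i (fun x => u x - v x) =ᵐ[volume.restrict Ω]
      fun x => weakPartial Ω i u x - weakPartial Ω i v x := by
  have h := (hu.hasWeakPartial i).add hΩ ((hv.hasWeakPartial i).const_mul (-1))
  simpa [sub_eq_add_neg] using h.weakPartial_ae hΩ

theorem MemW1.congr (hu : MemW1 Ω q u) (h : u =ᵐ[volume.restrict Ω] v) : MemW1 Ω q v :=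
  ⟨hu.1.ae_eq h, fun i => by
    obtain ⟨g, hg, hm⟩ := hu.2 i
    exact ⟨g, hg.congr h .rfl, hm⟩⟩

theorem IsW1Lip.weakPartial_ae (hΩ : IsOpen Ω) (hv : IsW1Lip Ω v) (i : Fin d) :
    weakPartial Ω i v =ᵐ[volume.restrict Ω] fun x => lineDeriv ℝ v x (basisVec i) :=
  (hv.hasWeakPartial hΩ i).weakPartial_ae hΩ

theorem IsW1Lip.memLp_top_weakPartial (hΩ : IsOpen Ω) (hv : IsW1Lip Ω v) (i : Fin d) :
    MemLp (weakPartial Ω i v) ⊤ (volume.restrict Ω) :=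
  (hv.memLp_top_lineDeriv hΩ i).ae_eq (hv.weakPartial_ae hΩ i).symm

theorem IsW1Lip.memW1 (hΩ : IsOpen Ω) (hb : Bornology.IsBounded Ω) (hv : IsW1Lip Ω v) :
    MemW1 Ω q v := by
  have := isFiniteMeasure_restrict hb
  exact ⟨(hv.memLp_top hΩ).mono_exponent le_top, fun i => ⟨_, hv.hasWeakPartial hΩ i,
    (hv.memLp_top_lineDeriv hΩ i).mono_exponent le_top⟩⟩

theorem weakPartial_mul_lip (hΩ : IsOpen Ω) (hu : MemW1 Ω q u) (hv : IsW1Lip Ω v) (i : Fin d) :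
    weakPartial Ω i (fun x => u x * v x) =ᵐ[volume.restrict Ω]
      fun x => weakPartial Ω i u x * v x + u x * weakPartial Ω i v x := by
  refine (((hu.hasWeakPartial i).mul_lip hΩ hv).weakPartial_ae hΩ).trans ?_
  filter_upwards [hv.weakPartial_ae hΩ i] with x hx
  rw [hx]

theorem memLp_mul_top {p : ℝ≥0∞} {μ : Measure (E d)} (hu : MemLp u p μ) (hv : MemLp v ⊤ μ) :
    MemLp (fun x => u x * v x) p μ := by
  simpa [mul_comm] using hu.mul' hv (p := ⊤) (q := p) (r := p)

theorem MemW1.mul_lip (hΩ : IsOpen Ω) (hu : MemW1 Ω q u) (hv : IsW1Lip Ω v) :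
    MemW1 Ω q (fun x => u x * v x) :=
  ⟨memLp_mul_top hu.1 (hv.memLp_top hΩ), fun i => ⟨_, (hu.hasWeakPartial i).mul_lip hΩ hv,
    (memLp_mul_top (hu.memLp_weakPartial hΩ i) (hv.memLp_top hΩ)).add
      (memLp_mul_top hu.1 (hv.memLp_top_lineDeriv hΩ i))⟩⟩

/-- A smooth function is bounded with bounded derivatives on a bounded set. -/
theorem isW1Lip_of_contDiff (hb : Bornology.IsBounded Ω) (hv : ContDiff ℝ 1 v) :
    IsW1Lip Ω v := by
  obtain ⟨R, hR⟩ := hb.subset_ball (0 : E d)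
  obtain ⟨C, hC⟩ := (isCompact_closedBall (0 : E d) R).exists_bound_of_continuousOn
    hv.continuous.continuousOn
  obtain ⟨K, hK⟩ := (hv.locallyLipschitz.locallyLipschitzOn
    (s := Metric.closedBall (0 : E d) R)).exists_lipschitzOnWith_of_compact
      (isCompact_closedBall _ _)
  exact ⟨⟨C, fun x hx => hC x (Metric.ball_subset_closedBall (hR hx))⟩, K, fun x hx =>
    ⟨_, mem_of_superset (Metric.isOpen_ball.mem_nhds (hR hx)) Metric.ball_subset_closedBall, hK⟩⟩

theorem weakPartial_of_contDiff (hΩ : IsOpen Ω) (hb : Bornology.IsBounded Ω)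
    (hv : ContDiff ℝ 1 v) (i : Fin d) :
    weakPartial Ω i v =ᵐ[volume.restrict Ω] fun x => fderiv ℝ v x (basisVec i) := by
  filter_upwards [(isW1Lip_of_contDiff hb hv).weakPartial_ae hΩ i] with x hx
  rw [hx, (hv.differentiable (by simp) x).lineDeriv_eq_fderiv]

/-- The `H^1(Ω)` norm (as a sum) of a scalar function. -/
def h1e (Ω : Set (E d)) (u : E d → ℝ) : ℝ≥0∞ :=
  eLpNorm u 2 (volume.restrict Ω) + ∑ i, eLpNorm (weakPartial Ω i u) 2 (volume.restrict Ω)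

theorem eLpNorm_le_h1e : eLpNorm u 2 (volume.restrict Ω) ≤ h1e Ω u := le_self_add

theorem eLpNorm_weakPartial_le_h1e (i : Fin d) :
    eLpNorm (weakPartial Ω i u) 2 (volume.restrict Ω) ≤ h1e Ω u :=
  (Finset.single_le_sum (f := fun i => eLpNorm (weakPartial Ω i u) 2 (volume.restrict Ω))
    (fun _ _ => zero_le) (Finset.mem_univ i)).trans le_add_self

theorem h1e_congr (h : u =ᵐ[volume.restrict Ω] v) : h1e Ω u = h1e Ω v := by
  simp only [h1e, weakPartial_congr h, eLpNorm_congr_ae h]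

theorem h1e_add_le (hΩ : IsOpen Ω) (hu : MemW1 Ω 2 u) (hv : MemW1 Ω 2 v) :
    h1e Ω (fun x => u x + v x) ≤ h1e Ω u + h1e Ω v := by
  have h1 := eLpNorm_add_le hu.1.1 hv.1.1 (one_le_two : (1 : ℝ≥0∞) ≤ 2)
  have h2 : ∀ i, eLpNorm (weakPartial Ω i fun x => u x + v x) 2 (volume.restrict Ω) ≤
      eLpNorm (weakPartial Ω i u) 2 (volume.restrict Ω) +
        eLpNorm (weakPartial Ω i v) 2 (volume.restrict Ω) := fun i => by
    rw [eLpNorm_congr_ae (weakPartial_add hΩ hu hv i)]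
    exact eLpNorm_add_le (hu.memLp_weakPartial hΩ i).1 (hv.memLp_weakPartial hΩ i).1 one_le_two
  calc h1e Ω (fun x => u x + v x) ≤ _ + ∑ i, _ :=
        add_le_add h1 (Finset.sum_le_sum fun i _ => h2 i)
    _ = _ := by rw [Finset.sum_add_distrib, h1e, h1e]; abel

theorem h1e_const_mul (hΩ : IsOpen Ω) (hu : MemW1 Ω 2 u) (c : ℝ) :
    h1e Ω (fun x => c * u x) = ‖c‖ₑ * h1e Ω u := by
  have h2 : ∀ i, eLpNorm (weakPartial Ω i fun x => c * u x) 2 (volume.restrict Ω) =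
      ‖c‖ₑ * eLpNorm (weakPartial Ω i u) 2 (volume.restrict Ω) := fun i => by
    rw [eLpNorm_congr_ae (weakPartial_const_mul hΩ hu c i)]
    exact eLpNorm_const_smul c (weakPartial Ω i u) 2 _
  have h1 : eLpNorm (fun x => c * u x) 2 (volume.restrict Ω) =
      ‖c‖ₑ * eLpNorm u 2 (volume.restrict Ω) := eLpNorm_const_smul c u 2 _
  simp only [h1e, h2, h1, mul_add, Finset.mul_sum]

/-- Convergence in `H^1(Ω)`. -/
def TendstoH1 (Ω : Set (E d)) (φ : ℕ → E d → ℝ) (u : E d → ℝ) : Prop :=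
  Tendsto (fun n => h1e Ω fun x => φ n x - u x) atTop (𝓝 0)

/-- `H^1_0(Ω)`. -/
def MemH0 (Ω : Set (E d)) (u : E d → ℝ) : Prop :=
  MemW1 Ω 2 u ∧ ∃ φ : ℕ → E d → ℝ, (∀ n, IsTest Ω (φ n)) ∧ TendstoH1 Ω φ u

/-- The functions of `H^1(Ω)` which are limits of functions smooth up to the boundary. -/
def MemHs (Ω : Set (E d)) (u : E d → ℝ) : Prop :=
  MemW1 Ω 2 u ∧ ∃ φ : ℕ → E d → ℝ, (∀ n, ContDiff ℝ ∞ (φ n)) ∧ TendstoH1 Ω φ u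

theorem MemH0.memHs (h : MemH0 Ω u) : MemHs Ω u :=
  ⟨h.1, h.2.choose, fun n => (h.2.choose_spec.1 n).1, h.2.choose_spec.2⟩

theorem memW1_of_contDiff (hΩ : IsOpen Ω) (hb : Bornology.IsBounded Ω) (hv : ContDiff ℝ ∞ v) :
    MemW1 Ω q v := (isW1Lip_of_contDiff hb (hv.of_le (by simp))).memW1 hΩ hb

theorem IsTest.memW1 (hΩ : IsOpen Ω) (hb : Bornology.IsBounded Ω) (hv : IsTest Ω v) :
    MemW1 Ω q v := memW1_of_contDiff hΩ hb hv.1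

theorem TendstoH1.add (hΩ : IsOpen Ω) {φ ψ : ℕ → E d → ℝ} (hφ : ∀ n, MemW1 Ω 2 (φ n))
    (hψ : ∀ n, MemW1 Ω 2 (ψ n)) (hu : MemW1 Ω 2 u) (hv : MemW1 Ω 2 v)
    (h : TendstoH1 Ω φ u) (h' : TendstoH1 Ω ψ v) :
    TendstoH1 Ω (fun n x => φ n x + ψ n x) (fun x => u x + v x) := by
  refine tendsto_of_tendsto_of_tendsto_of_le_of_le tendsto_const_nhds
    (by simpa using Tendsto.add h h') (fun n => zero_le) fun n => ?_
  refine le_trans (le_of_eq ?_) (h1e_add_le hΩ ((hφ n).sub hΩ hu) ((hψ n).sub hΩ hv))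
  congr 1; ext x; ring

theorem TendstoH1.const_mul (hΩ : IsOpen Ω) {φ : ℕ → E d → ℝ} (hφ : ∀ n, MemW1 Ω 2 (φ n))
    (hu : MemW1 Ω 2 u) (h : TendstoH1 Ω φ u) (c : ℝ) :
    TendstoH1 Ω (fun n x => c * φ n x) (fun x => c * u x) := by
  have : ∀ n, h1e Ω (fun x => c * φ n x - c * u x) = ‖c‖ₑ * h1e Ω fun x => φ n x - u x :=
    fun n => by
      rw [← h1e_const_mul hΩ ((hφ n).sub hΩ hu)]
      congr 1; ext x; ring
  simp only [TendstoH1, this]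
  simpa using ENNReal.Tendsto.const_mul h (Or.inr enorm_ne_top)

theorem IsTest.add (hu : IsTest Ω u) (hv : IsTest Ω v) : IsTest Ω fun x => u x + v x :=
  ⟨hu.1.add hv.1, hu.2.1.add hv.2.1,
    (tsupport_add (f := u) (g := v)).trans (union_subset hu.2.2 hv.2.2)⟩

theorem IsTest.const_mul (hu : IsTest Ω u) (c : ℝ) : IsTest Ω fun x => c * u x :=
  ⟨contDiff_const.mul hu.1, hu.2.1.mul_left,
    (tsupport_mul_subset_right (f := fun _ => c) (g := u)).trans hu.2.2⟩

theorem MemH0.add (hΩ : IsOpen Ω) (hb : Bornology.IsBounded Ω) (hu : MemH0 Ω u)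
    (hv : MemH0 Ω v) : MemH0 Ω fun x => u x + v x := by
  obtain ⟨hu, φ, hφ, h⟩ := hu
  obtain ⟨hv, ψ, hψ, h'⟩ := hv
  exact ⟨hu.add hΩ hv, _, fun n => (hφ n).add (hψ n),
    h.add hΩ (fun n => (hφ n).memW1 hΩ hb) (fun n => (hψ n).memW1 hΩ hb) hu hv h'⟩

theorem MemH0.const_mul (hΩ : IsOpen Ω) (hb : Bornology.IsBounded Ω) (hu : MemH0 Ω u) (c : ℝ) :
    MemH0 Ω fun x => c * u x := by
  obtain ⟨hu, φ, hφ, h⟩ := hu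
  exact ⟨hu.const_mul hΩ c, _, fun n => (hφ n).const_mul c,
    h.const_mul hΩ (fun n => (hφ n).memW1 hΩ hb) hu c⟩

theorem MemHs.add (hΩ : IsOpen Ω) (hb : Bornology.IsBounded Ω) (hu : MemHs Ω u)
    (hv : MemHs Ω v) : MemHs Ω fun x => u x + v x := by
  obtain ⟨hu, φ, hφ, h⟩ := hu
  obtain ⟨hv, ψ, hψ, h'⟩ := hv
  exact ⟨hu.add hΩ hv, _, fun n => (hφ n).add (hψ n),
    h.add hΩ (fun n => memW1_of_contDiff hΩ hb (hφ n)) (fun n => memW1_of_contDiff hΩ hb (hψ n))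
      hu hv h'⟩

theorem MemHs.const_mul (hΩ : IsOpen Ω) (hb : Bornology.IsBounded Ω) (hu : MemHs Ω u) (c : ℝ) :
    MemHs Ω fun x => c * u x := by
  obtain ⟨hu, φ, hφ, h⟩ := hu
  exact ⟨hu.const_mul hΩ c, _, fun n => contDiff_const.mul (hφ n),
    h.const_mul hΩ (fun n => memW1_of_contDiff hΩ hb (hφ n)) hu c⟩

theorem MemH0.congr (hu : MemH0 Ω u) (h : u =ᵐ[volume.restrict Ω] v) : MemH0 Ω v := by
  obtain ⟨h1, φ, hφ, h2⟩ := hu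
  refine ⟨h1.congr h, φ, hφ, ?_⟩
  refine h2.congr fun n => h1e_congr ?_
  filter_upwards [h] with x hx
  rw [hx]

/-- `H^1_0(Ω)` is closed in `H^1(Ω)`. -/
theorem memH0_of_tendstoH1 (hΩ : IsOpen Ω) (hb : Bornology.IsBounded Ω) (hu : MemW1 Ω 2 u)
    {φ : ℕ → E d → ℝ} (hφ : ∀ n, MemH0 Ω (φ n)) (h : TendstoH1 Ω φ u) : MemH0 Ω u := by
  have hex : ∀ n : ℕ, ∃ ψ, IsTest Ω ψ ∧ h1e Ω (fun x => ψ x - φ n x) ≤ ((n : ℝ≥0∞) + 1)⁻¹ := by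
    intro n
    obtain ⟨-, ψ, hψ, hl⟩ := hφ n
    have hp : (0 : ℝ≥0∞) < ((n : ℝ≥0∞) + 1)⁻¹ := by simp
    obtain ⟨m, hm⟩ := (Tendsto.eventually_lt_const hp hl).exists
    exact ⟨ψ m, hψ m, hm.le⟩
  choose ψ hψ hψl using hex
  refine ⟨hu, ψ, hψ, ?_⟩
  have h0 : Tendsto (fun n : ℕ => ((n : ℝ≥0∞) + 1)⁻¹) atTop (𝓝 0) := by
    have := (ENNReal.tendsto_inv_nat_nhds_zero).comp (tendsto_add_atTop_nat 1)
    refine this.congr fun n => by simp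
  refine tendsto_of_tendsto_of_tendsto_of_le_of_le tendsto_const_nhds
    (by simpa using h0.add h) (fun n => zero_le) fun n => ?_
  refine le_trans (le_of_eq ?_) ((h1e_add_le hΩ (((hψ n).memW1 hΩ hb).sub hΩ (hφ n).1)
    ((hφ n).1.sub hΩ hu)).trans (add_le_add_left (hψl n) _))
  congr 1; ext x; ring

/-- A bounded pointwise convergent sequence converges in `L^2` on a bounded set. -/
theorem tendsto_eLpNorm_of_bounded (hb : Bornology.IsBounded Ω) {f : ℕ → E d → ℝ}
    {f₀ : E d → ℝ} {M : ℝ} (hm : ∀ n, AEStronglyMeasurable (f n) (volume.restrict Ω))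
    (hM : ∀ n, ∀ᵐ x ∂(volume.restrict Ω), |f n x| ≤ M)
    (hl : ∀ᵐ x ∂(volume.restrict Ω), Tendsto (fun n => f n x) atTop (𝓝 (f₀ x))) :
    Tendsto (fun n => eLpNorm (fun x => f n x - f₀ x) 2 (volume.restrict Ω)) atTop (𝓝 0) := by
  have := isFiniteMeasure_restrict hb
  have hm0 : AEStronglyMeasurable f₀ (volume.restrict Ω) :=
    aestronglyMeasurable_of_tendsto_ae atTop hm hl
  have hM0 : ∀ᵐ x ∂(volume.restrict Ω), |f₀ x| ≤ M := by
    filter_upwards [ae_all_iff.2 hM, hl] with x hx hx'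
    exact le_of_tendsto hx'.abs (Eventually.of_forall hx)
  have key : Tendsto (fun n => ∫⁻ x in Ω, ‖f n x - f₀ x‖ₑ ^ (2 : ℝ)) atTop (𝓝 0) := by
    have := tendsto_lintegral_of_dominated_convergence' (μ := volume.restrict Ω)
      (F := fun n x => ‖f n x - f₀ x‖ₑ ^ (2 : ℝ)) (f := fun _ => 0)
      (fun _ => ENNReal.ofReal (2 * M) ^ (2 : ℝ)) (fun n => ?_) (fun n => ?_) ?_ ?_
    · simpa using this
    · exact ((hm n).sub hm0).enorm.pow_const _
    · filter_upwards [hM n, hM0] with x h1 h2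
      gcongr
      rw [← ofReal_norm, Real.norm_eq_abs]
      exact ENNReal.ofReal_le_ofReal ((abs_sub _ _).trans (by linarith))
    · rw [lintegral_const]
      exact ENNReal.mul_ne_top (ENNReal.rpow_ne_top_of_nonneg (by norm_num) ENNReal.ofReal_ne_top)
        (measure_ne_top _ _)
    · filter_upwards [hl] with x hx
      have h1 : Tendsto (fun n => f n x - f₀ x) atTop (𝓝 0) := by
        simpa using hx.sub_const (f₀ x)
      have h2 : Tendsto (fun n => ‖f n x - f₀ x‖ₑ) atTop (𝓝 0) := by
        simpa using h1.enorm
      simpa using h2.ennrpow_const 2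
  simp only [eLpNorm_eq_lintegral_rpow_enorm_toReal (p := 2) (by simp) (by simp)]
  simpa using key.ennrpow_const (1 / 2)

theorem isW1Lip_of_lipschitzWith {C : ℝ≥0} (hψ : LipschitzWith C u) (hc : HasCompactSupport u) :
    IsW1Lip Ω u := by
  obtain ⟨M, hM⟩ := hc.exists_bound_of_continuous hψ.continuous
  exact ⟨⟨M, fun x _ => hM x⟩, C, fun x _ => ⟨univ, univ_mem, hψ.lipschitzOnWith⟩⟩

/-- A sequence of Lipschitz functions converges in `H^1` if it is bounded and converges almost
everywhere, together with its derivatives. -/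
theorem tendstoH1_of_bounded (hΩ : IsOpen Ω) (hb : Bornology.IsBounded Ω) {φ : ℕ → E d → ℝ} {M : ℝ}
    (hφ : ∀ n, IsW1Lip Ω (φ n)) (hu : IsW1Lip Ω u)
    (hM : ∀ n, ∀ᵐ x ∂(volume.restrict Ω), |φ n x| ≤ M)
    (hl : ∀ᵐ x ∂(volume.restrict Ω), Tendsto (fun n => φ n x) atTop (𝓝 (u x)))
    (hM' : ∀ n i, ∀ᵐ x ∂(volume.restrict Ω), |lineDeriv ℝ (φ n) x (basisVec i)| ≤ M)
    (hl' : ∀ i, ∀ᵐ x ∂(volume.restrict Ω), Tendsto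
      (fun n => lineDeriv ℝ (φ n) x (basisVec i)) atTop (𝓝 (lineDeriv ℝ u x (basisVec i)))) :
    TendstoH1 Ω φ u := by
  have h1 := tendsto_eLpNorm_of_bounded hb (fun n => (hφ n).aestronglyMeasurable hΩ) hM hl
  have h2 : ∀ i, Tendsto (fun n => eLpNorm (weakPartial Ω i fun x => φ n x - u x) 2
      (volume.restrict Ω)) atTop (𝓝 0) := fun i => by
    refine (tendsto_eLpNorm_of_bounded hb
      (fun n => (hφ n).aestronglyMeasurable_lineDeriv hΩ (basisVec i))
      (fun n => hM' n i) (hl' i)).congr fun n => eLpNorm_congr_ae ?_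
    filter_upwards [weakPartial_sub (q := 2) hΩ ((hφ n).memW1 hΩ hb) (hu.memW1 hΩ hb) i,
      (hφ n).weakPartial_ae hΩ i, hu.weakPartial_ae hΩ i] with x e1 e2 e3
    rw [e1, e2, e3]
  have := h1.add (tendsto_finsetSum Finset.univ fun i _ => h2 i)
  simpa [TendstoH1, h1e] using this

theorem IsTest.memH0 (hΩ : IsOpen Ω) (hb : Bornology.IsBounded Ω) (hu : IsTest Ω u) :
    MemH0 Ω u := by
  refine ⟨hu.memW1 hΩ hb, fun _ => u, fun _ => hu, ?_⟩
  refine tendsto_const_nhds.congr fun n => ?_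
  have : (fun x => u x - u x) = fun x => 0 * u x := by ext x; ring
  rw [this, h1e_const_mul hΩ (hu.memW1 hΩ hb)]; simp

theorem memH0_of_lipschitzWith (hΩ : IsOpen Ω) (hb : Bornology.IsBounded Ω) {C : ℝ≥0}
    (hψ : LipschitzWith C u) (hc : HasCompactSupport u) (hs : tsupport u ⊆ Ω) : MemH0 Ω u := by
  obtain ⟨φ, K, M, -, -, -, hφ, -, hφM, hdM, hlim, hdlim⟩ := exists_test_approx hΩ hψ hc hs
  have hu := isW1Lip_of_lipschitzWith (Ω := Ω) hψ hc
  have e : ∀ n x i, lineDeriv ℝ (φ n) x (basisVec i) = fderiv ℝ (φ n) x (basisVec i) :=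
    fun n x i => ((hφ n).1.contDiffAt.differentiableAt (by simp)).lineDeriv_eq_fderiv
  refine ⟨hu.memW1 hΩ hb, φ, hφ, tendstoH1_of_bounded hΩ hb (M := M)
    (fun n => isW1Lip_of_contDiff hb ((hφ n).1.of_le (by simp))) hu
    (fun n => ae_of_all _ (hφM n)) (ae_of_all _ hlim) (fun n i => ae_of_all _ fun x => ?_)
    (fun i => ?_)⟩
  · rw [e]; exact hdM n x i
  · simp only [e]; exact ae_restrict_of_ae (hdlim i)

theorem eLpNorm_mul_le_top {p : ℝ≥0∞} {μ : Measure (E d)} (hu : AEStronglyMeasurable u μ)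
    (hv : AEStronglyMeasurable v μ) :
    eLpNorm (fun x => u x * v x) p μ ≤ eLpNorm v ⊤ μ * eLpNorm u p μ := by
  have := eLpNorm_smul_le_mul_eLpNorm (p := ⊤) (q := p) (r := p) hu hv
  refine le_trans (le_of_eq ?_) this
  congr 1; ext x; simp [mul_comm]

/-- Multiplication by a Lipschitz function is continuous on `H^1(Ω)`. -/
theorem exists_h1e_mul_lip_le (hΩ : IsOpen Ω) (hv : IsW1Lip Ω v) :
    ∃ C : ℝ≥0∞, C ≠ ⊤ ∧ ∀ u, MemW1 Ω 2 u → h1e Ω (fun x => u x * v x) ≤ C * h1e Ω u := by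
  set μ := volume.restrict Ω
  refine ⟨eLpNorm v ⊤ μ + ∑ i, (eLpNorm v ⊤ μ + eLpNorm (weakPartial Ω i v) ⊤ μ), ?_, ?_⟩
  · exact ENNReal.add_ne_top.2 ⟨(hv.memLp_top hΩ).2.ne, ENNReal.sum_ne_top.2 fun i _ =>
      ENNReal.add_ne_top.2 ⟨(hv.memLp_top hΩ).2.ne, (hv.memLp_top_weakPartial hΩ i).2.ne⟩⟩
  · intro u hu
    rw [add_mul, Finset.sum_mul]
    have hvm := (hv.memLp_top hΩ).1
    refine add_le_add ((eLpNorm_mul_le_top hu.1.1 hvm).trans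
      (mul_le_mul_right eLpNorm_le_h1e _)) (Finset.sum_le_sum fun i _ => ?_)
    rw [eLpNorm_congr_ae (weakPartial_mul_lip hΩ hu hv i), add_mul]
    have hdm := (hv.memLp_top_weakPartial hΩ i).1
    have hum := (hu.memLp_weakPartial hΩ i).1
    refine (eLpNorm_add_le (hum.mul hvm) (hu.1.1.mul hdm) one_le_two).trans (add_le_add ?_ ?_)
    · exact (eLpNorm_mul_le_top hum hvm).trans (mul_le_mul_right (eLpNorm_weakPartial_le_h1e i) _)
    · exact (eLpNorm_mul_le_top hu.1.1 hdm).trans (mul_le_mul_right eLpNorm_le_h1e _)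

theorem MemH0.mul_lip (hΩ : IsOpen Ω) (hb : Bornology.IsBounded Ω) (hu : MemH0 Ω u)
    (hv : IsW1Lip Ω v) : MemH0 Ω fun x => u x * v x := by
  obtain ⟨hu, φ, hφ, h⟩ := hu
  obtain ⟨C, hC, hle⟩ := exists_h1e_mul_lip_le hΩ hv
  refine memH0_of_tendstoH1 hΩ hb (hu.mul_lip hΩ hv) (φ := fun n x => φ n x * v x)
    (fun n => ?_) ?_
  · obtain ⟨⟨D, hD⟩, hc, hs⟩ := hv.exists_lipschitzWith_mul_test (hφ n)
    simpa only [mul_comm] using memH0_of_lipschitzWith hΩ hb hD hc hs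
  · refine tendsto_of_tendsto_of_tendsto_of_le_of_le tendsto_const_nhds
      (by simpa using ENNReal.Tendsto.const_mul h (Or.inr hC)) (fun n => zero_le) fun n => ?_
    refine le_trans (le_of_eq ?_) (hle _ (((hφ n).memW1 hΩ hb).sub hΩ hu))
    congr 1; ext x; ring

theorem enorm_integral_mul_le {μ : Measure (E d)} (hu : AEStronglyMeasurable u μ)
    (hv : AEStronglyMeasurable v μ) :
    ‖∫ x, u x * v x ∂μ‖ₑ ≤ eLpNorm u 2 μ * eLpNorm v 2 μ := by
  refine (enorm_integral_le_lintegral_enorm _).trans ?_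
  rw [← eLpNorm_one_eq_lintegral_enorm]
  have h := eLpNorm_smul_le_mul_eLpNorm (p := 2) (q := 2) (r := 1) hv hu
  rwa [smul_eq_mul] at h

theorem tendsto_integral_mul {μ : Measure (E d)} {f : ℕ → E d → ℝ} (hu : MemLp u 2 μ)
    (hf : ∀ n, MemLp (f n) 2 μ) (hv : MemLp v 2 μ)
    (h : Tendsto (fun n => eLpNorm (fun x => f n x - v x) 2 μ) atTop (𝓝 0)) :
    Tendsto (fun n => ∫ x, u x * f n x ∂μ) atTop (𝓝 (∫ x, u x * v x ∂μ)) := by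
  rw [tendsto_iff_edist_tendsto_0]
  refine tendsto_of_tendsto_of_tendsto_of_le_of_le tendsto_const_nhds
    (by simpa using ENNReal.Tendsto.const_mul h (Or.inr hu.2.ne)) (fun n => zero_le) fun n => ?_
  rw [edist_eq_enorm_sub, ← integral_sub (f := fun x => u x * f n x)
    (g := fun x => u x * v x) (hu.integrable_mul (hf n)) (hu.integrable_mul hv)]
  simp only [← mul_sub]
  exact enorm_integral_mul_le hu.1 ((hf n).sub hv).1

/-- Integration by parts against a function of `H^1_0(Ω)`. -/
theorem integral_mul_weakPartial_eq (hΩ : IsOpen Ω) (hb : Bornology.IsBounded Ω)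
    (h : HasWeakPartial Ω i u g) (hu : MemLp u 2 (volume.restrict Ω))
    (hg : MemLp g 2 (volume.restrict Ω)) (hv : MemH0 Ω v) :
    ∫ x in Ω, u x * weakPartial Ω i v x = -∫ x in Ω, g x * v x := by
  obtain ⟨hv, φ, hφ, hl⟩ := hv
  have h1 : Tendsto (fun n => eLpNorm (fun x => φ n x - v x) 2 (volume.restrict Ω)) atTop (𝓝 0) :=
    tendsto_of_tendsto_of_tendsto_of_le_of_le tendsto_const_nhds hl (fun n => zero_le)
      fun n => eLpNorm_le_h1e
  have h2 : Tendsto (fun n => eLpNorm (fun x => weakPartial Ω i (φ n) x - weakPartial Ω i v x) 2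
      (volume.restrict Ω)) atTop (𝓝 0) := by
    refine tendsto_of_tendsto_of_tendsto_of_le_of_le tendsto_const_nhds hl (fun n => zero_le)
      fun n => ?_
    rw [← eLpNorm_congr_ae (weakPartial_sub hΩ ((hφ n).memW1 hΩ hb) hv i)]
    exact eLpNorm_weakPartial_le_h1e i
  have l1 := tendsto_integral_mul hu (fun n => ((hφ n).memW1 hΩ hb).memLp_weakPartial hΩ i)
    (hv.memLp_weakPartial hΩ i) h2
  have l2 := tendsto_integral_mul hg (fun n => ((hφ n).memW1 hΩ hb (q := 2)).1) hv.1 h1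
  refine tendsto_nhds_unique l1 (l2.neg.congr fun n => ?_)
  rw [← h.2.2 (φ n) (hφ n)]
  refine integral_congr_ae ?_
  filter_upwards [weakPartial_of_contDiff hΩ hb ((hφ n).1.of_le (by simp)) i] with x hx
  rw [hx]

end SobolevClasses

section MeshFunctions

/-- A continuous function which is Lipschitz on each of finitely many closed sets that cover a
segment is Lipschitz along the segment. -/
theorem sub_le_of_lipschitzOnWith_cover {ι : Type*} [Finite ι] {s : ι → Set (E d)}
    (hs : ∀ k, IsClosed (s k)) {v : E d → ℝ} {K : ℝ≥0} (hK : ∀ k, LipschitzOnWith K v (s k))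
    {x y : E d} (hc : segment ℝ x y ⊆ ⋃ k, s k) (hv : ContinuousOn v (segment ℝ x y)) :
    v y - v x ≤ K * dist x y := by
  have hseg : ∀ t ∈ Icc (0 : ℝ) 1, AffineMap.lineMap x y t ∈ segment ℝ x y := fun t ht => by
    rw [segment_eq_image_lineMap]; exact mem_image_of_mem _ ht
  have hlc : Continuous fun t : ℝ => AffineMap.lineMap x y t :=
    (AffineMap.lineMap x y : ℝ →ᵃ[ℝ] E d).continuous_of_finiteDimensional
  have h := image_le_of_liminf_slope_right_le_deriv_boundary (a := 0) (b := 1)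
    (f := fun t => v (AffineMap.lineMap x y t)) (B := fun t => v x + t * (K * dist x y))
    (B' := fun _ => K * dist x y) (hv.comp hlc.continuousOn hseg) (by simp) (by fun_prop)
    (fun t _ => by
      simpa using (((hasDerivAt_id t).mul_const (K * dist x y)).const_add (v x)).hasDerivWithinAt)
    ?_ (right_mem_Icc.2 zero_le_one)
  · simp only [AffineMap.lineMap_apply_one, one_mul] at h; linarith
  intro t ht r hr
  have hz : ∀ᶠ z in 𝓝[>] t, z ∈ Ioo t 1 := Ioo_mem_nhdsGT ht.2
  have hfr : ∃ k, ∃ᶠ z in 𝓝[>] t, AffineMap.lineMap x y z ∈ s k := by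
    by_contra hcon
    push Not at hcon
    have := (eventually_all.2 hcon).and hz
    obtain ⟨z, h1, h2⟩ := this.exists
    obtain ⟨k, hk⟩ := mem_iUnion.1 (hc (hseg z ⟨ht.1.trans h2.1.le, h2.2.le⟩))
    exact h1 k hk
  obtain ⟨k, hk⟩ := hfr
  have htk : AffineMap.lineMap x y t ∈ s k := by
    refine (hs k).mem_of_frequently_of_tendsto hk ?_
    exact (hlc.tendsto t).mono_left nhdsWithin_le_nhds
  refine (hk.and_eventually hz).mono fun z hz => ?_
  have hpos : 0 < z - t := sub_pos.2 hz.2.1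
  refine lt_of_le_of_lt ?_ hr
  rw [slope_def_field, div_le_iff₀ hpos]
  have h1 := (hK k).dist_le_mul _ hz.1 _ htk
  rw [dist_lineMap_lineMap, Real.dist_eq, Real.dist_eq, abs_of_pos hpos] at h1
  calc _ ≤ _ := le_abs_self _
    _ ≤ _ := h1
    _ = _ := by ring

variable {Ω : Set (E d)} (T : Triangulation Ω) {v : E d → ℝ}

namespace Triangulation

theorem isCompact_elem (k : Fin T.N) : IsCompact (T.elem k) :=
  (finite_range _).isCompact_convexHull ℝ

theorem elem_subset (k : Fin T.N) : T.elem k ⊆ closure Ω := by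
  rw [T.cover]; exact subset_iUnion_of_subset k subset_rfl

theorem interior_elem_subset (hr : interior (closure Ω) = Ω) (k : Fin T.N) :
    interior (T.elem k) ⊆ Ω := by
  exact (interior_mono (T.elem_subset k)).trans hr.subset

theorem exists_mem_elem {x : E d} (hx : x ∈ closure Ω) : ∃ k, x ∈ T.elem k := by
  rw [T.cover] at hx; exact mem_iUnion.1 hx

theorem mem_elem_iff {k : Fin T.N} {x : E d} :
    x ∈ T.elem k ↔ ∀ i, 0 ≤ (T.vert k).coord i x := by
  rw [elem, AffineBasis.convexHull_eq_nonneg_coord]; rfl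

theorem mem_interior_elem_iff {k : Fin T.N} {x : E d} :
    x ∈ interior (T.elem k) ↔ ∀ i, 0 < (T.vert k).coord i x := by
  rw [elem, AffineBasis.interior_convexHull]; rfl

theorem exists_lipschitzOnWith_of_elem (hΩ : IsOpen Ω) (hv : ContinuousOn v (closure Ω)) {K : ℝ≥0}
    (hK : ∀ k, LipschitzOnWith K v (T.elem k)) {x : E d} (hx : x ∈ Ω) :
    ∃ t ∈ 𝓝 x, LipschitzOnWith K v t := by
  obtain ⟨r, hr, hrΩ⟩ := Metric.isOpen_iff.1 hΩ x hx
  refine ⟨Metric.ball x r, Metric.ball_mem_nhds x hr, LipschitzOnWith.of_dist_le_mul ?_⟩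
  have key : ∀ y ∈ Metric.ball x r, ∀ z ∈ Metric.ball x r, v z - v y ≤ K * dist y z := by
    intro y hy z hz
    have hs : segment ℝ y z ⊆ closure Ω :=
      (((convex_ball x r).segment_subset hy hz).trans hrΩ).trans subset_closure
    refine sub_le_of_lipschitzOnWith_cover (s := T.elem) (fun k => (T.isCompact_elem k).isClosed)
      hK ?_ (hv.mono hs)
    intro p hp
    exact mem_iUnion.2 (T.exists_mem_elem (hs hp))
  intro y hy z hz
  rw [Real.dist_eq, abs_le]
  have h1 := key y hy z hz
  have h2 := key z hz y hy
  rw [dist_comm z y] at h2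
  constructor <;> linarith

theorem isW1Lip_of_piecewise (hΩ : IsOpen Ω) (hb : Bornology.IsBounded Ω)
    (hv : ContinuousOn v (closure Ω))
    (h : ∀ k, ∃ P : E d → ℝ, ContDiff ℝ 1 P ∧ EqOn v P (T.elem k)) : IsW1Lip Ω v := by
  have hK : ∀ k, ∃ K, LipschitzOnWith K v (T.elem k) := fun k => by
    obtain ⟨P, hP, he⟩ := h k
    obtain ⟨K, hK⟩ := (hP.locallyLipschitz.locallyLipschitzOn
      (s := T.elem k)).exists_lipschitzOnWith_of_compact (T.isCompact_elem k)
    exact ⟨K, fun x hx y hy => by rw [he hx, he hy]; exact hK hx hy⟩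
  choose K hK using hK
  obtain ⟨C, hC⟩ := hb.isCompact_closure.exists_bound_of_continuousOn hv
  refine ⟨⟨C, fun x hx => hC x (subset_closure hx)⟩, ∑ k, K k, fun x hx => ?_⟩
  refine T.exists_lipschitzOnWith_of_elem hΩ hv (fun k => (hK k).weaken ?_) hx
  exact Finset.single_le_sum (fun _ _ => zero_le) (Finset.mem_univ k)

end Triangulation

theorem contDiff_affineMap (A : E d →ᵃ[ℝ] ℝ) {n : WithTop ℕ∞} : ContDiff ℝ n A := by
  have : (A : E d → ℝ) = fun x => A.linear.toContinuousLinearMap x + A 0 := by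
    ext x
    have := congrFun A.decomp x
    simpa using this
  rw [this]
  exact (ContinuousLinearMap.contDiff _).add contDiff_const

namespace Triangulation

theorem contDiff_bubble (k : Fin T.N) {n : WithTop ℕ∞} : ContDiff ℝ n (T.bubble k) :=
  contDiff_prod fun _ _ => contDiff_affineMap _

variable {T}

theorem MemXh.isW1Lip {w : E d → E d} (hΩ : IsOpen Ω) (hb : Bornology.IsBounded Ω)
    (hw : T.MemXh w) (j : Fin d) : IsW1Lip Ω fun x => w x j := by
  refine T.isW1Lip_of_piecewise hΩ hb ?_ fun k => ?_
  · exact (EuclideanSpace.proj (𝕜 := ℝ) j).continuous.comp_continuousOn hw.1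
  · obtain ⟨A, c, h⟩ := hw.2 k j
    exact ⟨fun x => A x + c * T.bubble k x,
      (contDiff_affineMap A).add (contDiff_const.mul (T.contDiff_bubble k)), h⟩

theorem MemMh.isW1Lip {q : E d → ℝ} (hΩ : IsOpen Ω) (hb : Bornology.IsBounded Ω)
    (hq : T.MemMh q) : IsW1Lip Ω q := by
  refine T.isW1Lip_of_piecewise hΩ hb hq.1 fun k => ?_
  obtain ⟨A, h⟩ := hq.2 k
  exact ⟨A, contDiff_affineMap A, h⟩

/-- A function of `M_h` whose gradient vanishes on every element is constant. -/
theorem MemMh.const_of_linear_eq_zero {q : E d → ℝ} (hΩ : IsOpen Ω) (hΩc : IsConnected Ω)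
    (hq : ContinuousOn q (closure Ω))
    (h : ∀ k, ∃ A : E d →ᵃ[ℝ] ℝ, A.linear = 0 ∧ ∀ x ∈ T.elem k, q x = A x) :
    ∃ c, ∀ x ∈ closure Ω, q x = c := by
  have hl : ∀ x ∈ Ω, ∃ t ∈ 𝓝 x, LipschitzOnWith 0 q t := fun x hx => by
    refine T.exists_lipschitzOnWith_of_elem hΩ hq (fun k => ?_) hx
    obtain ⟨A, hA, hqA⟩ := h k
    refine LipschitzOnWith.of_dist_le_mul fun y hy z hz => ?_
    rw [hqA y hy, hqA z hz, dist_eq_norm]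
    have := A.linearMap_vsub y z
    rw [hA] at this
    simp only [vsub_eq_sub, LinearMap.zero_apply] at this
    rw [← this]; simp
  have he : ∀ x ∈ Ω, q =ᶠ[𝓝 x] fun _ => q x := fun x hx => by
    obtain ⟨t, ht, hlt⟩ := hl x hx
    filter_upwards [ht] with y hy
    have := hlt.dist_le_mul y hy x (mem_of_mem_nhds ht)
    simpa using this
  obtain ⟨c, hc⟩ := hΩ.exists_is_const_of_fderiv_eq_zero (𝕜 := ℝ) hΩc.isPreconnected
    (f := q) (fun x hx => ((differentiableAt_const (q x)).congr_of_eventuallyEq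
      (he x hx)).differentiableWithinAt)
    (fun x hx => by rw [(he x hx).fderiv_eq]; simp)
  refine ⟨c, fun x hx => ?_⟩
  have : EqOn q (fun _ => c) (closure Ω) :=
    EqOn.of_subset_closure (s := Ω) (fun y hy => hc y hy) hq continuousOn_const subset_closure
      subset_rfl
  exact this hx

end Triangulation

/-- A non-negative Lipschitz function with compact support which vanishes outside `Ω` belongs to
`H^1_0(Ω)`. -/
theorem memH0_of_nonneg (hΩ : IsOpen Ω) (hb : Bornology.IsBounded Ω) {u : E d → ℝ} {C : ℝ≥0}
    (hu : LipschitzWith C u) (hc : HasCompactSupport u) (h0 : ∀ x, 0 ≤ u x)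
    (hs : ∀ x, 0 < u x → x ∈ Ω) : MemH0 Ω u := by
  obtain ⟨M, hM⟩ := hc.exists_bound_of_continuous hu.continuous
  let δ : ℕ → ℝ := fun n => ((n : ℝ) + 1)⁻¹
  have hδ : ∀ n, 0 < δ n := fun n => by positivity
  have hδl : Tendsto δ atTop (𝓝 0) :=
    tendsto_inv_atTop_zero.comp (tendsto_atTop_add_const_right _ _ tendsto_natCast_atTop_atTop)
  let φ : ℕ → E d → ℝ := fun n x => max (u x - δ n) 0
  have hφL : ∀ n, LipschitzWith C (φ n) := fun n => by
    have : LipschitzWith C fun x => u x - δ n := by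
      refine LipschitzWith.of_dist_le_mul fun x y => ?_
      rw [dist_sub_right]; exact hu.dist_le_mul x y
    exact this.max_const 0
  have hsub : ∀ n, Function.support (φ n) ⊆ {x | δ n ≤ u x} := fun n x hx => by
    by_contra hcon
    simp only [mem_ofPred_eq, not_le] at hcon
    exact hx (max_eq_right (by linarith))
  have hcl : ∀ n, IsClosed {x | δ n ≤ u x} := fun n => isClosed_le continuous_const hu.continuous
  have hts : ∀ n, tsupport (φ n) ⊆ {x | δ n ≤ u x} := fun n => closure_minimal (hsub n) (hcl n)
  have hφc : ∀ n, HasCompactSupport (φ n) := fun n => by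
    refine hc.mono' fun x hx => subset_tsupport _ fun h => ?_
    have := hsub n hx
    simp only [mem_ofPred_eq] at this
    linarith [hδ n]
  have hlip := fun n => isW1Lip_of_lipschitzWith (Ω := Ω) (hφL n) (hφc n)
  have hulip := isW1Lip_of_lipschitzWith (Ω := Ω) hu hc
  refine memH0_of_tendstoH1 hΩ hb (hulip.memW1 hΩ hb) (φ := φ) (fun n =>
    memH0_of_lipschitzWith hΩ hb (hφL n) (hφc n)
      (fun x hx => hs x ((hδ n).trans_le (hts n hx)))) ?_
  have hlin : ∀ x, Tendsto (fun n => u x - δ n) atTop (𝓝 (u x)) := fun x => by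
    simpa using tendsto_const_nhds.sub hδl
  refine tendstoH1_of_bounded hΩ hb (M := max M C) hlip hulip (fun n => ae_of_all _ fun x => ?_)
    (ae_of_all _ fun x => ?_) (fun n i => ae_of_all _ fun x => ?_) (fun i => ?_)
  · refine le_trans ?_ (le_max_left _ _)
    refine le_trans ?_ (hM x)
    rw [Real.norm_eq_abs, abs_of_nonneg (h0 x), abs_of_nonneg (le_max_right _ _)]
    exact max_le (by linarith [hδ n]) (h0 x)
  · have := (hlin x).max (tendsto_const_nhds (x := (0 : ℝ)))
    rwa [max_eq_left (h0 x)] at this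
  · refine le_trans ?_ (le_max_right _ _)
    simpa using norm_lineDeriv_le_of_lipschitz ℝ (hφL n) (x₀ := x) (v := basisVec i)
  · filter_upwards [hulip.ae_differentiableAt hΩ] with x hx
    refine tendsto_const_nhds.congr' ?_
    rcases (h0 x).eq_or_lt with hx0 | hx0
    · refine Eventually.of_forall fun n => ?_
      have hmin : IsLocalMin u x := Eventually.of_forall fun y => by rw [← hx0]; exact h0 y
      rw [hx.lineDeriv_eq_fderiv, hmin.fderiv_eq_zero]
      have : φ n =ᶠ[𝓝 x] fun _ => 0 := by
        have : {y | u y < δ n} ∈ 𝓝 x :=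
          hu.continuous.continuousAt.eventually (gt_mem_nhds (by rw [← hx0]; exact hδ n))
        filter_upwards [this] with y hy
        exact max_eq_right (by linarith)
      simp only [this.lineDeriv_eq]; simp [lineDeriv]
    · filter_upwards [hδl.eventually (gt_mem_nhds hx0)] with n hn
      have : φ n =ᶠ[𝓝 x] fun y => u y - δ n := by
        have : {y | δ n < u y} ∈ 𝓝 x :=
          hu.continuous.continuousAt.eventually (lt_mem_nhds hn)
        filter_upwards [this] with y hy
        exact max_eq_left (by linarith)
      rw [this.lineDeriv_eq]
      simp [lineDeriv]

namespace Triangulation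

/-- The bubble function of an element, extended by zero. -/
def bub (k : Fin T.N) (x : E d) : ℝ := ∏ i, max ((T.vert k).coord i x) 0

theorem bub_nonneg (k : Fin T.N) (x : E d) : 0 ≤ T.bub k x :=
  Finset.prod_nonneg fun _ _ => le_max_right _ _

theorem bub_pos_iff {k : Fin T.N} {x : E d} : 0 < T.bub k x ↔ x ∈ interior (T.elem k) := by
  rw [mem_interior_elem_iff]
  constructor
  · intro h i
    by_contra hcon
    exact h.ne' (Finset.prod_eq_zero (Finset.mem_univ i) (max_eq_right (not_lt.1 hcon)))
  · intro h
    exact Finset.prod_pos fun i _ => lt_max_of_lt_left (h i)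

theorem bub_eq_bubble {k : Fin T.N} {x : E d} (hx : x ∈ T.elem k) : T.bub k x = T.bubble k x :=
  Finset.prod_congr rfl fun i _ => max_eq_left (T.mem_elem_iff.1 hx i)

theorem bub_eq_zero {k : Fin T.N} {x : E d} (hx : x ∉ interior (T.elem k)) : T.bub k x = 0 :=
  le_antisymm (not_lt.1 fun h => hx (T.bub_pos_iff.1 h)) (T.bub_nonneg k x)

theorem hasCompactSupport_bub (k : Fin T.N) : HasCompactSupport (T.bub k) :=
  HasCompactSupport.of_support_subset_isCompact (T.isCompact_elem k) fun x hx => by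
    by_contra h
    exact hx (T.bub_eq_zero fun h' => h (interior_subset h'))

theorem exists_lipschitzWith_bub (k : Fin T.N) : ∃ C, LipschitzWith C (T.bub k) := by
  refine exists_lipschitzWith_of_hasCompactSupport ?_ (T.hasCompactSupport_bub k)
  have h1 : LocallyLipschitz fun y : Fin (d + 1) → ℝ => ∏ i, y i :=
    (contDiff_prod fun i _ => contDiff_apply ℝ ℝ i : ContDiff ℝ 1 _).locallyLipschitz
  have h2 : ∀ i, ∃ C, LipschitzWith C fun x => max ((T.vert k).coord i x) 0 := fun i => by
    have e : ((T.vert k).coord i : E d → ℝ) =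
        fun x => ((T.vert k).coord i).linear.toContinuousLinearMap x + (T.vert k).coord i 0 := by
      ext x
      have := congrFun ((T.vert k).coord i).decomp x
      simpa using this
    have h3 := (((T.vert k).coord i).linear.toContinuousLinearMap.lipschitz).add
      (LipschitzWith.const ((T.vert k).coord i 0))
    rw [e]
    exact ⟨_, h3.max_const 0⟩
  choose C hC using h2
  have h3 : LipschitzWith (∑ i, C i) fun x (i : Fin (d + 1)) => max ((T.vert k).coord i x) 0 := by
    refine LipschitzWith.of_dist_le_mul fun x y => (dist_pi_le_iff (by positivity)).2 fun i => ?_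
    refine ((hC i).dist_le_mul x y).trans (mul_le_mul_of_nonneg_right ?_ dist_nonneg)
    exact_mod_cast Finset.single_le_sum (f := C) (fun _ _ => zero_le) (Finset.mem_univ i)
  exact h1.comp h3.locallyLipschitz

theorem exists_vertex_notMem {k l : Fin T.N} (hkl : k ≠ l) :
    ∃ i, T.vert k i ∉ range (T.vert l) := by
  by_contra hcon
  push Not at hcon
  refine T.distinct k l hkl (Set.eq_of_subset_of_ncard_le ?_ ?_ (finite_range _))
  · rintro _ ⟨i, rfl⟩; exact hcon i
  · have h : ∀ m, (range (T.vert m)).ncard = d + 1 := fun m => by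
      rw [← image_univ, ncard_image_of_injective _ (T.vert m).ind.injective]
      simp
    rw [h, h]

theorem bub_eq_zero_of_ne {k l : Fin T.N} (hkl : k ≠ l) {x : E d} (hx : x ∈ T.elem l) :
    T.bub k x = 0 := by
  by_cases hxk : x ∈ T.elem k
  · obtain ⟨i, hi⟩ := T.exists_vertex_notMem hkl
    have hx' : x ∈ convexHull ℝ (range (T.vert k) ∩ range (T.vert l)) := by
      rw [← T.conforming k l hkl]; exact ⟨hxk, hx⟩
    have hsub : convexHull ℝ (range (T.vert k) ∩ range (T.vert l)) ⊆
        (T.vert k).coord i ⁻¹' {0} := by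
      refine convexHull_min ?_ ((convex_singleton 0).affine_preimage _)
      rintro _ ⟨⟨m, rfl⟩, hm⟩
      refine AffineBasis.coord_apply_ne _ fun him => hi ?_
      rwa [him]
    refine Finset.prod_eq_zero (Finset.mem_univ i) ?_
    have := hsub hx'
    simp only [mem_preimage, mem_singleton_iff] at this
    rw [this, max_self]
  · exact T.bub_eq_zero fun h => hxk (interior_subset h)

theorem memH0_bub (hΩ : IsOpen Ω) (hb : Bornology.IsBounded Ω) (hr : interior (closure Ω) = Ω)
    (k : Fin T.N) : MemH0 Ω (T.bub k) := by
  obtain ⟨C, hC⟩ := T.exists_lipschitzWith_bub k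
  exact memH0_of_nonneg hΩ hb hC (T.hasCompactSupport_bub k) (T.bub_nonneg k)
    fun x hx => T.interior_elem_subset hr k (T.bub_pos_iff.1 hx)

end Triangulation
end MeshFunctions

section SimplexSobolev

/-- The standard simplex with vertices `0` and the unit vectors. -/
def cornerSimplex (d : ℕ) : Set (Fin d → ℝ) := {x | (∀ i, 0 ≤ x i) ∧ ∑ i, x i ≤ 1}

theorem isClosed_cornerSimplex : IsClosed (cornerSimplex d) := by
  have : cornerSimplex d = (⋂ i, {x | 0 ≤ x i}) ∩ {x | ∑ i, x i ≤ 1} := by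
    ext x; simp [cornerSimplex]
  rw [this]
  refine (isClosed_iInter fun i => isClosed_le continuous_const (continuous_apply i)).inter ?_
  exact isClosed_le (continuous_finsetSum _ fun i _ => continuous_apply i) continuous_const

open Function in
/-- A Sobolev inequality on the standard simplex, for functions which vanish on the face opposite
to the origin. -/
theorem lintegral_cornerSimplex_le {p : ℝ} (hp : Real.HolderConjugate d p)
    {θ : (Fin d → ℝ) → ℝ} (hθ : ContDiff ℝ 1 θ) (h0 : ∀ x, ∑ i, x i = 1 → θ x = 0) :
    ∫⁻ x in cornerSimplex d, ‖θ x‖ₑ ^ p ≤ (∫⁻ x in cornerSimplex d, ‖fderiv ℝ θ x‖ₑ) ^ p := by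
  have hd2 : (2 : ℝ) ≤ d := by exact_mod_cast (by exact_mod_cast hp.lt : 1 < d)
  have hS : MeasurableSet (cornerSimplex d) := isClosed_cornerSimplex.measurableSet
  have hcard : (Fintype.card (Fin d) : ℝ) = d := by simp
  have hp' : Real.HolderConjugate (Fintype.card (Fin d)) p := by rwa [hcard]
  have hpos : 0 < p := hp.symm.pos
  set G : (Fin d → ℝ) → ℝ≥0∞ := (cornerSimplex d).indicator fun x => ‖fderiv ℝ θ x‖ₑ with hG
  have hGm : Measurable G :=
    ((hθ.continuous_fderiv one_ne_zero).enorm.measurable).indicator hS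
  have key : ∀ x ∈ cornerSimplex d, ∀ i, ‖θ x‖ₑ ≤ ∫⁻ t, G (update x i t) := by
    intro x hx i
    set b : ℝ := 1 - ∑ j ∈ Finset.univ.erase i, x j with hb
    have hsum : ∀ t, ∑ j, update x i t j = t + ∑ j ∈ Finset.univ.erase i, x j := fun t => by
      rw [← Finset.add_sum_erase _ _ (Finset.mem_univ i), update_self]
      congr 1
      exact Finset.sum_congr rfl fun j hj => update_of_ne (Finset.ne_of_mem_erase hj) _ _
    have hxb : x i ≤ b := by
      have := hx.2
      rw [← Finset.add_sum_erase _ _ (Finset.mem_univ i)] at this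
      linarith
    have hmem : ∀ t ∈ Icc (x i) b, update x i t ∈ cornerSimplex d := by
      intro t ht
      refine ⟨fun j => ?_, ?_⟩
      · rcases eq_or_ne j i with rfl | hj
        · rw [update_self]; exact (hx.1 j).trans ht.1
        · rw [update_of_ne hj]; exact hx.1 j
      · rw [hsum]; linarith [ht.2]
    have hc : ContDiff ℝ 1 (θ ∘ update x i) := hθ.comp (contDiff_update 1 x i)
    have h1 := enorm_sub_le_lintegral_deriv_of_contDiffOn_Icc hc.contDiffOn hxb
    have hend : θ (update x i b) = 0 := h0 _ (by rw [hsum]; simp [hb])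
    simp only [comp_apply, hend, update_eq_self, zero_sub, enorm_neg] at h1
    refine h1.trans ?_
    rw [← lintegral_indicator measurableSet_Icc]
    refine lintegral_mono fun t => ?_
    by_cases ht : t ∈ Icc (x i) b
    · rw [indicator_of_mem ht, hG, indicator_of_mem (hmem t ht)]
      calc ‖deriv (θ ∘ update x i) t‖ₑ
          = ‖fderiv ℝ θ (update x i t) (deriv (update x i) t)‖ₑ := by
            rw [fderiv_comp_deriv _ (hθ.differentiable one_ne_zero).differentiableAt
              (hasDerivAt_update x i t).differentiableAt]
        _ ≤ ‖fderiv ℝ θ (update x i t)‖ₑ * ‖deriv (update x i) t‖ₑ :=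
            ContinuousLinearMap.le_opENorm _ _
        _ ≤ ‖fderiv ℝ θ (update x i t)‖ₑ := by simp [deriv_update, Pi.enorm_single]
    · rw [indicator_of_notMem ht]; exact zero_le
  calc ∫⁻ x in cornerSimplex d, ‖θ x‖ₑ ^ p
      = ∫⁻ x, (cornerSimplex d).indicator (fun x => ‖θ x‖ₑ ^ p) x :=
        (lintegral_indicator hS _).symm
    _ ≤ ∫⁻ x, ∏ i : Fin d, (∫⁻ t, G (update x i t)) ^
          ((1 : ℝ) / ((Fintype.card (Fin d) : ℝ) - 1)) := by
        refine lintegral_mono fun x => ?_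
        by_cases hx : x ∈ cornerSimplex d
        · rw [indicator_of_mem hx]
          calc ‖θ x‖ₑ ^ p = ∏ _i : Fin d, ‖θ x‖ₑ ^ ((1 : ℝ) / ((Fintype.card (Fin d) : ℝ) - 1)) := by
                rw [Finset.prod_const, Finset.card_univ, ← ENNReal.rpow_natCast,
                  ← ENNReal.rpow_mul, hp'.conjugate_eq]
                congr 1
                rw [hcard]
                field_simp
            _ ≤ _ := Finset.prod_le_prod' fun i _ => by
                refine ENNReal.rpow_le_rpow (key x hx i) ?_
                rw [hcard]; apply div_nonneg zero_le_one; linarith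
        · rw [indicator_of_notMem hx]; exact zero_le
    _ ≤ (∫⁻ x, G x) ^ p := by
        exact lintegral_prod_lintegral_pow_le (fun _ : Fin d => (volume : Measure ℝ)) hp' hGm
    _ = _ := by rw [hG, lintegral_indicator hS]

/-- Barycentric coordinates with respect to the vertex `k`, as linear coordinates. -/
theorem exists_corner_chart (b : AffineBasis (Fin (d + 1)) ℝ (E d)) (k : Fin (d + 1)) :
    ∃ L : (Fin d → ℝ) ≃L[ℝ] E d, (∀ x m, b.coord (k.succAbove m) (L x + b k) = x m) ∧
      ∀ x, b.coord k (L x + b k) = 1 - ∑ m, x m := by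
  let B := (b.basisOf k).reindex (finSuccAboveEquiv k).symm
  have hB : ∀ m, B m = b (k.succAbove m) - b k := fun m => by
    simp only [B, Module.Basis.reindex_apply, Equiv.symm_symm, finSuccAboveEquiv_apply,
      AffineBasis.basisOf_apply, vsub_eq_sub]
  have hc : ∀ j x, b.coord j (B.equivFun.symm x + b k) =
      b.coord j (b k) + ∑ m, x m * (b.coord j (b (k.succAbove m)) - b.coord j (b k)) := by
    intro j x
    have h1 := (b.coord j).map_vadd (b k) (B.equivFun.symm x)
    simp only [vadd_eq_add] at h1
    rw [h1, Module.Basis.equivFun_symm_apply, map_sum, add_comm]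
    congr 1
    refine Finset.sum_congr rfl fun m _ => ?_
    rw [map_smul, hB, smul_eq_mul, ← vsub_eq_sub, AffineMap.linearMap_vsub, vsub_eq_sub]
  refine ⟨B.equivFun.symm.toContinuousLinearEquiv, fun x m => ?_, fun x => ?_⟩
  · refine (hc _ x).trans ?_
    rw [b.coord_apply_ne (Fin.succAbove_ne k m), Finset.sum_eq_single m]
    · simp
    · intro m' _ hm'
      rw [b.coord_apply_ne (fun h => hm' (Fin.succAbove_right_injective h).symm)]; simp
    · simp
  · refine (hc _ x).trans ?_
    simp only [b.coord_apply_eq, b.coord_apply_ne (Fin.succAbove_ne k _).symm]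
    rw [← Finset.sum_mul]
    ring

/-- A Sobolev inequality on a simplex, for functions which vanish on the face opposite to the
`k`-th vertex. -/
theorem exists_eLpNorm_simplex_le {p : ℝ} (hp : Real.HolderConjugate d p)
    (b : AffineBasis (Fin (d + 1)) ℝ (E d)) (k : Fin (d + 1)) :
    ∃ C : ℝ≥0∞, C ≠ ⊤ ∧ ∀ η : E d → ℝ, ContDiff ℝ 1 η → (∀ x, b.coord k x = 0 → η x = 0) →
      eLpNorm η (ENNReal.ofReal p) (volume.restrict (convexHull ℝ (range b))) ≤
        C * ∫⁻ x in convexHull ℝ (range b), ‖fderiv ℝ η x‖ₑ := by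
  obtain ⟨L, hL1, hL2⟩ := exists_corner_chart b k
  set κ := convexHull ℝ (range b) with hκ
  have hκm : MeasurableSet κ := ((finite_range b).isCompact_convexHull ℝ).isClosed.measurableSet
  set Φ : (Fin d → ℝ) → E d := fun x => L x + b k with hΦ
  have hΦc : Continuous Φ := by fun_prop
  have hpre : Φ ⁻¹' κ = cornerSimplex d := by
    ext x
    rw [hκ, AffineBasis.convexHull_eq_nonneg_coord]
    simp only [mem_preimage, mem_ofPred_eq, cornerSimplex]
    constructor
    · intro h
      exact ⟨fun m => by rw [← hL1 x m]; exact h _, by have := h k; rw [hL2] at this; linarith⟩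
    · rintro ⟨h1, h2⟩ j
      rcases eq_or_ne j k with rfl | hj
      · rw [hL2]; linarith
      · obtain ⟨m, rfl⟩ := Fin.exists_succAbove_eq hj
        rw [hL1]; exact h1 m
  obtain ⟨c, hc0, hct, hc⟩ : ∃ c : ℝ≥0∞, c ≠ 0 ∧ c ≠ ⊤ ∧
      (volume : Measure (Fin d → ℝ)).map L = c • (volume : Measure (E d)) :=
    ⟨_, ENNReal.coe_ne_zero.2 (Measure.addHaarScalarFactor_pos_of_isAddHaarMeasure
      ((volume : Measure (Fin d → ℝ)).map L) volume).ne', ENNReal.coe_ne_top,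
      Measure.isAddLeftInvariant_eq_smul _ _⟩
  have hmap : (volume : Measure (Fin d → ℝ)).map Φ = c • volume := by
    have : Φ = (fun y => y + b k) ∘ L := rfl
    rw [this, ← Measure.map_map (by fun_prop) (by fun_prop), hc, Measure.map_smul,
      map_add_right_eq_self]
  have hint : ∀ f : E d → ℝ≥0∞, Measurable f →
      ∫⁻ x in cornerSimplex d, f (Φ x) = c * ∫⁻ y in κ, f y := by
    intro f hf
    rw [← hpre, ← setLIntegral_map hκm hf hΦc.measurable, hmap, Measure.restrict_smul,
      lintegral_smul_measure, smul_eq_mul]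
  have hp0 : 0 < p := hp.symm.pos
  refine ⟨(c⁻¹) ^ (1 / p) * (c * ‖(L : (Fin d → ℝ) →L[ℝ] E d)‖ₑ), ?_, fun η hη h0 => ?_⟩
  · refine ENNReal.mul_ne_top (ENNReal.rpow_ne_top_of_nonneg (by positivity)
      (ENNReal.inv_ne_top.2 hc0)) (ENNReal.mul_ne_top hct enorm_ne_top)
  have hθ : ContDiff ℝ 1 (η ∘ Φ) := hη.comp (L.contDiff.add contDiff_const)
  have h1 := lintegral_cornerSimplex_le hp hθ fun x hx => h0 _ (by rw [hL2, hx, sub_self])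
  have h2 : ∫⁻ x in cornerSimplex d, ‖fderiv ℝ (η ∘ Φ) x‖ₑ ≤
      c * ‖(L : (Fin d → ℝ) →L[ℝ] E d)‖ₑ * ∫⁻ y in κ, ‖fderiv ℝ η y‖ₑ := by
    have hm : Measurable fun y => ‖fderiv ℝ η y‖ₑ :=
      (hη.continuous_fderiv one_ne_zero).enorm.measurable
    calc _ ≤ ∫⁻ x in cornerSimplex d, ‖(L : (Fin d → ℝ) →L[ℝ] E d)‖ₑ * ‖fderiv ℝ η (Φ x)‖ₑ := by
          refine lintegral_mono fun x => ?_
          have hd : HasFDerivAt Φ (L : (Fin d → ℝ) →L[ℝ] E d) x :=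
            L.hasFDerivAt.add_const (b k)
          have := ((hη.differentiable one_ne_zero (Φ x)).hasFDerivAt.comp x hd).fderiv
          rw [this, mul_comm]
          exact ContinuousLinearMap.opENorm_comp_le _ _
      _ = _ := by
          rw [lintegral_const_mul' _ _ enorm_ne_top, hint _ hm]; ring
  have h3 : ∫⁻ x in cornerSimplex d, ‖(η ∘ Φ) x‖ₑ ^ p = c * ∫⁻ y in κ, ‖η y‖ₑ ^ p :=
    hint (fun y => ‖η y‖ₑ ^ p) (hη.continuous.enorm.measurable.pow_const p)
  rw [h3] at h1
  have h4 : ∫⁻ y in κ, ‖η y‖ₑ ^ p ≤ c⁻¹ *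
      (c * ‖(L : (Fin d → ℝ) →L[ℝ] E d)‖ₑ * ∫⁻ y in κ, ‖fderiv ℝ η y‖ₑ) ^ p := by
    rw [mul_comm, ← div_eq_mul_inv, ENNReal.le_div_iff_mul_le (Or.inl hc0) (Or.inl hct), mul_comm]
    exact h1.trans (ENNReal.rpow_le_rpow h2 hp0.le)
  rw [eLpNorm_eq_lintegral_rpow_enorm_toReal (by simpa using hp0) ENNReal.ofReal_ne_top,
    ENNReal.toReal_ofReal hp0.le]
  calc _ ≤ _ := ENNReal.rpow_le_rpow h4 (by positivity)
    _ = _ := by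
      rw [ENNReal.mul_rpow_of_nonneg _ _ (by positivity), ← ENNReal.rpow_mul,
        mul_one_div_cancel hp0.ne', ENNReal.rpow_one]
      ring

theorem norm_clm_le_sum (f : E d →L[ℝ] ℝ) : ‖f‖ ≤ ∑ i, |f (basisVec i)| := by
  refine ContinuousLinearMap.opNorm_le_bound _ (by positivity) fun y => ?_
  have hy : y = ∑ i, y i • basisVec i := by
    have := (EuclideanSpace.basisFun (Fin d) ℝ).sum_repr y
    simpa using this.symm
  calc ‖f y‖ = ‖∑ i, y i * f (basisVec i)‖ := by
        conv_lhs => rw [hy]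
        simp only [map_sum, map_smul, smul_eq_mul]
    _ ≤ ∑ i, ‖y i * f (basisVec i)‖ := norm_sum_le _ _
    _ ≤ ∑ i, |f (basisVec i)| * ‖y‖ := by
        refine Finset.sum_le_sum fun i _ => ?_
        rw [norm_mul, mul_comm]
        exact mul_le_mul_of_nonneg_left (PiLp.norm_apply_le y i) (norm_nonneg _)
    _ = _ := by rw [Finset.sum_mul]

/-- The `H^1` norm (as a sum) on a set of a differentiable function. -/
def h1s (s : Set (E d)) (φ : E d → ℝ) : ℝ≥0∞ :=
  eLpNorm φ 2 (volume.restrict s) +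
    ∑ i, eLpNorm (fun x => fderiv ℝ φ x (basisVec i)) 2 (volume.restrict s)

theorem eLpNorm_norm_fderiv_le {φ : E d → ℝ} (hφ : ContDiff ℝ 1 φ) (s : Set (E d)) {p : ℝ≥0∞}
    (hp : 1 ≤ p) : eLpNorm (fderiv ℝ φ) p (volume.restrict s) ≤
      ∑ i, eLpNorm (fun x => fderiv ℝ φ x (basisVec i)) p (volume.restrict s) := by
  have hc : ∀ i, Continuous fun x => fderiv ℝ φ x (basisVec i) := fun i =>
    (hφ.continuous_fderiv one_ne_zero).clm_apply continuous_const
  calc eLpNorm (fderiv ℝ φ) p (volume.restrict s)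
      ≤ eLpNorm (∑ i, fun x => ‖fderiv ℝ φ x (basisVec i)‖) p (volume.restrict s) := by
        refine eLpNorm_mono_real fun x => ?_
        rw [Finset.sum_apply]
        exact norm_clm_le_sum _
    _ ≤ ∑ i, eLpNorm (fun x => ‖fderiv ℝ φ x (basisVec i)‖) p (volume.restrict s) :=
        eLpNorm_sum_le (fun i _ => (hc i).norm.aestronglyMeasurable) hp
    _ = _ := Finset.sum_congr rfl fun i _ => eLpNorm_norm _

theorem ENNReal_le_of_rpow_le {J C : ℝ≥0∞} (hJ : J ≠ ⊤)
    (h : J ^ (2 / 3 : ℝ) ≤ C * J ^ (1 / 2 : ℝ)) : J ^ (1 / 6 : ℝ) ≤ C := by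
  rcases eq_or_ne J 0 with rfl | h0
  · simp
  have hne : J ^ (1 / 2 : ℝ) ≠ 0 := by simp [h0, hJ]
  have hnt : J ^ (1 / 2 : ℝ) ≠ ⊤ := ENNReal.rpow_ne_top_of_nonneg (by norm_num) hJ
  have e : J ^ (2 / 3 : ℝ) = J ^ (1 / 6 : ℝ) * J ^ (1 / 2 : ℝ) := by
    rw [← ENNReal.rpow_add _ _ h0 hJ]; norm_num
  rw [e] at h
  exact (ENNReal.mul_le_mul_iff_left hne hnt).1 h

/-- The embedding of `H^1` into `L^6` on a simplex, for smooth functions. -/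
theorem exists_eLpNorm_six_simplex_le (hd : d = 2 ∨ d = 3)
    (b : AffineBasis (Fin (d + 1)) ℝ (E d)) :
    ∃ C : ℝ≥0∞, C ≠ ⊤ ∧ ∀ φ : E d → ℝ, ContDiff ℝ 1 φ →
      eLpNorm φ 6 (volume.restrict (convexHull ℝ (range b))) ≤
        C * h1s (convexHull ℝ (range b)) φ := by
  set κ := convexHull ℝ (range b) with hκ
  have hκc : IsCompact κ := (finite_range b).isCompact_convexHull ℝ
  have hκm : MeasurableSet κ := hκc.isClosed.measurableSet
  set μ := volume.restrict κ with hμ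
  have hfin : IsFiniteMeasure μ := isFiniteMeasure_restrict hκc.isBounded
  have hpex : ∃ p : ℝ, Real.HolderConjugate d p ∧ 3 / 2 ≤ p := by
    rcases hd with rfl | rfl
    · exact ⟨2, by norm_num [Real.holderConjugate_iff], by norm_num⟩
    · exact ⟨3 / 2, by norm_num [Real.holderConjugate_iff], le_rfl⟩
  obtain ⟨p, hp, h32⟩ := hpex
  have hq0 : ENNReal.ofReal (3 / 2) ≠ 0 := by simp
  choose C hC hS using exists_eLpNorm_simplex_le hp b
  set m : ℝ≥0∞ := μ univ ^ (1 / (ENNReal.ofReal (3 / 2)).toReal - 1 / (ENNReal.ofReal p).toReal)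
    with hm
  have hmt : m ≠ ⊤ := by
    refine ENNReal.rpow_ne_top_of_nonneg ?_ (measure_ne_top _ _)
    rw [ENNReal.toReal_ofReal (by norm_num), ENNReal.toReal_ofReal (by linarith), sub_nonneg]
    exact one_div_le_one_div_of_le (by norm_num) h32
  let D : Fin (d + 1) → ℝ≥0∞ := fun k =>
    ‖(b.coord k).linear.toContinuousLinearMap‖ₑ + 4
  refine ⟨∑ k, C k * D k * m, ENNReal.sum_ne_top.2 fun k _ => ENNReal.mul_ne_top
    (ENNReal.mul_ne_top (hC k) (by simp [D])) hmt, fun φ hφ => ?_⟩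
  set B : ℝ≥0∞ := h1s κ φ with hB
  have hφm : Measurable fun x => ‖φ x‖ₑ := hφ.continuous.enorm.measurable
  have hdm : Measurable fun x => ‖fderiv ℝ φ x‖ₑ :=
    (hφ.continuous_fderiv one_ne_zero).enorm.measurable
  set J : ℝ≥0∞ := ∫⁻ x, ‖φ x‖ₑ ^ (6 : ℝ) ∂μ with hJ
  have hJt : J ≠ ⊤ := by
    obtain ⟨M, hM⟩ := hκc.exists_bound_of_continuousOn hφ.continuous.continuousOn
    refine ne_top_of_le_ne_top (b := ENNReal.ofReal M ^ (6 : ℝ) * μ univ) ?_ ?_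
    · exact ENNReal.mul_ne_top (ENNReal.rpow_ne_top_of_nonneg (by norm_num) ENNReal.ofReal_ne_top)
        (measure_ne_top _ _)
    · rw [← lintegral_const]
      refine lintegral_mono_ae ?_
      filter_upwards [ae_restrict_mem hκm] with x hx
      refine ENNReal.rpow_le_rpow ?_ (by norm_num)
      rw [← ofReal_norm]
      exact ENNReal.ofReal_le_ofReal (hM x hx)
  -- the Hölder inequality for the right-hand side
  have hH : ∫⁻ x, ‖φ x‖ₑ ^ (3 : ℝ) * (‖φ x‖ₑ + ‖fderiv ℝ φ x‖ₑ) ∂μ ≤ J ^ (1 / 2 : ℝ) * B := by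
    have h22 : Real.HolderConjugate 2 2 := by norm_num [Real.holderConjugate_iff]
    refine (ENNReal.lintegral_mul_le_Lp_mul_Lq μ h22 (hφm.pow_const _).aemeasurable
      (hφm.add hdm).aemeasurable).trans ?_
    refine mul_le_mul' (le_of_eq ?_) ?_
    · congr 1
      refine lintegral_congr fun x => ?_
      rw [← ENNReal.rpow_mul]; norm_num
    · have h1 : (∫⁻ x, ((fun x => ‖φ x‖ₑ) + fun x => ‖fderiv ℝ φ x‖ₑ) x ^ (2 : ℝ) ∂μ) ^ (1 / 2 : ℝ)
          ≤ (∫⁻ x, ‖φ x‖ₑ ^ (2 : ℝ) ∂μ) ^ (1 / 2 : ℝ) +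
            (∫⁻ x, ‖fderiv ℝ φ x‖ₑ ^ (2 : ℝ) ∂μ) ^ (1 / 2 : ℝ) :=
        ENNReal.lintegral_Lp_add_le hφm.aemeasurable hdm.aemeasurable (by norm_num)
      refine h1.trans ?_
      have h2 := eLpNorm_norm_fderiv_le hφ κ (p := 2) one_le_two
      rw [eLpNorm_eq_lintegral_rpow_enorm_toReal (by simp) (by simp)] at h2
      simp only [ENNReal.toReal_ofNat] at h2
      rw [hB, h1s, eLpNorm_eq_lintegral_rpow_enorm_toReal (f := φ) (by simp) (by simp)]
      simp only [ENNReal.toReal_ofNat]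
      exact add_le_add le_rfl h2
  -- the Sobolev inequality for `λ_k φ^4`
  have hk : ∀ k, eLpNorm (fun x => b.coord k x * φ x ^ 4) (ENNReal.ofReal (3 / 2)) μ ≤
      C k * D k * m * (J ^ (1 / 2 : ℝ) * B) := by
    intro k
    have hlam : ContDiff ℝ 1 (b.coord k) := contDiff_affineMap _
    have hη : ContDiff ℝ 1 fun x => b.coord k x * φ x ^ 4 := hlam.mul (hφ.pow 4)
    have h1 := hS k _ hη fun x hx => by simp [hx]
    have h2 := eLpNorm_le_eLpNorm_mul_rpow_measure_univ (μ := μ)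
      (ENNReal.ofReal_le_ofReal h32) hη.continuous.aestronglyMeasurable
    suffices h3 : ∫⁻ x in κ, ‖fderiv ℝ (fun x => b.coord k x * φ x ^ 4) x‖ₑ ≤
        D k * (J ^ (1 / 2 : ℝ) * B) by
      calc _ ≤ _ := h2
        _ ≤ C k * (D k * (J ^ (1 / 2 : ℝ) * B)) * m :=
          mul_le_mul' (h1.trans (mul_le_mul' le_rfl h3)) le_rfl
        _ = _ := by ring
    refine le_trans ?_ (mul_le_mul_right hH (D k))
    rw [← lintegral_const_mul' _ _ (by simp [D])]
    refine lintegral_mono_ae ?_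
    filter_upwards [ae_restrict_mem hκm] with x hx
    have hx01 : 0 ≤ b.coord k x ∧ b.coord k x ≤ 1 := by
      rw [hκ, AffineBasis.convexHull_eq_nonneg_coord] at hx
      refine ⟨hx k, ?_⟩
      rw [← b.sum_coord_apply_eq_one x]
      exact Finset.single_le_sum (fun i _ => hx i) (Finset.mem_univ k)
    have hlf : HasFDerivAt (b.coord k) (b.coord k).linear.toContinuousLinearMap x := by
      have e : (b.coord k : E d → ℝ) =
          fun x => (b.coord k).linear.toContinuousLinearMap x + b.coord k 0 := by
        ext x
        have := congrFun (b.coord k).decomp x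
        simpa using this
      rw [e]
      exact (ContinuousLinearMap.hasFDerivAt _).add_const _
    have hφd := (hφ.differentiable one_ne_zero x).hasFDerivAt
    have hfd := (hlf.fun_mul (hφd.pow 4)).fderiv
    have hn : ‖fderiv ℝ (fun x => b.coord k x * φ x ^ 4) x‖ ≤
        (‖(b.coord k).linear.toContinuousLinearMap‖ + 4) *
          (‖φ x‖ ^ 3 * (‖φ x‖ + ‖fderiv ℝ φ x‖)) := by
      rw [hfd, nsmul_eq_mul]
      refine (norm_add_le _ _).trans ?_
      rw [norm_smul, norm_smul, norm_smul]
      simp only [norm_pow, norm_mul, Real.norm_eq_abs, abs_of_nonneg hx01.1, Nat.cast_ofNat,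
        Nat.abs_ofNat, Nat.add_one_sub_one]
      set A := ‖(b.coord k).linear.toContinuousLinearMap‖
      set F := ‖fderiv ℝ φ x‖
      have hA : 0 ≤ A := norm_nonneg _
      have hF : 0 ≤ F := norm_nonneg _
      have ha : 0 ≤ |φ x| := abs_nonneg _
      have h1 : b.coord k x * (|φ x| ^ 3 * F) ≤ |φ x| ^ 3 * F :=
        mul_le_of_le_one_left (by positivity) hx01.2
      have h2 : 0 ≤ A * (|φ x| ^ 3 * F) := by positivity
      have h3 : 0 ≤ |φ x| ^ 4 := by positivity
      linear_combination 4 * h1 + h2 + 4 * h3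
    have hn' := ENNReal.ofReal_le_ofReal hn
    rw [ENNReal.ofReal_mul (by positivity), ENNReal.ofReal_mul (by positivity),
      ENNReal.ofReal_add (by positivity) (by positivity),
      ENNReal.ofReal_add (by positivity) (by positivity), ENNReal.ofReal_pow (by positivity),
      ofReal_norm, ofReal_norm, ofReal_norm, ofReal_norm] at hn'
    refine hn'.trans (le_of_eq ?_)
    have e3 : ‖φ x‖ₑ ^ (3 : ℝ) = ‖φ x‖ₑ ^ 3 := by exact_mod_cast ENNReal.rpow_natCast _ 3
    have e4 : ENNReal.ofReal 4 = 4 := by simp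
    rw [e3, e4]
  have hsum : eLpNorm (fun x => φ x ^ 4) (ENNReal.ofReal (3 / 2)) μ ≤
      (∑ k, C k * D k * m) * (J ^ (1 / 2 : ℝ) * B) := by
    have e : (fun x => φ x ^ 4) = ∑ k, fun x => b.coord k x * φ x ^ 4 := by
      ext x
      rw [Finset.sum_apply, ← Finset.sum_mul, b.sum_coord_apply_eq_one, one_mul]
    rw [e, Finset.sum_mul]
    refine (eLpNorm_sum_le (fun k _ => ?_) ?_).trans (Finset.sum_le_sum fun k _ => hk k)
    · exact ((contDiff_affineMap (n := 0) _).continuous.mul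
        (hφ.continuous.pow 4)).aestronglyMeasurable
    · rw [← ENNReal.ofReal_one]; exact ENNReal.ofReal_le_ofReal (by norm_num)
  have hl : eLpNorm (fun x => φ x ^ 4) (ENNReal.ofReal (3 / 2)) μ = J ^ (2 / 3 : ℝ) := by
    rw [eLpNorm_eq_lintegral_rpow_enorm_toReal hq0 ENNReal.ofReal_ne_top,
      ENNReal.toReal_ofReal (by norm_num)]
    norm_num
    congr 1
    refine lintegral_congr fun x => ?_
    rw [← ENNReal.rpow_natCast, ← ENNReal.rpow_mul]; norm_num
  rw [hl] at hsum
  have hfinal := ENNReal_le_of_rpow_le hJt (C := (∑ k, C k * D k * m) * B)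
    (hsum.trans (le_of_eq (by ring)))
  rw [eLpNorm_eq_lintegral_rpow_enorm_toReal (by simp) (by simp)]
  simpa only [ENNReal.toReal_ofNat] using hfinal

end SimplexSobolev

section SobolevEmbeddings

variable {Ω : Set (E d)}

/-- Lower semicontinuity of `L^p` norms under `L^2` convergence. -/
theorem eLpNorm_le_of_tendsto {μ : Measure (E d)} {p : ℝ≥0∞} {φ : ℕ → E d → ℝ} {u : E d → ℝ}
    {c : ℕ → ℝ≥0∞} {c₀ : ℝ≥0∞} (hφ : ∀ n, AEStronglyMeasurable (φ n) μ)
    (hu : AEStronglyMeasurable u μ)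
    (h : Tendsto (fun n => eLpNorm (fun x => φ n x - u x) 2 μ) atTop (𝓝 0))
    (hc : ∀ n, eLpNorm (φ n) p μ ≤ c n) (hl : Tendsto c atTop (𝓝 c₀)) :
    eLpNorm u p μ ≤ c₀ := by
  have hm : TendstoInMeasure μ φ atTop u :=
    tendstoInMeasure_of_tendsto_eLpNorm (p := 2) (by simp) hφ hu h
  obtain ⟨ns, hns, hae⟩ := hm.exists_seq_tendsto_ae
  refine (Lp.eLpNorm_lim_le_liminf_eLpNorm (fun n => hφ (ns n)) u hae).trans ?_
  refine (liminf_le_liminf (Eventually.of_forall fun n => hc (ns n))).trans ?_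
  exact ((hl.comp hns.tendsto_atTop).liminf_eq).le

theorem h1e_le_add (hΩ : IsOpen Ω) {u v : E d → ℝ} (hu : MemW1 Ω 2 u) (hv : MemW1 Ω 2 v) :
    h1e Ω u ≤ h1e Ω v + h1e Ω fun x => u x - v x := by
  refine le_trans (le_of_eq ?_) (h1e_add_le hΩ hv (hu.sub hΩ hv))
  congr 1; ext x; ring

theorem Triangulation.restrict_elem_le (T : Triangulation Ω) (hr : interior (closure Ω) = Ω)
    (k : Fin T.N) :
    (volume : Measure (E d)).restrict (T.elem k) ≤ volume.restrict Ω := by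
  refine Measure.restrict_mono' ?_ le_rfl
  have h0 : volume (frontier (T.elem k)) = 0 := (convex_convexHull ℝ _).addHaar_frontier volume
  have h1 : ∀ᵐ x, x ∉ frontier (T.elem k) := measure_eq_zero_iff_ae_notMem.1 h0
  filter_upwards [h1] with x hx hxk
  refine T.interior_elem_subset hr k ?_
  by_contra hcon
  exact hx ⟨subset_closure hxk, hcon⟩

/-- The embedding of `H^1(Ω)` into `L^6(Ω)` on a domain with a triangulation. -/
theorem exists_eLpNorm_six_le (hd : d = 2 ∨ d = 3) (hΩ : IsOpen Ω) (hb : Bornology.IsBounded Ω)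
    (hr : interior (closure Ω) = Ω) (T : Triangulation Ω) :
    ∃ C : ℝ≥0∞, C ≠ ⊤ ∧ ∀ u, MemHs Ω u → eLpNorm u 6 (volume.restrict Ω) ≤ C * h1e Ω u := by
  choose C hC hS using fun k => exists_eLpNorm_six_simplex_le hd (T.vert k)
  refine ⟨∑ k, C k, ENNReal.sum_ne_top.2 fun k _ => hC k, ?_⟩
  have smooth : ∀ φ : E d → ℝ, ContDiff ℝ ∞ φ →
      eLpNorm φ 6 (volume.restrict Ω) ≤ (∑ k, C k) * h1e Ω φ := by
    intro φ hφ
    have hφ1 : ContDiff ℝ 1 φ := hφ.of_le (by simp)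
    have hh : ∀ k, h1s (T.elem k) φ ≤ h1e Ω φ := fun k => by
      refine add_le_add (eLpNorm_mono_measure _ (T.restrict_elem_le hr k))
        (Finset.sum_le_sum fun i _ => ?_)
      rw [eLpNorm_congr_ae (weakPartial_of_contDiff hΩ hb hφ1 i)]
      exact eLpNorm_mono_measure _ (T.restrict_elem_le hr k)
    have hm : ∀ k, MeasurableSet (T.elem k) := fun k => (T.isCompact_elem k).isClosed.measurableSet
    calc eLpNorm φ 6 (volume.restrict Ω)
        = eLpNorm (Ω.indicator φ) 6 volume :=
          (eLpNorm_indicator_eq_eLpNorm_restrict hΩ.measurableSet).symm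
      _ ≤ eLpNorm (∑ k, (T.elem k).indicator fun x => ‖φ x‖) 6 volume := by
          refine eLpNorm_mono_real fun x => ?_
          rw [Finset.sum_apply]
          by_cases hx : x ∈ Ω
          · obtain ⟨k, hk⟩ := T.exists_mem_elem (subset_closure hx)
            rw [indicator_of_mem hx]
            refine le_trans (le_of_eq ?_) (Finset.single_le_sum (f := fun k =>
              (T.elem k).indicator (fun x => ‖φ x‖) x)
              (fun k _ => indicator_nonneg (fun _ _ => norm_nonneg _) _) (Finset.mem_univ k))
            simp [indicator_of_mem hk]
          · rw [indicator_of_notMem hx, norm_zero]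
            exact Finset.sum_nonneg fun k _ => indicator_nonneg (fun _ _ => norm_nonneg _) _
      _ ≤ ∑ k, eLpNorm ((T.elem k).indicator fun x => ‖φ x‖) 6 volume :=
          eLpNorm_sum_le (fun k _ =>
            (hφ.continuous.norm.aestronglyMeasurable).indicator (hm k)) (by norm_num)
      _ = ∑ k, eLpNorm φ 6 (volume.restrict (T.elem k)) :=
          Finset.sum_congr rfl fun k _ => by
            rw [eLpNorm_indicator_eq_eLpNorm_restrict (hm k), eLpNorm_norm]
      _ ≤ ∑ k, C k * h1e Ω φ :=
          Finset.sum_le_sum fun k _ => (hS k φ hφ1).trans (mul_le_mul' le_rfl (hh k))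
      _ = _ := by rw [Finset.sum_mul]
  rintro u ⟨hu, φ, hφ, hl⟩
  have hφW := fun n => memW1_of_contDiff (q := 2) hΩ hb (hφ n)
  refine eLpNorm_le_of_tendsto (c := fun n => (∑ k, C k) *
    (h1e Ω u + h1e Ω fun x => φ n x - u x)) (fun n => (hφW n).1.1) hu.1.1 ?_ (fun n => ?_) ?_
  · exact tendsto_of_tendsto_of_tendsto_of_le_of_le tendsto_const_nhds hl (fun n => zero_le)
      fun n => eLpNorm_le_h1e
  · exact (smooth _ (hφ n)).trans (mul_le_mul' le_rfl (h1e_le_add hΩ (hφW n) hu))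
  · have : Tendsto (fun n => h1e Ω u + h1e Ω fun x => φ n x - u x) atTop (𝓝 (h1e Ω u)) := by
      simpa using Tendsto.const_add (h1e Ω u) hl
    exact ENNReal.Tendsto.const_mul this (Or.inr (ENNReal.sum_ne_top.2 fun k _ => hC k))

/-- The `L^2` norm of the gradient, as a sum. -/
def gradE (Ω : Set (E d)) (u : E d → ℝ) : ℝ≥0∞ :=
  ∑ i, eLpNorm (weakPartial Ω i u) 2 (volume.restrict Ω)

theorem gradE_le_h1e {u : E d → ℝ} : gradE Ω u ≤ h1e Ω u := le_add_self

theorem h1e_eq {u : E d → ℝ} : h1e Ω u = eLpNorm u 2 (volume.restrict Ω) + gradE Ω u := rfl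

theorem gradE_le_add (hΩ : IsOpen Ω) {u v : E d → ℝ} (hu : MemW1 Ω 2 u) (hv : MemW1 Ω 2 v) :
    gradE Ω u ≤ gradE Ω v + gradE Ω fun x => u x - v x := by
  rw [gradE, gradE, gradE, ← Finset.sum_add_distrib]
  refine Finset.sum_le_sum fun i _ => ?_
  have e : weakPartial Ω i u =ᵐ[volume.restrict Ω]
      (weakPartial Ω i v + weakPartial Ω i fun x => u x - v x) := by
    filter_upwards [weakPartial_sub hΩ hu hv i] with x hx
    rw [Pi.add_apply, hx]; ring
  rw [eLpNorm_congr_ae e]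
  exact eLpNorm_add_le (hv.memLp_weakPartial hΩ i).1 ((hu.sub hΩ hv).memLp_weakPartial hΩ i).1
    one_le_two

theorem exists_eLpNorm_test_le (hb : Bornology.IsBounded Ω) {p s : ℝ≥0} (hp1 : 1 ≤ p)
    (hpd : p < d) (hps : (p : ℝ)⁻¹ - (d : ℝ)⁻¹ ≤ (s : ℝ)⁻¹) :
    ∃ K : ℝ≥0∞, K ≠ ⊤ ∧ ∀ φ : E d → ℝ, IsTest Ω φ →
      eLpNorm φ s (volume.restrict Ω) ≤
        K * ∑ i, eLpNorm (fun x => fderiv ℝ φ x (basisVec i)) p (volume.restrict Ω) := by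
  have hfr : Module.finrank ℝ (E d) = d := finrank_euclideanSpace_fin
  refine ⟨(eLpNormLESNormFDerivOfLeConst ℝ (volume : Measure (E d)) Ω p s : ℝ≥0),
    ENNReal.coe_ne_top, fun φ hφ => ?_⟩
  have hφ1 : ContDiff ℝ 1 φ := hφ.1.of_le (by simp)
  have h1 := eLpNorm_le_eLpNorm_fderiv_of_le (F := ℝ) (volume : Measure (E d)) (u := φ) (s := Ω)
    (p := p) (q := s) hφ1 ((subset_tsupport φ).trans hφ.2.2) hp1
    (by rw [hfr]; exact hpd) (by rw [hfr]; exact hps) hb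
  have h2 : ∀ i, eLpNorm (fun x => fderiv ℝ φ x (basisVec i)) p (volume.restrict Ω) =
      eLpNorm (fun x => fderiv ℝ φ x (basisVec i)) p volume := fun i => by
    refine eLpNorm_restrict_eq_of_support_subset fun x hx => hφ.2.2 ?_
    by_contra hcon
    refine hx ?_
    beta_reduce
    rw [image_eq_zero_of_notMem_tsupport fun hh => hcon (tsupport_fderiv_subset ℝ hh)]; simp
  have h3 := eLpNorm_norm_fderiv_le hφ1 univ (p := p) (by exact_mod_cast hp1)
  rw [Measure.restrict_univ] at h3
  simp only [h2]
  exact (eLpNorm_mono_measure _ Measure.restrict_le_self).trans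
    (h1.trans (mul_le_mul' le_rfl h3))

/-- The Sobolev and Poincaré inequalities in `H^1_0(Ω)`. -/
theorem exists_eLpNorm_le_gradE (hd : d = 2 ∨ d = 3) (hΩ : IsOpen Ω)
    (hb : Bornology.IsBounded Ω) {s : ℝ≥0} (hs2 : 2 ≤ s) (hs : d = 3 → s ≤ 6) :
    ∃ C : ℝ≥0∞, C ≠ ⊤ ∧ ∀ u, MemH0 Ω u → eLpNorm u s (volume.restrict Ω) ≤ C * gradE Ω u := by
  have hfin := isFiniteMeasure_restrict hb
  have hs2' : (2 : ℝ) ≤ s := by exact_mod_cast hs2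
  have hpex : ∃ p : ℝ≥0, 1 ≤ p ∧ p ≤ 2 ∧ p < d ∧ (p : ℝ)⁻¹ - (d : ℝ)⁻¹ ≤ (s : ℝ)⁻¹ := by
    rcases hd with rfl | rfl
    · refine ⟨2 * s / (s + 2), ?_, ?_, ?_, ?_⟩
      · rw [one_le_div (by positivity)]
        have : (s + 2 : ℝ≥0) ≤ s + s := by gcongr
        calc s + 2 ≤ s + s := this
          _ = 2 * s := by ring
      · rw [div_le_iff₀ (by positivity)]
        gcongr; simp
      · rw [div_lt_iff₀ (by positivity)]
        push_cast
        rw [mul_add]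
        exact lt_add_of_pos_right _ (by norm_num)
      · push_cast
        have : (s : ℝ) ≠ 0 := by linarith
        refine le_of_eq ?_
        field_simp
        ring
    · refine ⟨2, one_le_two, le_rfl, by norm_num, ?_⟩
      have h6 : (s : ℝ) ≤ 6 := by exact_mod_cast hs rfl
      have : (6 : ℝ)⁻¹ ≤ (s : ℝ)⁻¹ := inv_anti₀ (by linarith) h6
      push_cast
      norm_num at this ⊢
      linarith
  obtain ⟨p, hp1, hp2, hpd, hps⟩ := hpex
  obtain ⟨K, hKt, hK⟩ := exists_eLpNorm_test_le hb hp1 hpd hps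
  set m : ℝ≥0∞ := (volume.restrict Ω) univ ^ (1 / (p : ℝ≥0∞).toReal - 1 / (2 : ℝ≥0∞).toReal)
  have hmt : m ≠ ⊤ := by
    refine ENNReal.rpow_ne_top_of_nonneg ?_ (measure_ne_top _ _)
    simp only [ENNReal.coe_toReal, ENNReal.toReal_ofNat, sub_nonneg]
    exact one_div_le_one_div_of_le (by have : (1 : ℝ) ≤ p := by exact_mod_cast hp1
                                       linarith) (by exact_mod_cast hp2)
  have hCt : K * m ≠ ⊤ := ENNReal.mul_ne_top hKt hmt
  refine ⟨K * m, hCt, ?_⟩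
  have smooth : ∀ φ : E d → ℝ, IsTest Ω φ →
      eLpNorm φ s (volume.restrict Ω) ≤ K * m * gradE Ω φ := by
    intro φ hφ
    have hφ1 : ContDiff ℝ 1 φ := hφ.1.of_le (by simp)
    have h3 : ∑ i, eLpNorm (fun x => fderiv ℝ φ x (basisVec i)) p (volume.restrict Ω) ≤
        gradE Ω φ * m := by
      rw [gradE, Finset.sum_mul]
      refine Finset.sum_le_sum fun i _ => ?_
      rw [eLpNorm_congr_ae (weakPartial_of_contDiff hΩ hb hφ1 i)]
      exact eLpNorm_le_eLpNorm_mul_rpow_measure_univ (by exact_mod_cast hp2)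
        ((hφ1.continuous_fderiv one_ne_zero).clm_apply continuous_const).aestronglyMeasurable
    calc eLpNorm φ s (volume.restrict Ω) ≤ K * (gradE Ω φ * m) :=
          (hK φ hφ).trans (mul_le_mul' le_rfl h3)
      _ = _ := by ring
  rintro u ⟨hu, φ, hφ, hl⟩
  have hφW := fun n => (hφ n).memW1 (q := 2) hΩ hb
  refine eLpNorm_le_of_tendsto (c := fun n => K * m *
    (gradE Ω u + h1e Ω fun x => φ n x - u x)) (fun n => (hφW n).1.1) hu.1.1 ?_ (fun n => ?_) ?_
  · exact tendsto_of_tendsto_of_tendsto_of_le_of_le tendsto_const_nhds hl (fun n => zero_le)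
      fun n => eLpNorm_le_h1e
  · exact (smooth _ (hφ n)).trans (mul_le_mul' le_rfl
      ((gradE_le_add hΩ (hφW n) hu).trans (add_le_add le_rfl gradE_le_h1e)))
  · have : Tendsto (fun n => gradE Ω u + h1e Ω fun x => φ n x - u x) atTop (𝓝 (gradE Ω u)) := by
      simpa using Tendsto.const_add (gradE Ω u) hl
    exact ENNReal.Tendsto.const_mul this (Or.inr hCt)

end SobolevEmbeddings

section VectorFields

variable {Ω : Set (E d)} {u v w : E d → E d}

theorem l2norm_nonneg {F : Type} [NormedAddCommGroup F] (f : E d → F) : 0 ≤ l2norm Ω f :=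
  ENNReal.toReal_nonneg

theorem ofReal_l2norm {F : Type} [NormedAddCommGroup F] {f : E d → F}
    (hf : MemLp f 2 (volume.restrict Ω)) :
    ENNReal.ofReal (l2norm Ω f) = eLpNorm f 2 (volume.restrict Ω) :=
  ENNReal.ofReal_toReal hf.2.ne

theorem l2norm_sq {f : E d → ℝ} (hf : MemLp f 2 (volume.restrict Ω)) :
    l2norm Ω f ^ 2 = ∫ x in Ω, f x ^ 2 := by
  have h0 : 0 ≤ ∫ x in Ω, f x ^ 2 := integral_nonneg fun x => sq_nonneg _
  have := hf.eLpNorm_eq_integral_rpow_norm (by simp) (by simp)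
  simp only [ENNReal.toReal_ofNat, Real.rpow_ofNat, Real.norm_eq_abs, sq_abs] at this
  rw [l2norm, this, ENNReal.toReal_ofReal (by positivity), ← Real.rpow_natCast, ← Real.rpow_mul h0]
  norm_num

theorem l2norm_add_le {f g : E d → ℝ} (hf : MemLp f 2 (volume.restrict Ω))
    (hg : MemLp g 2 (volume.restrict Ω)) :
    l2norm Ω (fun x => f x + g x) ≤ l2norm Ω f + l2norm Ω g := by
  rw [l2norm, l2norm, l2norm, ← ENNReal.toReal_add hf.2.ne hg.2.ne]
  exact ENNReal.toReal_mono (ENNReal.add_ne_top.2 ⟨hf.2.ne, hg.2.ne⟩)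
    (eLpNorm_add_le hf.1 hg.1 one_le_two)

theorem l2norm_const_mul (f : E d → ℝ) (c : ℝ) :
    l2norm Ω (fun x => c * f x) = |c| * l2norm Ω f := by
  have : eLpNorm (fun x => c * f x) 2 (volume.restrict Ω) =
      ‖c‖ₑ * eLpNorm f 2 (volume.restrict Ω) := eLpNorm_const_smul c f 2 _
  rw [l2norm, this, ENNReal.toReal_mul, l2norm]
  simp

theorem l2norm_congr {F : Type} [NormedAddCommGroup F] {f g : E d → F} (h : f =ᵐ[volume.restrict Ω] g) :
    l2norm Ω f = l2norm Ω g := by rw [l2norm, l2norm, eLpNorm_congr_ae h]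

theorem abs_integral_mul_le {f g : E d → ℝ} (hf : MemLp f 2 (volume.restrict Ω))
    (hg : MemLp g 2 (volume.restrict Ω)) :
    |∫ x in Ω, f x * g x| ≤ l2norm Ω f * l2norm Ω g := by
  have h := ENNReal.toReal_mono (ENNReal.mul_ne_top hf.2.ne hg.2.ne)
    (enorm_integral_mul_le hf.1 hg.1)
  simpa [ENNReal.toReal_mul, l2norm] using h

theorem MemX.memLp (hv : MemX Ω v) : MemLp v 2 (volume.restrict Ω) :=
  MemLp.of_eval_piLp fun j => (hv j).1

theorem MemX.memLp_partial (hΩ : IsOpen Ω) (hv : MemX Ω v) (i j : Fin d) :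
    MemLp (weakPartial Ω i fun x => v x j) 2 (volume.restrict Ω) :=
  (hv j).memLp_weakPartial hΩ i

theorem MemX.add (hΩ : IsOpen Ω) (hu : MemX Ω u) (hv : MemX Ω v) : MemX Ω (u + v) :=
  fun j => (hu j).add hΩ (hv j)

theorem MemX.smul (hΩ : IsOpen Ω) (hu : MemX Ω u) (c : ℝ) : MemX Ω (c • u) :=
  fun j => (hu j).const_mul hΩ c

theorem MemX.sub (hΩ : IsOpen Ω) (hu : MemX Ω u) (hv : MemX Ω v) : MemX Ω (u - v) :=
  fun j => (hu j).sub hΩ (hv j)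

/-- The sum of the `L^2` norms of the partial derivatives of the components. -/
def gradN (Ω : Set (E d)) (v : E d → E d) : ℝ :=
  ∑ j, ∑ i, l2norm Ω (weakPartial Ω i fun x => v x j)

/-- The sum of the `L^2` norms of the components and of their partial derivatives. -/
def fullN (Ω : Set (E d)) (v : E d → E d) : ℝ := ∑ j, l2norm Ω (fun x => v x j) + gradN Ω v

theorem gradN_nonneg (v : E d → E d) : 0 ≤ gradN Ω v :=
  Finset.sum_nonneg fun _ _ => Finset.sum_nonneg fun _ _ => l2norm_nonneg _

theorem fullN_nonneg (v : E d → E d) : 0 ≤ fullN Ω v :=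
  add_nonneg (Finset.sum_nonneg fun _ _ => l2norm_nonneg _) (gradN_nonneg v)

theorem gradN_le_fullN (v : E d → E d) : gradN Ω v ≤ fullN Ω v :=
  le_add_of_nonneg_left (Finset.sum_nonneg fun _ _ => l2norm_nonneg _)

theorem l2norm_partial_le_gradN (i j : Fin d) :
    l2norm Ω (weakPartial Ω i fun x => v x j) ≤ gradN Ω v :=
  (Finset.single_le_sum (f := fun i => l2norm Ω (weakPartial Ω i fun x => v x j))
    (fun _ _ => l2norm_nonneg _) (Finset.mem_univ i)).trans
  (Finset.single_le_sum (f := fun j => ∑ i, l2norm Ω (weakPartial Ω i fun x => v x j))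
    (fun _ _ => Finset.sum_nonneg fun _ _ => l2norm_nonneg _) (Finset.mem_univ j))

theorem l2norm_comp_le_fullN (j : Fin d) : l2norm Ω (fun x => v x j) ≤ fullN Ω v :=
  (Finset.single_le_sum (f := fun j => l2norm Ω fun x => v x j)
    (fun _ _ => l2norm_nonneg _) (Finset.mem_univ j)).trans
    (le_add_of_nonneg_right (gradN_nonneg v))

theorem gradN_add_le (hΩ : IsOpen Ω) (hu : MemX Ω u) (hv : MemX Ω v) :
    gradN Ω (u + v) ≤ gradN Ω u + gradN Ω v := by
  simp only [gradN, ← Finset.sum_add_distrib]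
  refine Finset.sum_le_sum fun j _ => Finset.sum_le_sum fun i _ => ?_
  refine (l2norm_congr (weakPartial_add hΩ (hu j) (hv j) i)).le.trans ?_
  exact l2norm_add_le (hu.memLp_partial hΩ i j) (hv.memLp_partial hΩ i j)

theorem gradN_smul (hΩ : IsOpen Ω) (hu : MemX Ω u) (c : ℝ) :
    gradN Ω (c • u) = |c| * gradN Ω u := by
  simp only [gradN, Finset.mul_sum]
  refine Finset.sum_congr rfl fun j _ => Finset.sum_congr rfl fun i _ => ?_
  rw [← l2norm_const_mul]
  exact l2norm_congr (weakPartial_const_mul hΩ (hu j) c i)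

theorem fullN_add_le (hΩ : IsOpen Ω) (hu : MemX Ω u) (hv : MemX Ω v) :
    fullN Ω (u + v) ≤ fullN Ω u + fullN Ω v := by
  have h1 : ∑ j, l2norm Ω (fun x => (u + v) x j) ≤
      ∑ j, l2norm Ω (fun x => u x j) + ∑ j, l2norm Ω (fun x => v x j) := by
    rw [← Finset.sum_add_distrib]
    exact Finset.sum_le_sum fun j _ => l2norm_add_le (hu j).1 (hv j).1
  have h2 := gradN_add_le hΩ hu hv
  simp only [fullN]; linarith

theorem gradE_comp_le (hΩ : IsOpen Ω) (hv : MemX Ω v) (j : Fin d) :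
    gradE Ω (fun x => v x j) ≤ ENNReal.ofReal (gradN Ω v) := by
  have : gradE Ω (fun x => v x j) =
      ENNReal.ofReal (∑ i, l2norm Ω (weakPartial Ω i fun x => v x j)) := by
    rw [ENNReal.ofReal_sum_of_nonneg fun _ _ => l2norm_nonneg _]
    exact Finset.sum_congr rfl fun i _ => (ofReal_l2norm (hv.memLp_partial hΩ i j)).symm
  rw [this]
  refine ENNReal.ofReal_le_ofReal ?_
  exact Finset.single_le_sum (f := fun j => ∑ i, l2norm Ω (weakPartial Ω i fun x => v x j))
    (fun _ _ => Finset.sum_nonneg fun _ _ => l2norm_nonneg _) (Finset.mem_univ j)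

theorem h1e_comp_le (hΩ : IsOpen Ω) (hv : MemX Ω v) (j : Fin d) :
    h1e Ω (fun x => v x j) ≤ ENNReal.ofReal (fullN Ω v) := by
  rw [h1e_eq, fullN, ENNReal.ofReal_add (Finset.sum_nonneg fun _ _ => l2norm_nonneg _)
    (gradN_nonneg v)]
  refine add_le_add ?_ (gradE_comp_le hΩ hv j)
  rw [← ofReal_l2norm (hv j).1]
  exact ENNReal.ofReal_le_ofReal (Finset.single_le_sum (f := fun j => l2norm Ω fun x => v x j)
    (fun _ _ => l2norm_nonneg _) (Finset.mem_univ j))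

theorem fullN_eq_sum_h1e (hΩ : IsOpen Ω) (hv : MemX Ω v) :
    fullN Ω v = ∑ j, (h1e Ω fun x => v x j).toReal := by
  rw [fullN, gradN, ← Finset.sum_add_distrib]
  refine Finset.sum_congr rfl fun j _ => ?_
  rw [h1e, ENNReal.toReal_add (hv j).1.2.ne
    (ENNReal.sum_ne_top.2 fun i _ => (hv.memLp_partial hΩ i j).2.ne),
    ENNReal.toReal_sum fun i _ => (hv.memLp_partial hΩ i j).2.ne]
  rfl

theorem seminormX_nonneg (v : E d → E d) : 0 ≤ seminormX Ω v := Real.sqrt_nonneg _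

theorem seminormX_sq (hΩ : IsOpen Ω) (hv : MemX Ω v) :
    seminormX Ω v ^ 2 = ∑ j, ∑ i, l2norm Ω (weakPartial Ω i fun x => v x j) ^ 2 := by
  rw [seminormX, Real.sq_sqrt]
  · exact Finset.sum_congr rfl fun j _ => Finset.sum_congr rfl fun i _ =>
      (l2norm_sq (hv.memLp_partial hΩ i j)).symm
  · exact Finset.sum_nonneg fun j _ => Finset.sum_nonneg fun i _ =>
      integral_nonneg fun x => sq_nonneg _

theorem l2norm_partial_le_seminormX (hΩ : IsOpen Ω) (hv : MemX Ω v) (i j : Fin d) :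
    l2norm Ω (weakPartial Ω i fun x => v x j) ≤ seminormX Ω v := by
  refine le_of_sq_le_sq ?_ (Real.sqrt_nonneg _)
  rw [seminormX_sq hΩ hv]
  exact (Finset.single_le_sum (f := fun i => l2norm Ω (weakPartial Ω i fun x => v x j) ^ 2)
    (fun _ _ => sq_nonneg _) (Finset.mem_univ i)).trans
    (Finset.single_le_sum (f := fun j => ∑ i, l2norm Ω (weakPartial Ω i fun x => v x j) ^ 2)
    (fun _ _ => Finset.sum_nonneg fun _ _ => sq_nonneg _) (Finset.mem_univ j))

theorem gradN_le_seminormX (hΩ : IsOpen Ω) (hv : MemX Ω v) :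
    gradN Ω v ≤ d * (d * seminormX Ω v) := by
  calc gradN Ω v ≤ ∑ _j : Fin d, ∑ _i : Fin d, seminormX Ω v :=
        Finset.sum_le_sum fun j _ => Finset.sum_le_sum fun i _ =>
          l2norm_partial_le_seminormX hΩ hv i j
    _ = _ := by simp

theorem seminormX_le_gradN (hΩ : IsOpen Ω) (hv : MemX Ω v) : seminormX Ω v ≤ gradN Ω v := by
  refine le_of_sq_le_sq ?_ (gradN_nonneg v)
  rw [seminormX_sq hΩ hv]
  calc _ ≤ ∑ j, ∑ i, l2norm Ω (weakPartial Ω i fun x => v x j) * gradN Ω v :=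
        Finset.sum_le_sum fun j _ => Finset.sum_le_sum fun i _ => by
          rw [sq]
          exact mul_le_mul_of_nonneg_left (l2norm_partial_le_gradN i j) (l2norm_nonneg _)
    _ = gradN Ω v ^ 2 := by simp only [← Finset.sum_mul]; rw [sq]; rfl

theorem seminormX_le_normX (v : E d → E d) : seminormX Ω v ≤ normX Ω v :=
  Real.le_sqrt_of_sq_le (by linarith [sq_nonneg (l2norm Ω v)])

theorem l2norm_le_normX (v : E d → E d) : l2norm Ω v ≤ normX Ω v :=
  Real.le_sqrt_of_sq_le (by linarith [sq_nonneg (seminormX Ω v)])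

theorem l2norm_comp_le (hv : MemX Ω v) (j : Fin d) : l2norm Ω (fun x => v x j) ≤ l2norm Ω v :=
  ENNReal.toReal_mono hv.memLp.2.ne (eLpNorm_mono fun x => PiLp.norm_apply_le (v x) j)

theorem norm_le_sum_abs (y : E d) : ‖y‖ ≤ ∑ i, |y i| := by
  rw [EuclideanSpace.norm_eq]
  refine Real.sqrt_le_iff.2 ⟨by positivity, ?_⟩
  have hs : ∀ i, |y i| ≤ ∑ i, |y i| := fun i =>
    Finset.single_le_sum (f := fun i => |y i|) (fun _ _ => abs_nonneg _) (Finset.mem_univ i)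
  calc ∑ i, ‖y i‖ ^ 2 ≤ ∑ i, |y i| * ∑ i, |y i| := Finset.sum_le_sum fun i _ => by
        rw [sq, Real.norm_eq_abs]
        exact mul_le_mul_of_nonneg_left (hs i) (abs_nonneg _)
    _ = _ := by rw [← Finset.sum_mul, sq]

theorem l2norm_le_sum (hv : ∀ j, MemLp (fun x => v x j) 2 (volume.restrict Ω)) :
    l2norm Ω v ≤ ∑ j, l2norm Ω (fun x => v x j) := by
  have h1 : eLpNorm v 2 (volume.restrict Ω) ≤
      ∑ j, eLpNorm (fun x => v x j) 2 (volume.restrict Ω) := by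
    calc _ ≤ eLpNorm (∑ j, fun x => ‖v x j‖) 2 (volume.restrict Ω) :=
          eLpNorm_mono_real fun x => by
            rw [Finset.sum_apply]; exact norm_le_sum_abs (v x)
      _ ≤ ∑ j, eLpNorm (fun x => ‖v x j‖) 2 (volume.restrict Ω) :=
          eLpNorm_sum_le (fun j _ => (hv j).1.norm) one_le_two
      _ = _ := Finset.sum_congr rfl fun j _ => eLpNorm_norm _
  have h2 := ENNReal.toReal_mono (ENNReal.sum_ne_top.2 fun j _ => (hv j).2.ne) h1
  rwa [ENNReal.toReal_sum fun j _ => (hv j).2.ne] at h2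

theorem fullN_le_normX (hΩ : IsOpen Ω) (hv : MemX Ω v) :
    fullN Ω v ≤ (d + d * d) * normX Ω v := by
  have h1 : ∑ j, l2norm Ω (fun x => v x j) ≤ d * normX Ω v := by
    calc _ ≤ ∑ _j : Fin d, normX Ω v :=
          Finset.sum_le_sum fun j _ => (l2norm_comp_le hv j).trans (l2norm_le_normX v)
      _ = _ := by simp
  have h2 := gradN_le_seminormX hΩ hv
  have h3 : (d : ℝ) * (d * seminormX Ω v) ≤ d * (d * normX Ω v) := by
    have := seminormX_le_normX (Ω := Ω) v
    gcongr
  rw [fullN]; linarith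

theorem normX_le_fullN (hΩ : IsOpen Ω) (hv : MemX Ω v) : normX Ω v ≤ fullN Ω v := by
  have h1 := l2norm_le_sum fun j => (hv j).1
  have h2 := seminormX_le_gradN hΩ hv
  have h3 : normX Ω v ≤ l2norm Ω v + seminormX Ω v := by
    refine Real.sqrt_le_iff.2 ⟨add_nonneg (l2norm_nonneg _) (Real.sqrt_nonneg _), ?_⟩
    have : 0 ≤ l2norm Ω v * seminormX Ω v := mul_nonneg (l2norm_nonneg _) (Real.sqrt_nonneg _)
    nlinarith
  rw [fullN]; linarith

theorem tendstoH1_of_tendsto_normX (hΩ : IsOpen Ω) {φ : ℕ → E d → E d} (hφ : ∀ n, MemX Ω (φ n))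
    (hv : MemX Ω v) (h : Tendsto (fun n => normX Ω (φ n - v)) atTop (𝓝 0)) (j : Fin d) :
    TendstoH1 Ω (fun n x => φ n x j) (fun x => v x j) := by
  have h1 : Tendsto (fun n => ENNReal.ofReal ((d + d * d) * normX Ω (φ n - v))) atTop (𝓝 0) := by
    have := ENNReal.tendsto_ofReal (h.const_mul ((d : ℝ) + d * d))
    simpa using this
  refine tendsto_of_tendsto_of_tendsto_of_le_of_le tendsto_const_nhds h1 (fun n => zero_le)
    fun n => ?_
  refine (h1e_comp_le hΩ ((hφ n).sub hΩ hv) j).trans ?_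
  exact ENNReal.ofReal_le_ofReal (fullN_le_normX hΩ ((hφ n).sub hΩ hv))

theorem contDiff_comp_apply {φ : E d → E d} {n : WithTop ℕ∞} (hφ : ContDiff ℝ n φ) (j : Fin d) :
    ContDiff ℝ n fun x => φ x j :=
  (EuclideanSpace.proj (𝕜 := ℝ) j).contDiff.comp hφ

theorem IsTest.apply {φ : E d → E d} (hφ : IsTest Ω φ) (j : Fin d) : IsTest Ω fun x => φ x j :=
  ⟨contDiff_comp_apply hφ.1 j, hφ.2.1.comp_left (g := fun y : E d => y j) rfl,
    (closure_mono fun x (hx : φ x j ≠ 0) =>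
      (fun h : φ x = 0 => hx (by simp [h]) : x ∈ Function.support φ)).trans hφ.2.2⟩

theorem memX0_iff (hΩ : IsOpen Ω) (hb : Bornology.IsBounded Ω) :
    MemX0 Ω v ↔ ∀ j, MemH0 Ω fun x => v x j := by
  constructor
  · rintro ⟨hv, φ, hφ, h⟩ j
    exact ⟨hv j, fun n x => φ n x j, fun n => (hφ n).apply j, tendstoH1_of_tendsto_normX hΩ
      (fun n k => ((hφ n).apply k).memW1 hΩ hb) hv h j⟩
  · intro h
    have hv : MemX Ω v := fun j => (h j).1
    choose φ hφ hl using fun j => (h j).2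
    let ψ : ℕ → E d → E d := fun n x => WithLp.toLp 2 fun j => φ j n x
    have hψX : ∀ n, MemX Ω (ψ n) := fun n j => (hφ j n).memW1 hΩ hb
    have hsupp : ∀ n, Function.support (ψ n) ⊆ ⋃ j, tsupport (φ j n) := fun n x hx => by
      by_contra hcon
      refine hx ?_
      ext j
      exact image_eq_zero_of_notMem_tsupport (f := φ j n) (x := x) fun hh => hcon (mem_iUnion.2 ⟨j, hh⟩)
    have hcpt : ∀ n, IsCompact (⋃ j, tsupport (φ j n)) := fun n =>
      isCompact_iUnion fun j => (hφ j n).2.1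
    refine ⟨hv, ψ, fun n => ⟨?_, HasCompactSupport.of_support_subset_isCompact (hcpt n) (hsupp n),
      (closure_minimal (hsupp n) (hcpt n).isClosed).trans
        (iUnion_subset fun j => (hφ j n).2.2)⟩, ?_⟩
    · exact contDiff_piLp' 2 fun j => (hφ j n).1
    · have h1 : Tendsto (fun n => fullN Ω (ψ n - v)) atTop (𝓝 0) := by
        have e : (fun n => fullN Ω (ψ n - v)) =
            fun n => ∑ j, (h1e Ω fun x => φ j n x - v x j).toReal := by
          ext n; exact fullN_eq_sum_h1e hΩ ((hψX n).sub hΩ hv)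
        rw [e]
        have : Tendsto (fun n => ∑ j, (h1e Ω fun x => φ j n x - v x j).toReal) atTop
            (𝓝 (∑ _j : Fin d, 0)) := tendsto_finsetSum _ fun j _ => by
          have := (ENNReal.tendsto_toReal ENNReal.zero_ne_top).comp (hl j)
          simpa [Function.comp_def] using this
        simpa using this
      exact tendsto_of_tendsto_of_tendsto_of_le_of_le tendsto_const_nhds h1
        (fun n => Real.sqrt_nonneg _) fun n => normX_le_fullN hΩ ((hψX n).sub hΩ hv)

theorem HasTrace.memHs (hΩ : IsOpen Ω) (hb : Bornology.IsBounded Ω) {g : E d → E d}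
    (h : HasTrace Ω v g) (j : Fin d) : MemHs Ω fun x => v x j := by
  obtain ⟨hv, φ, hφ, hl, -⟩ := h
  exact ⟨hv j, fun n x => φ n x j, fun n => contDiff_comp_apply (hφ n) j,
    tendstoH1_of_tendsto_normX hΩ
      (fun n k => memW1_of_contDiff hΩ hb (contDiff_comp_apply (hφ n) k)) hv hl j⟩

/-- Poincaré's inequality for vector fields. -/
theorem exists_fullN_le_gradN (hd : d = 2 ∨ d = 3) (hΩ : IsOpen Ω) (hb : Bornology.IsBounded Ω) :
    ∃ C : ℝ, 0 < C ∧ ∀ v, MemX0 Ω v → fullN Ω v ≤ C * gradN Ω v := by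
  obtain ⟨C, hC, h⟩ := exists_eLpNorm_le_gradE hd hΩ hb (s := 2) le_rfl (fun _ => by norm_num)
  refine ⟨d * C.toReal + 1, by positivity, fun v hv => ?_⟩
  have hX := hv.1
  have hj : ∀ j, l2norm Ω (fun x => v x j) ≤ C.toReal * gradN Ω v := fun j => by
    have h1 := (h _ ((memX0_iff hΩ hb).1 hv j)).trans
      (mul_le_mul' le_rfl (gradE_comp_le hΩ hX j))
    have h2 := ENNReal.toReal_mono (ENNReal.mul_ne_top hC ENNReal.ofReal_ne_top) h1
    rwa [ENNReal.toReal_mul, ENNReal.toReal_ofReal (gradN_nonneg v)] at h2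
  have : ∑ j, l2norm Ω (fun x => v x j) ≤ ∑ _j : Fin d, C.toReal * gradN Ω v :=
    Finset.sum_le_sum fun j _ => hj j
  simp only [Finset.sum_const, Finset.card_univ, Fintype.card_fin, nsmul_eq_mul] at this
  rw [fullN]; linarith

theorem inner_eq_sum (y z : E d) : inner ℝ y z = ∑ j, y j * z j := by
  simp [PiLp.inner_apply, mul_comm]

theorem integral_inner_eq {f : E d → E d} (hf : MemLp f 2 (volume.restrict Ω))
    (hv : MemLp v 2 (volume.restrict Ω)) :
    ∫ x in Ω, inner ℝ (f x) (v x) = ∑ j, ∫ x in Ω, f x j * v x j := by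
  simp only [inner_eq_sum]
  exact integral_finsetSum _ fun j _ => (hf.eval_piLp j).integrable_mul (hv.eval_piLp j)

theorem MemX0.smul (hΩ : IsOpen Ω) (hb : Bornology.IsBounded Ω) (hv : MemX0 Ω v) (c : ℝ) :
    MemX0 Ω (c • v) :=
  (memX0_iff hΩ hb).2 fun j => ((memX0_iff hΩ hb).1 hv j).const_mul hΩ hb c

theorem MemX0.add (hΩ : IsOpen Ω) (hb : Bornology.IsBounded Ω) (hu : MemX0 Ω u)
    (hv : MemX0 Ω v) : MemX0 Ω (u + v) :=
  (memX0_iff hΩ hb).2 fun j => ((memX0_iff hΩ hb).1 hu j).add hΩ hb ((memX0_iff hΩ hb).1 hv j)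

theorem seminormX_smul (hΩ : IsOpen Ω) (hv : MemX Ω v) (c : ℝ) :
    seminormX Ω (c • v) = |c| * seminormX Ω v := by
  have h0 : 0 ≤ |c| * seminormX Ω v := mul_nonneg (abs_nonneg _) (seminormX_nonneg _)
  rw [← Real.sqrt_sq (seminormX_nonneg (c • v)), ← Real.sqrt_sq h0, mul_pow,
    seminormX_sq hΩ hv, seminormX_sq hΩ (hv.smul hΩ c)]
  congr 1
  simp only [Finset.mul_sum]
  refine Finset.sum_congr rfl fun j _ => Finset.sum_congr rfl fun i _ => ?_
  rw [← mul_pow, ← l2norm_const_mul]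
  congr 1
  exact l2norm_congr (weakPartial_const_mul hΩ (hv j) c i)

theorem memX0_zero (hΩ : IsOpen Ω) (hb : Bornology.IsBounded Ω) : MemX0 Ω (0 : E d → E d) := by
  refine (memX0_iff hΩ hb).2 fun j => IsTest.memH0 hΩ hb ⟨contDiff_const, ?_, ?_⟩
  · exact HasCompactSupport.zero
  · simp [tsupport]

/-- The duality pairing is bounded by the dual norm, which is non-negative. -/
theorem abs_integral_inner_le_dualNorm (hd : d = 2 ∨ d = 3) (hΩ : IsOpen Ω)
    (hb : Bornology.IsBounded Ω) {f : E d → E d} (hf : MemLp f 2 (volume.restrict Ω)) :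
    0 ≤ dualNorm Ω f ∧
    ∀ v, MemX0 Ω v → |∫ x in Ω, inner ℝ (f x) (v x)| ≤ dualNorm Ω f * seminormX Ω v := by
  obtain ⟨C, hC, hP⟩ := exists_fullN_le_gradN hd hΩ hb
  set A : ℝ := ∑ j, l2norm Ω (fun x => f x j) * (C * (d * d)) with hA
  have hA0 : 0 ≤ A := Finset.sum_nonneg fun j _ => mul_nonneg (l2norm_nonneg _) (by positivity)
  have hbd : ∀ v, MemX0 Ω v → |∫ x in Ω, inner ℝ (f x) (v x)| ≤ A * seminormX Ω v := by
    intro v hv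
    rw [integral_inner_eq hf hv.1.memLp, hA, Finset.sum_mul]
    refine (Finset.abs_sum_le_sum_abs _ _).trans (Finset.sum_le_sum fun j _ => ?_)
    refine (abs_integral_mul_le (hf.eval_piLp j) (hv.1 j).1).trans ?_
    rw [mul_assoc]
    refine mul_le_mul_of_nonneg_left ?_ (l2norm_nonneg _)
    calc _ ≤ fullN Ω v := l2norm_comp_le_fullN j
      _ ≤ C * gradN Ω v := hP v hv
      _ ≤ C * (d * (d * seminormX Ω v)) :=
        mul_le_mul_of_nonneg_left (gradN_le_seminormX hΩ hv.1) hC.le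
      _ = _ := by ring
  have hba : BddAbove {t | ∃ v, MemX0 Ω v ∧ seminormX Ω v ≤ 1 ∧
      t = ∫ x in Ω, inner ℝ (f x) (v x)} := by
    refine ⟨A, ?_⟩
    rintro t ⟨v, hv, hv1, rfl⟩
    exact (le_abs_self _).trans ((hbd v hv).trans (mul_le_of_le_one_right hA0 hv1))
  have h0X := memX0_zero (Ω := Ω) hΩ hb
  have h0 : 0 ≤ dualNorm Ω f := by
    refine le_csSup hba ⟨0, h0X, ?_, by simp⟩
    have := seminormX_smul hΩ h0X.1 0
    simp only [smul_zero, abs_zero, zero_mul] at this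
    rw [this]; exact zero_le_one
  refine ⟨h0, fun v hv => ?_⟩
  have hone : ∀ v, MemX0 Ω v → ∫ x in Ω, inner ℝ (f x) (v x) ≤ dualNorm Ω f * seminormX Ω v := by
    intro v hv
    rcases (seminormX_nonneg (Ω := Ω) v).eq_or_lt with hz | hpos
    · have := (le_abs_self _).trans (hbd v hv)
      rw [← hz] at this ⊢
      simpa using this
    · have hm : (seminormX Ω v)⁻¹ * ∫ x in Ω, inner ℝ (f x) (v x) ≤ dualNorm Ω f := by
        refine le_csSup hba ⟨(seminormX Ω v)⁻¹ • v, hv.smul hΩ hb _, ?_, ?_⟩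
        · rw [seminormX_smul hΩ hv.1, abs_of_pos (inv_pos.2 hpos), inv_mul_cancel₀ hpos.ne']
        · simp only [Pi.smul_apply, inner_smul_right]
          rw [integral_const_mul]
      rwa [inv_mul_le_iff₀ hpos, mul_comm] at hm
  rw [abs_le]
  constructor
  · have := hone _ (hv.smul hΩ hb (-1))
    rw [seminormX_smul hΩ hv.1] at this
    simp only [Pi.smul_apply, inner_smul_right, integral_const_mul, abs_neg, abs_one, one_mul] at this
    linarith
  · exact hone v hv

end VectorFields

section Forms

variable {Ω : Set (E d)} {u u' v v' z z' : E d → E d} {εh q q' : E d → ℝ} {α β : ℝ → ℝ} {Re : ℝ}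

theorem integral_mul_add_eq {μ : Measure (E d)} {F F' H : E d → ℝ} {c : ℝ} (hF : Integrable F μ)
    (hF' : Integrable F' μ) (h : H =ᵐ[μ] fun x => c * F x + F' x) :
    ∫ x, H x ∂μ = c * ∫ x, F x ∂μ + ∫ x, F' x ∂μ := by
  rw [integral_congr_ae h, integral_add (hF.const_mul c) hF', integral_const_mul]

theorem integral_eq_sum_sum {μ : Measure (E d)} {H : E d → ℝ} {F : Fin d → Fin d → E d → ℝ}
    (hF : ∀ j i, Integrable (F j i) μ) (h : ∀ x, H x = ∑ j, ∑ i, F j i x) :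
    ∫ x, H x ∂μ = ∑ j, ∑ i, ∫ x, F j i x ∂μ := by
  simp only [h]
  rw [integral_finsetSum _ fun j _ => integrable_finsetSum _ fun i _ => hF j i]
  exact Finset.sum_congr rfl fun j _ => integral_finsetSum _ fun i _ => hF j i

theorem weakPartial_mul_add (hΩ : IsOpen Ω) {f g : E d → ℝ} (hf : MemW1 Ω 2 f) (hg : MemW1 Ω 2 g)
    (c : ℝ) : ∀ᵐ x ∂(volume.restrict Ω), ∀ i, weakPartial Ω i (fun x => c * f x + g x) x =
      c * weakPartial Ω i f x + weakPartial Ω i g x := by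
  refine ae_all_iff.2 fun i => ?_
  filter_upwards [weakPartial_add hΩ (hf.const_mul hΩ c) hg i, weakPartial_const_mul hΩ hf c i]
    with x h1 h2
  rw [h1, h2]

theorem MemX.weakPartial_smul_add (hΩ : IsOpen Ω) (hu : MemX Ω u) (hu' : MemX Ω u') (c : ℝ) :
    ∀ᵐ x ∂(volume.restrict Ω), ∀ j i, weakPartial Ω i (fun x => (c • u + u') x j) x =
      c * weakPartial Ω i (fun x => u x j) x + weakPartial Ω i (fun x => u' x j) x :=
  ae_all_iff.2 fun j => weakPartial_mul_add hΩ (hu j) (hu' j) c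

theorem MemX.mul_lip (hΩ : IsOpen Ω) (hε : IsW1Lip Ω εh) (hu : MemX Ω u) :
    MemX Ω fun x => εh x • u x := fun j => by
  have := (hu j).mul_lip hΩ hε
  simp only [mul_comm] at this
  exact this

theorem MemX.memLp_weakDiv (hΩ : IsOpen Ω) (hu : MemX Ω u) :
    MemLp (weakDiv Ω u) 2 (volume.restrict Ω) :=
  memLp_finsetSum _ fun i _ => hu.memLp_partial hΩ i i

theorem weakDiv_smul_add (hΩ : IsOpen Ω) (hε : IsW1Lip Ω εh) (hu : MemX Ω u) (hu' : MemX Ω u')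
    (c : ℝ) : weakDiv Ω (fun y => εh y • (c • u + u') y) =ᵐ[volume.restrict Ω] fun x =>
      c * weakDiv Ω (fun y => εh y • u y) x + weakDiv Ω (fun y => εh y • u' y) x := by
  have e : (fun y => εh y • (c • u + u') y) =
      c • (fun y => εh y • u y) + fun y => εh y • u' y := by
    ext y j
    simp only [Pi.add_apply, Pi.smul_apply, PiLp.add_apply, PiLp.smul_apply, smul_eq_mul]
    ring
  filter_upwards [(hu.mul_lip hΩ hε).weakPartial_smul_add hΩ (hu'.mul_lip hΩ hε) c] with x hx
  rw [e]
  simp only [weakDiv, hx, Finset.sum_add_distrib, Finset.mul_sum]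

/-- A vector field with bounded, uniformly locally Lipschitz components. -/
def LipX (Ω : Set (E d)) (v : E d → E d) : Prop := ∀ j, IsW1Lip Ω fun x => v x j

theorem LipX.memX (hΩ : IsOpen Ω) (hb : Bornology.IsBounded Ω) (hv : LipX Ω v) : MemX Ω v :=
  fun j => (hv j).memW1 hΩ hb

theorem memLp_inner (hΩ : IsOpen Ω) (hz : MemLp z 2 (volume.restrict Ω)) (hv : LipX Ω v) :
    MemLp (fun x => inner ℝ (z x) (v x)) 2 (volume.restrict Ω) := by
  simp only [inner_eq_sum]
  exact memLp_finsetSum _ fun j _ => memLp_mul_top (hz.eval_piLp j) ((hv j).memLp_top hΩ)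

theorem integrable_formA_grad (hΩ : IsOpen Ω) (hε : IsW1Lip Ω εh) (hu : MemX Ω u)
    (hv : MemX Ω v) : Integrable (fun x => εh x * ∑ j, ∑ i,
      weakPartial Ω i (fun y => u y j) x * weakPartial Ω i (fun y => v y j) x)
      (volume.restrict Ω) := by
  simp only [Finset.mul_sum]
  refine integrable_finsetSum _ fun j _ => integrable_finsetSum _ fun i _ => ?_
  have := (memLp_mul_top (hu.memLp_partial hΩ i j) (hε.memLp_top hΩ)).integrable_mul
    (hv.memLp_partial hΩ i j)
  refine this.congr (ae_of_all _ fun x => ?_)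
  simp only [Pi.mul_apply]; ring

theorem integrable_mul_inner {a : E d → ℝ} (ha : MemLp a ⊤ (volume.restrict Ω))
    (hu : MemLp u 2 (volume.restrict Ω)) (hv : MemLp v 2 (volume.restrict Ω)) :
    Integrable (fun x => a x * inner ℝ (u x) (v x)) (volume.restrict Ω) := by
  simp only [inner_eq_sum, Finset.mul_sum]
  refine integrable_finsetSum _ fun j _ => ?_
  have := (memLp_mul_top (hu.eval_piLp j) ha).integrable_mul (hv.eval_piLp j)
  refine this.congr (ae_of_all _ fun x => ?_)
  simp only [Pi.mul_apply]; ring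

theorem integrable_formD_conv (hΩ : IsOpen Ω) (hε : IsW1Lip Ω εh) (hu : MemX Ω u)
    (hz : MemX Ω z) (hv : LipX Ω v) : Integrable (fun x => εh x * ∑ j,
      (∑ i, u x i * weakPartial Ω i (fun y => z y j) x) * v x j) (volume.restrict Ω) := by
  simp only [Finset.mul_sum, Finset.sum_mul]
  refine integrable_finsetSum _ fun j _ => integrable_finsetSum _ fun i _ => ?_
  have := (memLp_mul_top (hu i).1 (hε.memLp_top hΩ)).integrable_mul
    (memLp_mul_top (hz.memLp_partial hΩ i j) ((hv j).memLp_top hΩ))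
  refine this.congr (ae_of_all _ fun x => ?_)
  simp only [Pi.mul_apply]; ring

theorem integrable_formD_div (hΩ : IsOpen Ω) (hε : IsW1Lip Ω εh) (hu : MemX Ω u)
    (hz : MemX Ω z) (hv : LipX Ω v) : Integrable (fun x =>
      weakDiv Ω (fun y => εh y • u y) x * inner ℝ (z x) (v x)) (volume.restrict Ω) :=
  ((hu.mul_lip hΩ hε).memLp_weakDiv hΩ).integrable_mul (memLp_inner hΩ hz.memLp hv)

theorem integrable_formC_norm (hΩ : IsOpen Ω) (hβ : MemLp (fun x => β (εh x)) ⊤ (volume.restrict Ω))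
    (hu : MemX Ω u) (hz : MemX Ω z) (hv : LipX Ω v) : Integrable (fun x =>
      β (εh x) * ‖u x‖ * inner ℝ (z x) (v x)) (volume.restrict Ω) := by
  refine ((memLp_mul_top hu.memLp.norm hβ).integrable_mul (memLp_inner hΩ hz.memLp hv)).congr
    (ae_of_all _ fun x => ?_)
  simp only [Pi.mul_apply]; ring

theorem integrable_formB (hΩ : IsOpen Ω) (hε : IsW1Lip Ω εh) (hv : MemX Ω v)
    (hq : MemLp q 2 (volume.restrict Ω)) : Integrable (fun x =>
      weakDiv Ω (fun y => εh y • v y) x * q x) (volume.restrict Ω) :=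
  ((hv.mul_lip hΩ hε).memLp_weakDiv hΩ).integrable_mul hq

theorem formA_smul_add_left (hΩ : IsOpen Ω) (hε : IsW1Lip Ω εh)
    (hα : MemLp (fun x => α (εh x)) ⊤ (volume.restrict Ω)) (hu : MemX Ω u) (hu' : MemX Ω u')
    (hv : MemX Ω v) (c : ℝ) :
    formA Ω Re α εh (c • u + u') v = c * formA Ω Re α εh u v + formA Ω Re α εh u' v := by
  have h1 := integral_mul_add_eq (c := c) (integrable_formA_grad hΩ hε hu hv)
    (integrable_formA_grad hΩ hε hu' hv) (H := fun x => εh x * ∑ j, ∑ i,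
      weakPartial Ω i (fun y => (c • u + u') y j) x * weakPartial Ω i (fun y => v y j) x) (by
      filter_upwards [hu.weakPartial_smul_add hΩ hu' c] with x hx
      simp only [hx, add_mul, Finset.sum_add_distrib, mul_add, Finset.mul_sum]
      congr 1
      exact Finset.sum_congr rfl fun j _ => Finset.sum_congr rfl fun i _ => by ring)
  have h2 := integral_mul_add_eq (c := c) (integrable_mul_inner hα hu.memLp hv.memLp)
    (integrable_mul_inner hα hu'.memLp hv.memLp)
    (H := fun x => α (εh x) * inner ℝ ((c • u + u') x) (v x)) (ae_of_all _ fun x => by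
      simp only [Pi.add_apply, Pi.smul_apply, inner_add_left, real_inner_smul_left]; ring)
  rw [formA, h1, h2, formA, formA]
  ring

theorem formA_comm : formA Ω Re α εh u v = formA Ω Re α εh v u := by
  simp only [formA, mul_comm (weakPartial Ω _ (fun y => u y _) _), real_inner_comm (u _) (v _)]

theorem formA_smul_add_right (hΩ : IsOpen Ω) (hε : IsW1Lip Ω εh)
    (hα : MemLp (fun x => α (εh x)) ⊤ (volume.restrict Ω)) (hu : MemX Ω u) (hv : MemX Ω v)
    (hv' : MemX Ω v') (c : ℝ) :
    formA Ω Re α εh u (c • v + v') = c * formA Ω Re α εh u v + formA Ω Re α εh u v' := by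
  rw [formA_comm, formA_smul_add_left hΩ hε hα hv hv' hu, formA_comm, formA_comm (u := v')]

theorem formD_smul_add_left (hΩ : IsOpen Ω) (hε : IsW1Lip Ω εh) (hu : MemX Ω u)
    (hu' : MemX Ω u') (hz : MemX Ω z) (hv : LipX Ω v) (c : ℝ) :
    formD Ω εh (c • u + u') z v = c * formD Ω εh u z v + formD Ω εh u' z v := by
  have h1 := integral_mul_add_eq (c := c) (integrable_formD_conv hΩ hε hu hz hv)
    (integrable_formD_conv hΩ hε hu' hz hv) (H := fun x => εh x * ∑ j,
      (∑ i, (c • u + u') x i * weakPartial Ω i (fun y => z y j) x) * v x j)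
      (ae_of_all _ fun x => by
      simp only [Pi.add_apply, Pi.smul_apply, PiLp.add_apply, PiLp.smul_apply, smul_eq_mul,
        add_mul, Finset.sum_add_distrib, mul_add, Finset.mul_sum, Finset.sum_mul]
      congr 1
      exact Finset.sum_congr rfl fun j _ => Finset.sum_congr rfl fun i _ => by ring)
  have h2 := integral_mul_add_eq (c := c) (integrable_formD_div hΩ hε hu hz hv)
    (integrable_formD_div hΩ hε hu' hz hv)
    (H := fun x => weakDiv Ω (fun y => εh y • (c • u + u') y) x * inner ℝ (z x) (v x)) (by
      filter_upwards [weakDiv_smul_add hΩ hε hu hu' c] with x hx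
      rw [hx]; ring)
  rw [formD, h1, h2, formD, formD]
  ring

theorem formC_smul_add_mid (hΩ : IsOpen Ω) (hε : IsW1Lip Ω εh)
    (hβ : MemLp (fun x => β (εh x)) ⊤ (volume.restrict Ω)) (hu : MemX Ω u)
    (hz : MemX Ω z) (hz' : MemX Ω z') (hv : LipX Ω v) (c : ℝ) :
    formC Ω β εh u (c • z + z') v = c * formC Ω β εh u z v + formC Ω β εh u z' v := by
  have h1 := integral_mul_add_eq (c := c) (integrable_formD_conv hΩ hε hu hz hv)
    (integrable_formD_conv hΩ hε hu hz' hv) (H := fun x => εh x * ∑ j,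
      (∑ i, u x i * weakPartial Ω i (fun y => (c • z + z') y j) x) * v x j) (by
      filter_upwards [hz.weakPartial_smul_add hΩ hz' c] with x hx
      simp only [hx, add_mul, Finset.sum_add_distrib, mul_add, Finset.mul_sum, Finset.sum_mul]
      congr 1
      exact Finset.sum_congr rfl fun j _ => Finset.sum_congr rfl fun i _ => by ring)
  have h2 := integral_mul_add_eq (c := c) (integrable_formD_div hΩ hε hu hz hv)
    (integrable_formD_div hΩ hε hu hz' hv)
    (H := fun x => weakDiv Ω (fun y => εh y • u y) x * inner ℝ ((c • z + z') x) (v x))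
    (ae_of_all _ fun x => by
      simp only [Pi.add_apply, Pi.smul_apply, inner_add_left, real_inner_smul_left]; ring)
  have h3 := integral_mul_add_eq (c := c) (integrable_formC_norm hΩ hβ hu hz hv)
    (integrable_formC_norm hΩ hβ hu hz' hv)
    (H := fun x => β (εh x) * ‖u x‖ * inner ℝ ((c • z + z') x) (v x))
    (ae_of_all _ fun x => by
      simp only [Pi.add_apply, Pi.smul_apply, inner_add_left, real_inner_smul_left]; ring)
  rw [formC, formD, h1, h2, h3, formC, formD, formC, formD]
  ring

theorem formC_smul_add_right (hΩ : IsOpen Ω) (hε : IsW1Lip Ω εh)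
    (hβ : MemLp (fun x => β (εh x)) ⊤ (volume.restrict Ω)) (hu : MemX Ω u)
    (hz : MemX Ω z) (hv : LipX Ω v) (hv' : LipX Ω v') (c : ℝ) :
    formC Ω β εh u z (c • v + v') = c * formC Ω β εh u z v + formC Ω β εh u z v' := by
  have h1 := integral_mul_add_eq (c := c) (integrable_formD_conv hΩ hε hu hz hv)
    (integrable_formD_conv hΩ hε hu hz hv') (H := fun x => εh x * ∑ j,
      (∑ i, u x i * weakPartial Ω i (fun y => z y j) x) * (c • v + v') x j)
      (ae_of_all _ fun x => by
      simp only [Pi.add_apply, Pi.smul_apply, PiLp.add_apply, PiLp.smul_apply, smul_eq_mul,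
        Finset.sum_add_distrib, mul_add, Finset.mul_sum, Finset.sum_mul]
      congr 1
      exact Finset.sum_congr rfl fun j _ => Finset.sum_congr rfl fun i _ => by ring)
  have h2 := integral_mul_add_eq (c := c) (integrable_formD_div hΩ hε hu hz hv)
    (integrable_formD_div hΩ hε hu hz hv')
    (H := fun x => weakDiv Ω (fun y => εh y • u y) x * inner ℝ (z x) ((c • v + v') x))
    (ae_of_all _ fun x => by
      simp only [Pi.add_apply, Pi.smul_apply, inner_add_right, real_inner_smul_right]; ring)
  have h3 := integral_mul_add_eq (c := c) (integrable_formC_norm hΩ hβ hu hz hv)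
    (integrable_formC_norm hΩ hβ hu hz hv')
    (H := fun x => β (εh x) * ‖u x‖ * inner ℝ (z x) ((c • v + v') x))
    (ae_of_all _ fun x => by
      simp only [Pi.add_apply, Pi.smul_apply, inner_add_right, real_inner_smul_right]; ring)
  rw [formC, formD, h1, h2, h3, formC, formD, formC, formD]
  ring

theorem formB_smul_add_left (hΩ : IsOpen Ω) (hε : IsW1Lip Ω εh) (hv : MemX Ω v)
    (hv' : MemX Ω v') (hq : MemLp q 2 (volume.restrict Ω)) (c : ℝ) :
    formB Ω εh (c • v + v') q = c * formB Ω εh v q + formB Ω εh v' q := by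
  refine integral_mul_add_eq (integrable_formB hΩ hε hv hq) (integrable_formB hΩ hε hv' hq) ?_
  filter_upwards [weakDiv_smul_add hΩ hε hv hv' c] with x hx
  rw [hx]; ring

theorem formB_smul_add_right (hΩ : IsOpen Ω) (hε : IsW1Lip Ω εh) (hv : MemX Ω v)
    (hq : MemLp q 2 (volume.restrict Ω)) (hq' : MemLp q' 2 (volume.restrict Ω)) (c : ℝ) :
    formB Ω εh v (c • q + q') = c * formB Ω εh v q + formB Ω εh v q' := by
  refine integral_mul_add_eq (integrable_formB hΩ hε hv hq) (integrable_formB hΩ hε hv hq')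
    (ae_of_all _ fun x => ?_)
  simp only [Pi.add_apply, Pi.smul_apply, smul_eq_mul]; ring

theorem formL_smul_add {f : E d → E d} (hΩ : IsOpen Ω) (hε : IsW1Lip Ω εh)
    (hf : MemLp f 2 (volume.restrict Ω)) (hv : MemX Ω v) (hv' : MemX Ω v') (c : ℝ) :
    formL Ω εh f (c • v + v') = c * formL Ω εh f v + formL Ω εh f v' := by
  refine integral_mul_add_eq (integrable_mul_inner (hε.memLp_top hΩ) hf hv.memLp)
    (integrable_mul_inner (hε.memLp_top hΩ) hf hv'.memLp) (ae_of_all _ fun x => ?_)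
  simp only [Pi.add_apply, Pi.smul_apply, inner_add_right, real_inner_smul_right]; ring

theorem ae_restrict_of_eqOn {F : Type*} (hΩ : IsOpen Ω) {f g : E d → F} (h : EqOn f g Ω) :
    f =ᵐ[volume.restrict Ω] g :=
  (ae_restrict_iff' hΩ.measurableSet).2 (ae_of_all _ h)

theorem weakPartial_congr_of_eqOn (hΩ : IsOpen Ω) (h : EqOn u u' Ω) (i j : Fin d) :
    weakPartial Ω i (fun x => u x j) = weakPartial Ω i fun x => u' x j :=
  weakPartial_congr (ae_restrict_of_eqOn hΩ fun x hx => by simp only [h hx])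

theorem formA_congr (hΩ : IsOpen Ω) (hu : EqOn u u' Ω) (hv : EqOn v v' Ω) :
    formA Ω Re α εh u v = formA Ω Re α εh u' v' := by
  simp only [formA, weakPartial_congr_of_eqOn hΩ hu, weakPartial_congr_of_eqOn hΩ hv]
  congr 1
  exact setIntegral_congr_fun hΩ.measurableSet fun x hx => by simp only [hu hx, hv hx]

theorem weakDiv_congr (hΩ : IsOpen Ω) (hu : EqOn u u' Ω) :
    weakDiv Ω (fun y => εh y • u y) = weakDiv Ω fun y => εh y • u' y := by
  ext x
  refine Finset.sum_congr rfl fun i _ => ?_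
  rw [weakPartial_congr_of_eqOn hΩ (u := fun y => εh y • u y) (u' := fun y => εh y • u' y)
    fun x hx => by simp only [hu hx]]

theorem formC_congr (hΩ : IsOpen Ω) (hu : EqOn u u' Ω) (hz : EqOn z z' Ω) (hv : EqOn v v' Ω) :
    formC Ω β εh u z v = formC Ω β εh u' z' v' := by
  simp only [formC, formD, weakPartial_congr_of_eqOn hΩ hz, weakDiv_congr hΩ hu]
  congr 1
  · congr 1
    · exact setIntegral_congr_fun hΩ.measurableSet fun x hx => by simp only [hu hx, hv hx]
    · congr 1
      exact setIntegral_congr_fun hΩ.measurableSet fun x hx => by simp only [hz hx, hv hx]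
  · exact setIntegral_congr_fun hΩ.measurableSet fun x hx => by simp only [hu hx, hz hx, hv hx]

theorem formB_congr (hΩ : IsOpen Ω) (hv : EqOn v v' Ω) (hq : EqOn q q' Ω) :
    formB Ω εh v q = formB Ω εh v' q' := by
  simp only [formB, weakDiv_congr hΩ hv]
  exact setIntegral_congr_fun hΩ.measurableSet fun x hx => by simp only [hq hx]

theorem formL_congr {f : E d → E d} (hΩ : IsOpen Ω) (hv : EqOn v v' Ω) :
    formL Ω εh f v = formL Ω εh f v' :=
  setIntegral_congr_fun hΩ.measurableSet fun x hx => by simp only [hv hx]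

/-- Antisymmetry of the convection form. -/
theorem formD_self (hΩ : IsOpen Ω) (hb : Bornology.IsBounded Ω) (hε : IsW1Lip Ω εh)
    (hu : MemX Ω u) (hv : LipX Ω v) (hv0 : MemX0 Ω v) : formD Ω εh u v v = 0 := by
  have hvX := hv.memX hΩ hb
  have hU := hu.mul_lip hΩ hε
  have i1 : ∀ i j, Integrable (fun x => εh x * u x i * v x j * weakPartial Ω i (fun y => v y j) x)
      (volume.restrict Ω) := fun i j =>
    (memLp_mul_top (hU i).1 ((hv j).memLp_top hΩ)).integrable_mul (hvX.memLp_partial hΩ i j)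
  have i2 : ∀ i j, Integrable (fun x => weakPartial Ω i (fun y => (εh y • u y) i) x * v x j * v x j)
      (volume.restrict Ω) := fun i j =>
    (memLp_mul_top (hU.memLp_partial hΩ i i) ((hv j).memLp_top hΩ)).integrable_mul (hvX j).1
  have key : ∀ i j, (∫ x in Ω, εh x * u x i * v x j * weakPartial Ω i (fun y => v y j) x) +
      1 / 2 * ∫ x in Ω, weakPartial Ω i (fun y => (εh y • u y) i) x * v x j * v x j = 0 := by
    intro i j
    have hW := (hU i).mul_lip hΩ (hv j)
    have := integral_mul_weakPartial_eq hΩ hb (hW.hasWeakPartial i) hW.1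
      (hW.memLp_weakPartial hΩ i) ((memX0_iff hΩ hb).1 hv0 j)
    have e : ∫ x in Ω, weakPartial Ω i (fun x => (εh x • u x) i * v x j) x * v x j =
        (∫ x in Ω, weakPartial Ω i (fun y => (εh y • u y) i) x * v x j * v x j) +
        ∫ x in Ω, εh x * u x i * v x j * weakPartial Ω i (fun y => v y j) x := by
      rw [← integral_add (i2 i j) (i1 i j)]
      refine integral_congr_ae ?_
      filter_upwards [weakPartial_mul_lip hΩ (hU i) (hv j) i] with x hx
      rw [hx]
      simp only [PiLp.smul_apply, smul_eq_mul]
      ring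
    rw [e] at this
    simp only [PiLp.smul_apply, smul_eq_mul] at this ⊢
    linarith
  have e1 : ∫ x in Ω, εh x * ∑ j, (∑ i, u x i * weakPartial Ω i (fun y => v y j) x) * v x j =
      ∑ j, ∑ i, ∫ x in Ω, εh x * u x i * v x j * weakPartial Ω i (fun y => v y j) x := by
    refine integral_eq_sum_sum (fun j i => i1 i j) fun x => ?_
    simp only [Finset.mul_sum, Finset.sum_mul]
    exact Finset.sum_congr rfl fun j _ => Finset.sum_congr rfl fun i _ => by ring
  have e2 : ∫ x in Ω, weakDiv Ω (fun y => εh y • u y) x * inner ℝ (v x) (v x) =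
      ∑ j, ∑ i, ∫ x in Ω, weakPartial Ω i (fun y => (εh y • u y) i) x * v x j * v x j := by
    refine integral_eq_sum_sum (fun j i => i2 i j) fun x => ?_
    simp only [inner_eq_sum, weakDiv, Finset.mul_sum, Finset.sum_mul]
    exact Finset.sum_congr rfl fun j _ => Finset.sum_congr rfl fun i _ => by ring
  rw [formD, e1, e2, Finset.mul_sum, ← Finset.sum_add_distrib]
  refine Finset.sum_eq_zero fun j _ => ?_
  rw [Finset.mul_sum, ← Finset.sum_add_distrib]
  exact Finset.sum_eq_zero fun i _ => key i j

end Forms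

section Bounds

variable {Ω : Set (E d)} {u u' v z : E d → E d} {εh : E d → ℝ} {α β : ℝ → ℝ} {Re : ℝ}

instance holderTriple_four : ENNReal.HolderTriple 4 4 2 where
  inv_add_inv_eq_inv := by
    rw [← two_mul, show (4 : ℝ≥0∞) = 2 * 2 by norm_num,
      ENNReal.mul_inv (by simp) (by simp), ← mul_assoc,
      ENNReal.mul_inv_cancel (by simp) (by simp), one_mul]

theorem eLpNorm_mul_le_of_holder {μ : Measure (E d)} {f g : E d → ℝ} {p q : ℝ≥0∞}
    [ENNReal.HolderTriple p q 2] (hf : AEStronglyMeasurable f μ) (hg : AEStronglyMeasurable g μ) :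
    eLpNorm (fun x => f x * g x) 2 μ ≤ eLpNorm f p μ * eLpNorm g q μ := by
  have h := eLpNorm_smul_le_mul_eLpNorm (p := p) (q := q) (r := 2) hg hf
  rwa [smul_eq_mul] at h

theorem abs_integral_mul_le_of_eLpNorm_le {μ : Measure (E d)} {f g : E d → ℝ} {a b : ℝ}
    (hf : AEStronglyMeasurable f μ) (hg : AEStronglyMeasurable g μ) (ha : 0 ≤ a) (hb : 0 ≤ b)
    (hfa : eLpNorm f 2 μ ≤ ENNReal.ofReal a) (hgb : eLpNorm g 2 μ ≤ ENNReal.ofReal b) :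
    |∫ x, f x * g x ∂μ| ≤ a * b := by
  have h := (enorm_integral_mul_le hf hg).trans (mul_le_mul' hfa hgb)
  rw [← ENNReal.ofReal_mul ha, Real.enorm_eq_ofReal_abs] at h
  exact (ENNReal.ofReal_le_ofReal_iff (mul_nonneg ha hb)).1 h

theorem eLpNorm_mul_le_ofReal {μ : Measure (E d)} {f g : E d → ℝ} {p q : ℝ≥0∞} {a b : ℝ}
    [ENNReal.HolderTriple p q 2] (hf : AEStronglyMeasurable f μ) (hg : AEStronglyMeasurable g μ)
    (ha : 0 ≤ a) (hfa : eLpNorm f p μ ≤ ENNReal.ofReal a) (hgb : eLpNorm g q μ ≤ ENNReal.ofReal b) :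
    eLpNorm (fun x => f x * g x) 2 μ ≤ ENNReal.ofReal (a * b) := by
  rw [ENNReal.ofReal_mul ha]
  exact (eLpNorm_mul_le_of_holder hf hg).trans (mul_le_mul' hfa hgb)

theorem eLpNorm_mul_le_of_bound {μ : Measure (E d)} {c f : E d → ℝ} {A a : ℝ}
    (hc : ∀ᵐ x ∂μ, |c x| ≤ A) (hA : 0 ≤ A) (hf : eLpNorm f 2 μ ≤ ENNReal.ofReal a) :
    eLpNorm (fun x => f x * c x) 2 μ ≤ ENNReal.ofReal (A * a) := by
  rw [ENNReal.ofReal_mul hA]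
  refine (eLpNorm_le_mul_eLpNorm_of_ae_le_mul (g := f) ?_ 2).trans (mul_le_mul' le_rfl hf)
  filter_upwards [hc] with x hx
  rw [norm_mul, mul_comm, Real.norm_eq_abs, Real.norm_eq_abs]
  exact mul_le_mul_of_nonneg_right hx (abs_nonneg _)

/-- The constants of the Sobolev embeddings used in the bounds of the forms. -/
structure SobolevBounds (Ω : Set (E d)) (r s : ℝ≥0∞) (K : ℝ) : Prop where
  one_le : 1 ≤ K
  holder : ENNReal.HolderTriple r s 2
  four : ∀ u, MemHs Ω u → eLpNorm u 4 (volume.restrict Ω) ≤ ENNReal.ofReal K * h1e Ω u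
  exponent : ∀ u, MemH0 Ω u → eLpNorm u s (volume.restrict Ω) ≤ ENNReal.ofReal K * gradE Ω u
  poincare : ∀ v, MemX0 Ω v → fullN Ω v ≤ K * gradN Ω v

theorem exists_sobolevBounds (hd : d = 2 ∨ d = 3) (hΩ : IsOpen Ω) (hb : Bornology.IsBounded Ω)
    (hreg : interior (closure Ω) = Ω) (T : Triangulation Ω) {r : ℝ} (hr : (d : ℝ) < r) :
    ∃ s K, SobolevBounds Ω (ENNReal.ofReal r) s K := by
  have hfin := isFiniteMeasure_restrict hb
  have hr2 : 2 < r := by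
    rcases hd with rfl | rfl
    · simpa using hr
    · norm_num at hr; linarith
  obtain ⟨C6, hC6, h6⟩ := exists_eLpNorm_six_le hd hΩ hb hreg T
  obtain ⟨CP, -, hP⟩ := exists_fullN_le_gradN hd hΩ hb
  have hr2' : 0 < r - 2 := by linarith
  have hs0 : 0 < 2 * r / (r - 2) := by positivity
  set s : ℝ≥0 := Real.toNNReal (2 * r / (r - 2)) with hs
  have hsr : (s : ℝ) = 2 * r / (r - 2) := Real.coe_toNNReal _ hs0.le
  obtain ⟨Cs, hCs, hS⟩ := exists_eLpNorm_le_gradE hd hΩ hb (s := s)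
    (by
      rw [← NNReal.coe_le_coe, hsr, NNReal.coe_ofNat, le_div_iff₀ hr2']; linarith)
    (fun h3 => by
      subst h3
      norm_num at hr
      rw [← NNReal.coe_le_coe, hsr, NNReal.coe_ofNat, div_le_iff₀ hr2']; linarith)
  set m := (volume.restrict Ω) univ ^ (1 / (4 : ℝ≥0∞).toReal - 1 / (6 : ℝ≥0∞).toReal) with hm
  have hmt : m ≠ ⊤ := ENNReal.rpow_ne_top_of_nonneg (by norm_num) (measure_ne_top _ _)
  have hC4 : C6 * m ≠ ⊤ := ENNReal.mul_ne_top hC6 hmt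
  refine ⟨s, max 1 (max (C6 * m).toReal (max Cs.toReal CP)), le_max_left _ _, ⟨?_⟩,
    fun u hu => ?_, fun u hu => ?_, fun v hv => ?_⟩
  · have e2 : ((2 : ℝ≥0∞))⁻¹ = ENNReal.ofReal (2⁻¹) := by
      rw [ENNReal.ofReal_inv_of_pos two_pos]; simp
    have es : ((s : ℝ≥0∞)) = ENNReal.ofReal (2 * r / (r - 2)) := rfl
    rw [es, e2, ← ENNReal.ofReal_inv_of_pos (by linarith), ← ENNReal.ofReal_inv_of_pos hs0,
      ← ENNReal.ofReal_add (by positivity) (by positivity)]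
    congr 1
    field_simp
    ring
  · refine (eLpNorm_le_eLpNorm_mul_rpow_measure_univ (q := 6) (by norm_num) hu.1.1.1).trans ?_
    rw [← hm]
    calc _ ≤ C6 * h1e Ω u * m := mul_le_mul' (h6 u hu) le_rfl
      _ = C6 * m * h1e Ω u := by ring
      _ ≤ _ := by
        refine mul_le_mul' ?_ le_rfl
        exact ENNReal.le_ofReal_iff_toReal_le hC4 (by positivity) |>.2
          ((le_max_left _ _).trans (le_max_right _ _))
  · refine (hS u hu).trans (mul_le_mul' ?_ le_rfl)
    exact ENNReal.le_ofReal_iff_toReal_le hCs (by positivity) |>.2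
      (((le_max_left _ _).trans (le_max_right _ _)).trans (le_max_right _ _))
  · refine (hP v hv).trans (mul_le_mul_of_nonneg_right ?_ (gradN_nonneg v))
    exact ((le_max_right _ _).trans (le_max_right _ _)).trans (le_max_right _ _)

/-- The vector fields whose components are limits of functions smooth up to the boundary. -/
def MemXs (Ω : Set (E d)) (u : E d → E d) : Prop := ∀ j, MemHs Ω fun x => u x j

theorem MemXs.memX (hu : MemXs Ω u) : MemX Ω u := fun j => (hu j).1

theorem MemXs.add (hΩ : IsOpen Ω) (hb : Bornology.IsBounded Ω) (hu : MemXs Ω u)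
    (hv : MemXs Ω v) : MemXs Ω (u + v) := fun j => (hu j).add hΩ hb (hv j)

theorem MemXs.smul (hΩ : IsOpen Ω) (hb : Bornology.IsBounded Ω) (hu : MemXs Ω u) (c : ℝ) :
    MemXs Ω (c • u) := fun j => (hu j).const_mul hΩ hb c

theorem MemX0.memXs (hΩ : IsOpen Ω) (hb : Bornology.IsBounded Ω) (hu : MemX0 Ω u) : MemXs Ω u :=
  fun j => ((memX0_iff hΩ hb).1 hu j).memHs

variable {r s : ℝ≥0∞} {K : ℝ}

theorem SobolevBounds.eLpNorm_four_le (hK : SobolevBounds Ω r s K) (hΩ : IsOpen Ω)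
    (hu : MemXs Ω u) (j : Fin d) :
    eLpNorm (fun x => u x j) 4 (volume.restrict Ω) ≤ ENNReal.ofReal (K * fullN Ω u) := by
  rw [ENNReal.ofReal_mul (by linarith [hK.one_le])]
  exact (hK.four _ (hu j)).trans (mul_le_mul' le_rfl (h1e_comp_le hΩ hu.memX j))

theorem SobolevBounds.eLpNorm_exponent_le (hK : SobolevBounds Ω r s K) (hΩ : IsOpen Ω)
    (hb : Bornology.IsBounded Ω) (hv : MemX0 Ω v) (j : Fin d) :
    eLpNorm (fun x => v x j) s (volume.restrict Ω) ≤ ENNReal.ofReal (K * gradN Ω v) := by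
  rw [ENNReal.ofReal_mul (by linarith [hK.one_le])]
  exact (hK.exponent _ ((memX0_iff hΩ hb).1 hv j)).trans
    (mul_le_mul' le_rfl (gradE_comp_le hΩ hv.1 j))

theorem SobolevBounds.eLpNorm_four_le_gradN (hK : SobolevBounds Ω r s K) (hΩ : IsOpen Ω)
    (hb : Bornology.IsBounded Ω) (hv : MemX0 Ω v) (j : Fin d) :
    eLpNorm (fun x => v x j) 4 (volume.restrict Ω) ≤ ENNReal.ofReal (K * (K * gradN Ω v)) :=
  (hK.eLpNorm_four_le hΩ (hv.memXs hΩ hb) j).trans (ENNReal.ofReal_le_ofReal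
    (mul_le_mul_of_nonneg_left (hK.poincare v hv) (by linarith [hK.one_le])))

theorem MemX.eLpNorm_le (hu : MemX Ω u) (j : Fin d) :
    eLpNorm (fun x => u x j) 2 (volume.restrict Ω) ≤ ENNReal.ofReal (fullN Ω u) := by
  rw [← ofReal_l2norm (hu j).1]
  exact ENNReal.ofReal_le_ofReal (l2norm_comp_le_fullN j)

theorem MemX.eLpNorm_partial_le (hΩ : IsOpen Ω) (hu : MemX Ω u) (i j : Fin d) :
    eLpNorm (weakPartial Ω i fun x => u x j) 2 (volume.restrict Ω) ≤
      ENNReal.ofReal (fullN Ω u) := by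
  rw [← ofReal_l2norm (hu.memLp_partial hΩ i j)]
  exact ENNReal.ofReal_le_ofReal ((l2norm_partial_le_gradN i j).trans (gradN_le_fullN u))

theorem abs_sum_sum_le {F : Fin d → Fin d → ℝ} {B : ℝ} (h : ∀ j i, |F j i| ≤ B) :
    |∑ j, ∑ i, F j i| ≤ d * d * B := by
  calc _ ≤ ∑ _j : Fin d, ∑ _i : Fin d, B := (Finset.abs_sum_le_sum_abs _ _).trans
        (Finset.sum_le_sum fun j _ => (Finset.abs_sum_le_sum_abs _ _).trans
          (Finset.sum_le_sum fun i _ => h j i))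
    _ = _ := by simp [mul_assoc]

theorem abs_sum_le {F : Fin d → ℝ} {B : ℝ} (h : ∀ j, |F j| ≤ B) : |∑ j, F j| ≤ d * B := by
  calc _ ≤ ∑ _j : Fin d, B := (Finset.abs_sum_le_sum_abs _ _).trans
        (Finset.sum_le_sum fun j _ => h j)
    _ = _ := by simp

theorem abs_formA_le (hΩ : IsOpen Ω) (hε : IsW1Lip Ω εh) (hRe : 0 < Re)
    (hε1 : ∀ᵐ x ∂(volume.restrict Ω), |εh x| ≤ 1) {αM : ℝ} (hαM : 0 ≤ αM)
    (hα : MemLp (fun x => α (εh x)) ⊤ (volume.restrict Ω))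
    (hα' : ∀ᵐ x ∂(volume.restrict Ω), |α (εh x)| ≤ αM) (hu : MemX Ω u) (hv : MemX Ω v) :
    |formA Ω Re α εh u v| ≤ (d * d / Re + d * αM) * (fullN Ω u * fullN Ω v) := by
  have e1 : ∫ x in Ω, εh x * ∑ j, ∑ i,
      weakPartial Ω i (fun y => u y j) x * weakPartial Ω i (fun y => v y j) x =
      ∑ j, ∑ i, ∫ x in Ω, weakPartial Ω i (fun y => u y j) x * εh x *
        weakPartial Ω i (fun y => v y j) x := by
    refine integral_eq_sum_sum (fun j i => ?_) fun x => ?_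
    · exact (memLp_mul_top (hu.memLp_partial hΩ i j) (hε.memLp_top hΩ)).integrable_mul
        (hv.memLp_partial hΩ i j)
    · simp only [Finset.mul_sum]
      exact Finset.sum_congr rfl fun j _ => Finset.sum_congr rfl fun i _ => by ring
  have e2 : ∫ x in Ω, α (εh x) * inner ℝ (u x) (v x) =
      ∑ j, ∫ x in Ω, u x j * α (εh x) * v x j := by
    rw [← integral_finsetSum _ fun j _ => ?_]
    · refine integral_congr_ae (ae_of_all _ fun x => ?_)
      simp only [inner_eq_sum, Finset.mul_sum]
      exact Finset.sum_congr rfl fun j _ => by ring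
    · exact (memLp_mul_top (hu j).1 hα).integrable_mul (hv j).1
  have b1 : |∫ x in Ω, εh x * ∑ j, ∑ i,
      weakPartial Ω i (fun y => u y j) x * weakPartial Ω i (fun y => v y j) x| ≤
      d * d * (fullN Ω u * fullN Ω v) := by
    rw [e1]
    refine abs_sum_sum_le fun j i => ?_
    have := eLpNorm_mul_le_of_bound hε1 zero_le_one (hu.eLpNorm_partial_le hΩ i j)
    rw [one_mul] at this
    exact abs_integral_mul_le_of_eLpNorm_le
      (memLp_mul_top (hu.memLp_partial hΩ i j) (hε.memLp_top hΩ)).1 (hv.memLp_partial hΩ i j).1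
      (fullN_nonneg u) (fullN_nonneg v) this (hv.eLpNorm_partial_le hΩ i j)
  have b2 : |∫ x in Ω, α (εh x) * inner ℝ (u x) (v x)| ≤
      d * (αM * fullN Ω u * fullN Ω v) := by
    rw [e2]
    refine abs_sum_le fun j => ?_
    exact abs_integral_mul_le_of_eLpNorm_le (memLp_mul_top (hu j).1 hα).1 (hv j).1.1
      (mul_nonneg hαM (fullN_nonneg u)) (fullN_nonneg v)
      (eLpNorm_mul_le_of_bound hα' hαM (hu.eLpNorm_le j)) (hv.eLpNorm_le j)
  rw [formA]
  refine (abs_add_le _ _).trans ?_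
  rw [abs_mul, abs_of_pos (by positivity : 0 < 1 / Re)]
  calc _ ≤ 1 / Re * (d * d * (fullN Ω u * fullN Ω v)) + d * (αM * fullN Ω u * fullN Ω v) := by
        gcongr
    _ = _ := by ring

theorem SobolevBounds.abs_formD_le (hK : SobolevBounds Ω r s K) (hΩ : IsOpen Ω)
    (hb : Bornology.IsBounded Ω) (hε : IsW1Lip Ω εh)
    (hε1 : ∀ᵐ x ∂(volume.restrict Ω), |εh x| ≤ 1) {P : ℝ} (hP : 0 ≤ P)
    (hεP : ∀ i, eLpNorm (weakPartial Ω i εh) r (volume.restrict Ω) ≤ ENNReal.ofReal P)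
    (hu : MemXs Ω u) (hz : MemXs Ω z) (hv : LipX Ω v) (hv0 : MemX0 Ω v) :
    |formD Ω εh u z v| ≤ d * d * (K ^ 3 * (2 + P)) * (fullN Ω u * fullN Ω z * gradN Ω v) := by
  have := hK.holder
  have hK1 := hK.one_le
  have hK0 : 0 ≤ K := by linarith
  have huX := hu.memX
  have hzX := hz.memX
  have nu := fullN_nonneg (Ω := Ω) u
  have nz := fullN_nonneg (Ω := Ω) z
  have nv := gradN_nonneg (Ω := Ω) v
  have hvX := hv0.1
  have lv := fun j => (hv j).memLp_top hΩ
  have lε := hε.memLp_top hΩ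
  have e1 : ∫ x in Ω, εh x * ∑ j, (∑ i, u x i * weakPartial Ω i (fun y => z y j) x) * v x j =
      ∑ j, ∑ i, ∫ x in Ω, weakPartial Ω i (fun y => z y j) x * εh x * (u x i * v x j) := by
    refine integral_eq_sum_sum (fun j i => ?_) fun x => ?_
    · exact (memLp_mul_top (hzX.memLp_partial hΩ i j) lε).integrable_mul
        (memLp_mul_top (huX i).1 (lv j))
    · simp only [Finset.mul_sum, Finset.sum_mul]
      exact Finset.sum_congr rfl fun j _ => Finset.sum_congr rfl fun i _ => by ring
  have i2 : ∀ j i, Integrable (fun x => weakPartial Ω i (fun y => u y i) x * εh x *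
      (z x j * v x j)) (volume.restrict Ω) := fun j i =>
    (memLp_mul_top (huX.memLp_partial hΩ i i) lε).integrable_mul (memLp_mul_top (hzX j).1 (lv j))
  have lp := fun i => hε.memLp_top_weakPartial hΩ i
  have i3 : ∀ j i, Integrable (fun x => weakPartial Ω i εh x * v x j * (u x i * z x j))
      (volume.restrict Ω) := fun j i => by
    refine ((memLp_mul_top (memLp_mul_top (huX i).1 (lp i)) (lv j)).integrable_mul
      (hzX j).1).congr (ae_of_all _ fun x => ?_)
    simp only [Pi.mul_apply]; ring
  have e2 : ∫ x in Ω, weakDiv Ω (fun y => εh y • u y) x * inner ℝ (z x) (v x) =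
      ∑ j, ∑ i, ((∫ x in Ω, weakPartial Ω i (fun y => u y i) x * εh x * (z x j * v x j)) +
        ∫ x in Ω, weakPartial Ω i εh x * v x j * (u x i * z x j)) := by
    have : ∀ j i, Integrable (fun x => weakPartial Ω i (fun y => u y i) x * εh x * (z x j * v x j) +
        weakPartial Ω i εh x * v x j * (u x i * z x j)) (volume.restrict Ω) :=
      fun j i => (i2 j i).add (i3 j i)
    simp only [← integral_add (i2 _ _) (i3 _ _)]
    rw [← integral_eq_sum_sum this (fun x => rfl)]
    refine integral_congr_ae ?_
    filter_upwards [ae_all_iff.2 fun i => weakPartial_mul_lip hΩ (huX i) hε i] with x hx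
    simp only [weakDiv, PiLp.smul_apply, smul_eq_mul, mul_comm (εh _), hx, inner_eq_sum,
      Finset.mul_sum, Finset.sum_mul]
    exact Finset.sum_congr rfl fun j _ => Finset.sum_congr rfl fun i _ => by ring
  have b1 : ∀ j i, |∫ x in Ω, weakPartial Ω i (fun y => z y j) x * εh x * (u x i * v x j)| ≤
      fullN Ω z * (K * fullN Ω u * (K * (K * gradN Ω v))) := fun j i => by
    have h1 := eLpNorm_mul_le_of_bound hε1 zero_le_one (hzX.eLpNorm_partial_le hΩ i j)
    rw [one_mul] at h1
    exact abs_integral_mul_le_of_eLpNorm_le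
      (memLp_mul_top (hzX.memLp_partial hΩ i j) lε).1 ((huX i).1.1.mul (hvX j).1.1)
      nz (by positivity) h1
      (eLpNorm_mul_le_ofReal (p := 4) (q := 4) (huX i).1.1 (hvX j).1.1 (by positivity)
        (hK.eLpNorm_four_le hΩ hu i) (hK.eLpNorm_four_le_gradN hΩ hb hv0 j))
  have b2 : ∀ j i, |∫ x in Ω, weakPartial Ω i (fun y => u y i) x * εh x * (z x j * v x j)| ≤
      fullN Ω u * (K * fullN Ω z * (K * (K * gradN Ω v))) := fun j i => by
    have h1 := eLpNorm_mul_le_of_bound hε1 zero_le_one (huX.eLpNorm_partial_le hΩ i i)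
    rw [one_mul] at h1
    exact abs_integral_mul_le_of_eLpNorm_le
      (memLp_mul_top (huX.memLp_partial hΩ i i) lε).1 ((hzX j).1.1.mul (hvX j).1.1)
      nu (by positivity) h1
      (eLpNorm_mul_le_ofReal (p := 4) (q := 4) (hzX j).1.1 (hvX j).1.1 (by positivity)
        (hK.eLpNorm_four_le hΩ hz j) (hK.eLpNorm_four_le_gradN hΩ hb hv0 j))
  have b3 : ∀ j i, |∫ x in Ω, weakPartial Ω i εh x * v x j * (u x i * z x j)| ≤
      P * (K * gradN Ω v) * (K * fullN Ω u * (K * fullN Ω z)) := fun j i =>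
    abs_integral_mul_le_of_eLpNorm_le ((lp i).1.mul (hvX j).1.1) ((huX i).1.1.mul (hzX j).1.1)
      (by positivity) (by positivity)
      (eLpNorm_mul_le_ofReal (p := r) (q := s) (lp i).1 (hvX j).1.1 hP (hεP i)
        (hK.eLpNorm_exponent_le hΩ hb hv0 j))
      (eLpNorm_mul_le_ofReal (p := 4) (q := 4) (huX i).1.1 (hzX j).1.1 (by positivity)
        (hK.eLpNorm_four_le hΩ hu i) (hK.eLpNorm_four_le hΩ hz j))
  have c1 := abs_sum_sum_le b1
  have c2 := abs_sum_sum_le fun j i => (abs_add_le _ _).trans (add_le_add (b2 j i) (b3 j i))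
  rw [formD, e1, e2]
  refine (abs_add_le _ _).trans ?_
  rw [abs_mul, abs_of_pos (by norm_num : (0 : ℝ) < 1 / 2)]
  refine (add_le_add c1 (mul_le_mul_of_nonneg_left c2 (by norm_num))).trans ?_
  have hX : 0 ≤ (d : ℝ) * d * K ^ 3 * (1 + P) * (fullN Ω u * fullN Ω z * gradN Ω v) := by
    positivity
  linarith

/-- The trilinear form is locally Lipschitz in its first argument. -/
theorem SobolevBounds.abs_formC_sub_le (hK : SobolevBounds Ω r s K) (hΩ : IsOpen Ω)
    (hb : Bornology.IsBounded Ω) (hε : IsW1Lip Ω εh)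
    (hε1 : ∀ᵐ x ∂(volume.restrict Ω), |εh x| ≤ 1) {P : ℝ} (hP : 0 ≤ P)
    (hεP : ∀ i, eLpNorm (weakPartial Ω i εh) r (volume.restrict Ω) ≤ ENNReal.ofReal P)
    {βM : ℝ} (hβM : 0 ≤ βM) (hβ : MemLp (fun x => β (εh x)) ⊤ (volume.restrict Ω))
    (hβ' : ∀ᵐ x ∂(volume.restrict Ω), |β (εh x)| ≤ βM)
    (hu : MemXs Ω u) (hu' : MemXs Ω u') (hz : MemXs Ω z) (hv : LipX Ω v) (hv0 : MemX0 Ω v) :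
    |formC Ω β εh u z v - formC Ω β εh u' z v| ≤
      d * d * (K ^ 3 * (2 + P + βM)) * (fullN Ω (u - u') * fullN Ω z * gradN Ω v) := by
  have hK1 := hK.one_le
  have hK0 : 0 ≤ K := by linarith
  have hw : MemXs Ω (u - u') := by
    rw [sub_eq_add_neg, ← neg_one_smul ℝ]
    exact hu.add hΩ hb (hu'.smul hΩ hb _)
  have nw := fullN_nonneg (Ω := Ω) (u - u')
  have nz := fullN_nonneg (Ω := Ω) z
  have nv := gradN_nonneg (Ω := Ω) v
  have hD : formD Ω εh u z v - formD Ω εh u' z v = formD Ω εh (u - u') z v := by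
    have := formD_smul_add_left hΩ hε hu'.memX hu.memX hz.memX hv (-1)
    rw [show (-1 : ℝ) • u' + u = u - u' by rw [neg_one_smul]; abel] at this
    rw [this]; ring
  have hN : MemLp (fun x => ‖u x‖ - ‖u' x‖) 2 (volume.restrict Ω) :=
    hu.memX.memLp.norm.sub hu'.memX.memLp.norm
  have hNle : eLpNorm (fun x => ‖u x‖ - ‖u' x‖) 2 (volume.restrict Ω) ≤
      ENNReal.ofReal (fullN Ω (u - u')) := by
    calc _ ≤ eLpNorm (u - u') 2 (volume.restrict Ω) :=
          eLpNorm_mono fun x => abs_norm_sub_norm_le (u x) (u' x)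
      _ = ENNReal.ofReal (l2norm Ω (u - u')) := (ofReal_l2norm hw.memX.memLp).symm
      _ ≤ _ := ENNReal.ofReal_le_ofReal
        ((l2norm_le_normX _).trans (normX_le_fullN hΩ hw.memX))
  have e : (∫ x in Ω, β (εh x) * ‖u x‖ * inner ℝ (z x) (v x)) -
      ∫ x in Ω, β (εh x) * ‖u' x‖ * inner ℝ (z x) (v x) =
      ∑ j, ∫ x in Ω, (‖u x‖ - ‖u' x‖) * β (εh x) * (z x j * v x j) := by
    rw [← integral_sub (integrable_formC_norm hΩ hβ hu.memX hz.memX hv)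
      (integrable_formC_norm hΩ hβ hu'.memX hz.memX hv),
      ← integral_finsetSum _ fun j _ => ?_]
    · refine integral_congr_ae (ae_of_all _ fun x => ?_)
      simp only [inner_eq_sum, Finset.mul_sum, ← Finset.sum_sub_distrib]
      exact Finset.sum_congr rfl fun j _ => by ring
    · exact (memLp_mul_top hN hβ).integrable_mul
        (memLp_mul_top (hz.memX j).1 ((hv j).memLp_top hΩ))
  have b : |∑ j, ∫ x in Ω, (‖u x‖ - ‖u' x‖) * β (εh x) * (z x j * v x j)| ≤
      d * (βM * fullN Ω (u - u') * (K * fullN Ω z * (K * (K * gradN Ω v)))) :=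
    abs_sum_le fun j => abs_integral_mul_le_of_eLpNorm_le (memLp_mul_top hN hβ).1
      ((hz.memX j).1.1.mul (hv0.1 j).1.1) (by positivity) (by positivity)
      (eLpNorm_mul_le_of_bound hβ' hβM hNle)
      (eLpNorm_mul_le_ofReal (p := 4) (q := 4) (hz.memX j).1.1 (hv0.1 j).1.1 (by positivity)
        (hK.eLpNorm_four_le hΩ hz j) (hK.eLpNorm_four_le_gradN hΩ hb hv0 j))
  have hDle := hK.abs_formD_le hΩ hb hε hε1 hP hεP hw hz hv hv0
  have e3 : formC Ω β εh u z v - formC Ω β εh u' z v = formD Ω εh (u - u') z v +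
      ∑ j, ∫ x in Ω, (‖u x‖ - ‖u' x‖) * β (εh x) * (z x j * v x j) := by
    rw [← e, ← hD, formC, formC]; ring
  rw [e3]
  refine (abs_add_le _ _).trans ((add_le_add hDle b).trans ?_)
  have hdd : (d : ℝ) ≤ d * d := by
    exact_mod_cast Nat.le_mul_self d
  have : d * (βM * fullN Ω (u - u') * (K * fullN Ω z * (K * (K * gradN Ω v)))) ≤
      d * d * (βM * fullN Ω (u - u') * (K * fullN Ω z * (K * (K * gradN Ω v)))) :=
    mul_le_mul_of_nonneg_right hdd (by positivity)
  linarith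

/-- Coercivity of the linearized problem. -/
theorem coercive (hΩ : IsOpen Ω) (hb : Bornology.IsBounded Ω) (hε : IsW1Lip Ω εh) (hRe : 0 < Re)
    {ε₀ : ℝ} (hεb : ∀ x ∈ Ω, ε₀ ≤ εh x)
    (hα : ∀ x ∈ Ω, 0 ≤ α (εh x)) (hβ : ∀ x ∈ Ω, 0 ≤ β (εh x))
    (hu : MemX Ω u) (hv : LipX Ω v) (hv0 : MemX0 Ω v) :
    ε₀ / Re * seminormX Ω v ^ 2 ≤ formA Ω Re α εh v v + formC Ω β εh u v v := by
  have hvX := hv0.1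
  rw [formC, formD_self hΩ hb hε hu hv hv0, formA]
  have h1 : 0 ≤ ∫ x in Ω, α (εh x) * inner ℝ (v x) (v x) :=
    setIntegral_nonneg hΩ.measurableSet fun x hx => mul_nonneg (hα x hx) real_inner_self_nonneg
  have h2 : 0 ≤ ∫ x in Ω, β (εh x) * ‖u x‖ * inner ℝ (v x) (v x) :=
    setIntegral_nonneg hΩ.measurableSet fun x hx =>
      mul_nonneg (mul_nonneg (hβ x hx) (norm_nonneg _)) real_inner_self_nonneg
  have i0 : ∀ j i, Integrable (fun x => ε₀ * (weakPartial Ω i (fun y => v y j) x *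
      weakPartial Ω i (fun y => v y j) x)) (volume.restrict Ω) := fun j i =>
    ((hvX.memLp_partial hΩ i j).integrable_mul (hvX.memLp_partial hΩ i j)).const_mul ε₀
  have h3 : ε₀ * seminormX Ω v ^ 2 ≤ ∫ x in Ω, εh x * ∑ j, ∑ i,
      weakPartial Ω i (fun y => v y j) x * weakPartial Ω i (fun y => v y j) x := by
    have e : ε₀ * seminormX Ω v ^ 2 = ∫ x in Ω, ε₀ * ∑ j, ∑ i,
        weakPartial Ω i (fun y => v y j) x * weakPartial Ω i (fun y => v y j) x := by
      rw [integral_eq_sum_sum i0 fun x => by simp only [Finset.mul_sum], seminormX_sq hΩ hvX,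
        Finset.mul_sum]
      refine Finset.sum_congr rfl fun j _ => ?_
      rw [Finset.mul_sum]
      refine Finset.sum_congr rfl fun i _ => ?_
      rw [integral_const_mul, l2norm_sq (hvX.memLp_partial hΩ i j)]
      simp only [sq]
    rw [e]
    refine setIntegral_mono_on ?_ (integrable_formA_grad hΩ hε hvX hvX) hΩ.measurableSet
      fun x hx => mul_le_mul_of_nonneg_right (hεb x hx) (Finset.sum_nonneg fun j _ =>
        Finset.sum_nonneg fun i _ => mul_self_nonneg _)
    simp only [Finset.mul_sum]
    exact integrable_finsetSum _ fun j _ => integrable_finsetSum _ fun i _ => i0 j i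
  have h4 : ε₀ / Re * seminormX Ω v ^ 2 = 1 / Re * (ε₀ * seminormX Ω v ^ 2) := by ring
  rw [h4]
  have := mul_le_mul_of_nonneg_left h3 (by positivity : 0 ≤ 1 / Re)
  linarith

end Bounds

section Coefficients

variable {Ω : Set (E d)} {εh ε : E d → ℝ} {α : ℝ → ℝ} {ε₀ αM : ℝ}

theorem IsCoefficient.exists_measurable (hα : IsCoefficient ε₀ α) :
    ∃ A : ℝ → ℝ, Measurable A ∧ ∀ t ∈ Icc ε₀ 1, A t = α t := by
  classical
  have h1 : Measurable ((Ioo ε₀ 1).piecewise α fun _ => 0) :=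
    ContinuousOn.measurable_piecewise
      (fun t ht => (hα.diff t ht).continuousAt.continuousWithinAt) continuousOn_const
      measurableSet_Ioo
  refine ⟨fun t => if t ≤ ε₀ then α ε₀ else if 1 ≤ t then α 1 else
    (Ioo ε₀ 1).piecewise α (fun _ => 0) t,
    Measurable.ite measurableSet_Iic measurable_const
      (Measurable.ite measurableSet_Ici measurable_const h1), fun t ht => ?_⟩
  dsimp only
  split_ifs with h2 h3
  · rw [le_antisymm ht.1 h2]
  · rw [le_antisymm ht.2 h3]
  · exact piecewise_eq_of_mem (Ioo ε₀ 1) α _ (mem_Ioo.2 ⟨not_le.1 h2, not_le.1 h3⟩)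

theorem IsCoefficient.abs_le (hα : IsCoefficient ε₀ α) (hαM : ∀ t ∈ Icc ε₀ 1, α t ≤ αM)
    (hΩ : IsOpen Ω) (hεb : ∀ x ∈ Ω, ε₀ ≤ εh x ∧ εh x ≤ 1) :
    ∀ᵐ x ∂(volume.restrict Ω), |α (εh x)| ≤ αM :=
  (ae_restrict_iff' hΩ.measurableSet).2 (ae_of_all _ fun x hx => by
    rw [abs_of_pos (hα.pos _ (hεb x hx))]; exact hαM _ (hεb x hx))

theorem IsCoefficient.memLp_top (hα : IsCoefficient ε₀ α) (hαM : ∀ t ∈ Icc ε₀ 1, α t ≤ αM)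
    (hΩ : IsOpen Ω) (hε : IsW1Lip Ω εh) (hεb : ∀ x ∈ Ω, ε₀ ≤ εh x ∧ εh x ≤ 1) :
    MemLp (fun x => α (εh x)) ⊤ (volume.restrict Ω) := by
  obtain ⟨A, hA, hAα⟩ := hα.exists_measurable
  refine memLp_top_of_bound ?_ αM (hα.abs_le hαM hΩ hεb)
  refine (hA.comp_aemeasurable (hε.aestronglyMeasurable hΩ).aemeasurable).aestronglyMeasurable.congr
    (ae_restrict_of_eqOn hΩ fun x hx => hAα _ (hεb x hx))

theorem Triangulation.size_le (hb : Bornology.IsBounded Ω) (T : Triangulation Ω) :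
    T.size ≤ Metric.diam Ω := by
  refine Real.iSup_le (fun k => ?_) Metric.diam_nonneg
  rw [← Metric.diam_closure Ω]
  exact Metric.diam_mono (T.elem_subset k) hb.closure

/-- A bound of the gradient of the discrete porosity which is uniform in the mesh. -/
theorem Triangulation.eLpNorm_weakPartial_le (hΩ : IsOpen Ω) (hb : Bornology.IsBounded Ω)
    (T : Triangulation Ω) {r Cε : ℝ} (hr : 1 ≤ r) (hε : MemW1 Ω (ENNReal.ofReal r) ε)
    (hεh : IsW1Lip Ω εh)
    (h : eLpNorm (weakGrad Ω ε - weakGrad Ω εh) (ENNReal.ofReal r) (volume.restrict Ω)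
          ≤ ENNReal.ofReal (Cε * T.size)) (i : Fin d) :
    eLpNorm (weakPartial Ω i εh) (ENNReal.ofReal r) (volume.restrict Ω) ≤ ENNReal.ofReal
      (∑ i, (eLpNorm (weakPartial Ω i ε) (ENNReal.ofReal r) (volume.restrict Ω)).toReal +
        |Cε| * Metric.diam Ω) := by
  set μ := volume.restrict Ω
  have hr1 : 1 ≤ ENNReal.ofReal r := by rw [← ENNReal.ofReal_one]; exact ENNReal.ofReal_le_ofReal hr
  have hmε := hε.memLp_weakPartial hΩ i
  have hmh : MemLp (weakPartial Ω i εh) (ENNReal.ofReal r) μ :=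
    (hεh.memW1 hΩ hb).memLp_weakPartial hΩ i
  have e : weakPartial Ω i εh = weakPartial Ω i ε -
      (fun x => weakPartial Ω i ε x - weakPartial Ω i εh x) := by
    ext x; simp
  rw [e, ENNReal.ofReal_add (Finset.sum_nonneg fun _ _ => ENNReal.toReal_nonneg)
    (mul_nonneg (abs_nonneg _) Metric.diam_nonneg)]
  refine (eLpNorm_sub_le hmε.1 (hmε.1.sub hmh.1) hr1).trans (add_le_add ?_ ?_)
  · rw [← ENNReal.ofReal_toReal hmε.2.ne]
    exact ENNReal.ofReal_le_ofReal (Finset.single_le_sum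
      (f := fun i => (eLpNorm (weakPartial Ω i ε) (ENNReal.ofReal r) μ).toReal)
      (fun _ _ => ENNReal.toReal_nonneg) (Finset.mem_univ i))
  · calc _ ≤ eLpNorm (weakGrad Ω ε - weakGrad Ω εh) (ENNReal.ofReal r) μ :=
          eLpNorm_mono fun x => PiLp.norm_apply_le ((weakGrad Ω ε - weakGrad Ω εh) x) i
      _ ≤ _ := h.trans (ENNReal.ofReal_le_ofReal ?_)
    have hs : 0 ≤ T.size := Real.iSup_nonneg fun k => Metric.diam_nonneg
    calc Cε * T.size ≤ |Cε| * T.size := mul_le_mul_of_nonneg_right (le_abs_self _) hs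
      _ ≤ _ := mul_le_mul_of_nonneg_left (T.size_le hb) (abs_nonneg _)

theorem SobolevBounds.abs_formL_le {r s : ℝ≥0∞} {K : ℝ} (hK : SobolevBounds Ω r s K)
    (hd : d = 2 ∨ d = 3) (hΩ : IsOpen Ω)
    (hb : Bornology.IsBounded Ω) (hε : IsW1Lip Ω εh)
    (hε1 : ∀ᵐ x ∂(volume.restrict Ω), |εh x| ≤ 1) {P : ℝ} (hP : 0 ≤ P)
    (hεP : ∀ i, eLpNorm (weakPartial Ω i εh) r (volume.restrict Ω) ≤ ENNReal.ofReal P)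
    {f v : E d → E d} (hf : MemLp f 2 (volume.restrict Ω)) (hv0 : MemX0 Ω v) :
    |formL Ω εh f v| ≤ d * d * (1 + P * K) * (dualNorm Ω f * gradN Ω v) := by
  have := hK.holder
  have hK0 : 0 ≤ K := by linarith [hK.one_le]
  have nv := gradN_nonneg (Ω := Ω) v
  have hX0 : MemX0 Ω fun x => εh x • v x := (memX0_iff hΩ hb).2 fun j => by
    have := ((memX0_iff hΩ hb).1 hv0 j).mul_lip hΩ hb hε
    simp only [mul_comm] at this
    exact this
  obtain ⟨hd0, hdual⟩ := abs_integral_inner_le_dualNorm hd hΩ hb hf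
  have e : formL Ω εh f v = ∫ x in Ω, inner ℝ (f x) (εh x • v x) := by
    simp only [formL, real_inner_smul_right]
  rw [e]
  refine (hdual _ hX0).trans ?_
  have hterm : ∀ i j, l2norm Ω (weakPartial Ω i fun x => (εh x • v x) j) ≤
      (1 + P * K) * gradN Ω v := fun i j => by
    have h1 : weakPartial Ω i (fun x => (εh x • v x) j) =ᵐ[volume.restrict Ω] fun x =>
        weakPartial Ω i (fun y => v y j) x * εh x + weakPartial Ω i εh x * v x j := by
      have := weakPartial_mul_lip hΩ (hv0.1 j) hε i
      simp only [mul_comm _ (εh _)] at this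
      filter_upwards [this] with x hx
      refine Eq.trans hx ?_
      ring
    have hg2 := eLpNorm_mul_le_ofReal (p := r) (q := s) (hε.memLp_top_weakPartial hΩ i).1
      (hv0.1 j).1.1 hP (hεP i) (hK.eLpNorm_exponent_le hΩ hb hv0 j)
    have hg1 := eLpNorm_mul_le_of_bound hε1 zero_le_one
      (ofReal_l2norm (hv0.1.memLp_partial hΩ i j)).ge
    have m2 : MemLp (fun x => weakPartial Ω i εh x * v x j) 2 (volume.restrict Ω) :=
      ⟨(hε.memLp_top_weakPartial hΩ i).1.mul (hv0.1 j).1.1,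
        hg2.trans_lt ENNReal.ofReal_lt_top⟩
    have m1 := memLp_mul_top (hv0.1.memLp_partial hΩ i j) (hε.memLp_top hΩ)
    have n1 : l2norm Ω (fun x => weakPartial Ω i (fun y => v y j) x * εh x) ≤ gradN Ω v := by
      refine (ENNReal.toReal_le_of_le_ofReal (by simp [l2norm_nonneg]) hg1).trans ?_
      rw [one_mul]; exact l2norm_partial_le_gradN i j
    have n2 : l2norm Ω (fun x => weakPartial Ω i εh x * v x j) ≤ P * (K * gradN Ω v) :=
      ENNReal.toReal_le_of_le_ofReal (by positivity) hg2
    rw [l2norm_congr h1]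
    refine (l2norm_add_le m1 m2).trans ?_
    linarith
  have hs : seminormX Ω (fun x => εh x • v x) ≤ d * (d * ((1 + P * K) * gradN Ω v)) := by
    refine (seminormX_le_gradN hΩ hX0.1).trans ?_
    calc _ ≤ ∑ _j : Fin d, ∑ _i : Fin d, (1 + P * K) * gradN Ω v :=
          Finset.sum_le_sum fun j _ => Finset.sum_le_sum fun i _ => hterm i j
      _ = _ := by simp
  refine (mul_le_mul_of_nonneg_left hs hd0).trans (le_of_eq ?_)
  ring

theorem formB_eq (hΩ : IsOpen Ω) (hb : Bornology.IsBounded Ω) (hε : IsW1Lip Ω εh)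
    {v : E d → E d} (hv0 : MemX0 Ω v) {q : E d → ℝ} (hq : IsW1Lip Ω q) :
    formB Ω εh v q = -∑ i, ∫ x in Ω, weakPartial Ω i q x * (v x i * εh x) := by
  have hqW : MemW1 Ω 2 q := hq.memW1 hΩ hb
  have hH : ∀ i, MemH0 Ω fun x => v x i * εh x := fun i =>
    ((memX0_iff hΩ hb).1 hv0 i).mul_lip hΩ hb hε
  have key := fun i => integral_mul_weakPartial_eq hΩ hb (hqW.hasWeakPartial i) hqW.1
    (hqW.memLp_weakPartial hΩ i) (hH i)
  have hint : ∀ i, Integrable (fun x => q x * weakPartial Ω i (fun x => v x i * εh x) x)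
      (volume.restrict Ω) := fun i => hqW.1.integrable_mul ((hH i).1.memLp_weakPartial hΩ i)
  rw [← Finset.sum_neg_distrib, ← Finset.sum_congr rfl fun i _ => key i,
    ← integral_finsetSum _ fun i _ => hint i, formB]
  refine integral_congr_ae (ae_of_all _ fun x => ?_)
  simp only [weakDiv, PiLp.smul_apply, smul_eq_mul, mul_comm (εh _), Finset.sum_mul]
  exact Finset.sum_congr rfl fun i _ => mul_comm _ _

end Coefficients

section DiscreteSpaces

namespace Triangulation

variable {Ω : Set (E d)} {T : Triangulation Ω} {εh q q' : E d → ℝ} {v v' : E d → E d}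

theorem interior_elem_nonempty (T : Triangulation Ω) (k : Fin T.N) :
    (interior (T.elem k)).Nonempty :=
  ⟨_, (T.vert k).centroid_mem_interior_convexHull⟩

theorem memX0h_bub (hΩ : IsOpen Ω) (hb : Bornology.IsBounded Ω) (hr : interior (closure Ω) = Ω)
    (k : Fin T.N) (j : Fin d) : T.MemX0h fun x => T.bub k x • basisVec j := by
  have hcomp : ∀ i x, (T.bub k x • basisVec j) i = (if i = j then 1 else 0) * T.bub k x := by
    intro i x
    by_cases h : i = j <;> simp [h]
  obtain ⟨C, hC⟩ := T.exists_lipschitzWith_bub k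
  refine ⟨⟨(hC.continuous.smul continuous_const).continuousOn, fun l i => ?_⟩,
    (memX0_iff hΩ hb).2 fun i => ?_⟩
  · by_cases hkl : k = l
    · subst hkl
      exact ⟨0, if i = j then 1 else 0, fun x hx => by
        rw [hcomp, bub_eq_bubble T hx]; simp⟩
    · exact ⟨0, 0, fun x hx => by rw [hcomp, bub_eq_zero_of_ne T hkl hx]; simp⟩
  · simp only [hcomp]
    exact (T.memH0_bub hΩ hb hr k).const_mul hΩ hb _

theorem linear_eq_zero_of_basisVec {A : E d →ₗ[ℝ] ℝ} (h : ∀ j, A (basisVec j) = 0) : A = 0 :=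
  (EuclideanSpace.basisFun (Fin d) ℝ).toBasis.ext fun j => by simpa using h j

/-- The discrete inf-sup condition in its qualitative form. -/
theorem MemM0h.eq_zero_of_formB (hΩ : IsOpen Ω) (hΩc : IsConnected Ω)
    (hb : Bornology.IsBounded Ω) (hr : interior (closure Ω) = Ω) (hε : IsW1Lip Ω εh)
    (hεpos : ∀ x ∈ Ω, 0 < εh x) (hq : T.MemM0h q)
    (h : ∀ v, T.MemX0h v → formB Ω εh v q = 0) : ∀ x ∈ closure Ω, q x = 0 := by
  have hqL := hq.1.isW1Lip hΩ hb
  have hfin := isFiniteMeasure_restrict hb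
  have hlin : ∀ k, ∃ A : E d →ᵃ[ℝ] ℝ, A.linear = 0 ∧ ∀ x ∈ T.elem k, q x = A x := by
    intro k
    obtain ⟨A, hA⟩ := hq.1.2 k
    refine ⟨A, linear_eq_zero_of_basisVec fun j => ?_, hA⟩
    have hv := T.memX0h_bub hΩ hb hr k j
    have h1 := h _ hv
    rw [formB_eq hΩ hb hε hv.2 hqL, neg_eq_zero, Finset.sum_eq_single j] at h1
    · have hpos : 0 < ∫ x in Ω, T.bub k x * εh x := by
        rw [setIntegral_pos_iff_support_of_nonneg_ae]
        · refine lt_of_lt_of_le (isOpen_interior.measure_pos volume (T.interior_elem_nonempty k))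
            (measure_mono fun x hx => ?_)
          have hxΩ := T.interior_elem_subset hr k hx
          exact ⟨(mul_pos (T.bub_pos_iff.2 hx) (hεpos x hxΩ)).ne', hxΩ⟩
        · exact (ae_restrict_iff' hΩ.measurableSet).2 (ae_of_all _ fun x hx =>
            mul_nonneg (T.bub_nonneg k x) (hεpos x hx).le)
        · exact (memLp_mul_top (T.memH0_bub hΩ hb hr k).1.1 (hε.memLp_top hΩ)).integrable
            one_le_two
      have h2 : ∫ x in Ω, weakPartial Ω j q x * ((T.bub k x • basisVec j) j * εh x) =
          ∫ x in Ω, A.linear (basisVec j) * (T.bub k x * εh x) := by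
        refine integral_congr_ae ?_
        filter_upwards [hqL.weakPartial_ae hΩ j] with x hx
        by_cases hxk : x ∈ interior (T.elem k)
        · have he : q =ᶠ[𝓝 x] A := by
            filter_upwards [isOpen_interior.mem_nhds hxk] with y hy
            exact hA y (interior_subset hy)
          have hd : lineDeriv ℝ q x (basisVec j) = A.linear (basisVec j) := by
            rw [he.lineDeriv_eq]
            have : (fun t : ℝ => A (x + t • basisVec j)) =
                fun t => A x + t * A.linear (basisVec j) := by
              ext t
              have := A.map_vadd x (t • basisVec j)
              rw [vadd_eq_add, vadd_eq_add, add_comm] at this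
              rw [this]; simp [add_comm]
            rw [lineDeriv, this]
            simp
          rw [hx, hd]; simp
        · rw [T.bub_eq_zero hxk]; simp
      rw [h2, integral_const_mul] at h1
      exact (mul_eq_zero.1 h1).resolve_right hpos.ne'
    · intro i _ hij
      simp [hij]
    · simp
  obtain ⟨c, hc⟩ := MemMh.const_of_linear_eq_zero hΩ hΩc hq.1.1 hlin
  have h0 := hq.2
  rw [setIntegral_congr_fun hΩ.measurableSet fun x hx => hc x (subset_closure hx)] at h0
  have hvol : volume.real Ω ≠ 0 := by
    have hm := isFiniteMeasure_restrict hb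
    have h1 : volume Ω ≠ ⊤ := hb.measure_lt_top.ne
    exact (ENNReal.toReal_pos (hΩ.measure_pos volume hΩc.nonempty).ne' h1).ne'
  have hc0 : c = 0 := by
    simpa [hvol] using h0
  intro x hx
  rw [hc x hx, hc0]

theorem MemXh.smul_add (hv : T.MemXh v) (hv' : T.MemXh v') (c : ℝ) : T.MemXh (c • v + v') := by
  refine ⟨(hv.1.const_smul c).add hv'.1, fun k j => ?_⟩
  obtain ⟨A, a, h⟩ := hv.2 k j
  obtain ⟨A', a', h'⟩ := hv'.2 k j
  refine ⟨c • A + A', c * a + a', fun x hx => ?_⟩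
  simp only [Pi.add_apply, Pi.smul_apply, PiLp.add_apply, PiLp.smul_apply, smul_eq_mul, h x hx,
    h' x hx, AffineMap.coe_add, AffineMap.coe_smul]
  ring

theorem MemX0h.smul_add (hΩ : IsOpen Ω) (hb : Bornology.IsBounded Ω) (hv : T.MemX0h v)
    (hv' : T.MemX0h v') (c : ℝ) : T.MemX0h (c • v + v') :=
  ⟨hv.1.smul_add hv'.1 c, (hv.2.smul hΩ hb c).add hΩ hb hv'.2⟩

theorem memX0h_zero (hΩ : IsOpen Ω) (hb : Bornology.IsBounded Ω) :
    T.MemX0h (0 : E d → E d) :=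
  ⟨⟨continuousOn_const, fun _ _ => ⟨0, 0, fun x _ => by simp⟩⟩, memX0_zero hΩ hb⟩

theorem MemMh.memLp (hΩ : IsOpen Ω) (hb : Bornology.IsBounded Ω) (hq : T.MemMh q) :
    MemLp q 2 (volume.restrict Ω) :=
  ((hq.isW1Lip hΩ hb).memW1 hΩ hb).1

theorem MemM0h.smul_add (hΩ : IsOpen Ω) (hb : Bornology.IsBounded Ω) (hq : T.MemM0h q)
    (hq' : T.MemM0h q') (c : ℝ) : T.MemM0h (c • q + q') := by
  have hfin := isFiniteMeasure_restrict hb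
  refine ⟨⟨(hq.1.1.const_smul c).add hq'.1.1, fun k => ?_⟩, ?_⟩
  · obtain ⟨A, h⟩ := hq.1.2 k
    obtain ⟨A', h'⟩ := hq'.1.2 k
    refine ⟨c • A + A', fun x hx => ?_⟩
    simp [h x hx, h' x hx]
  · have := integral_mul_add_eq (c := c) ((hq.1.memLp hΩ hb).integrable one_le_two)
      ((hq'.1.memLp hΩ hb).integrable one_le_two) (H := c • q + q') (ae_of_all _ fun x => rfl)
    rw [this, hq.2, hq'.2]; simp

theorem memM0h_zero : T.MemM0h (0 : E d → ℝ) :=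
  ⟨⟨continuousOn_const, fun _ => ⟨0, fun x _ => by simp⟩⟩, by simp⟩

/-- The discrete velocities, normalized by `0` outside `closure Ω`. -/
def velocitySpace (T : Triangulation Ω) (hΩ : IsOpen Ω) (hb : Bornology.IsBounded Ω) :
    Submodule ℝ (E d → E d) where
  carrier := {v | T.MemX0h v ∧ ∀ x ∉ closure Ω, v x = 0}
  zero_mem' := ⟨memX0h_zero hΩ hb, fun _ _ => rfl⟩
  add_mem' := fun {u v} hu hv => ⟨by simpa using hu.1.smul_add hΩ hb hv.1 1, fun x hx => by
    simp [hu.2 x hx, hv.2 x hx]⟩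
  smul_mem' := fun c v hv => ⟨by simpa using hv.1.smul_add hΩ hb (memX0h_zero hΩ hb) c,
    fun x hx => by simp [hv.2 x hx]⟩

/-- The discrete pressures, normalized by `0` outside `closure Ω`. -/
def pressureSpace (T : Triangulation Ω) (hΩ : IsOpen Ω) (hb : Bornology.IsBounded Ω) :
    Submodule ℝ (E d → ℝ) where
  carrier := {q | T.MemM0h q ∧ ∀ x ∉ closure Ω, q x = 0}
  zero_mem' := ⟨memM0h_zero, fun _ _ => rfl⟩
  add_mem' := fun {u v} hu hv => ⟨by simpa using hu.1.smul_add hΩ hb hv.1 1, fun x hx => by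
    simp [hu.2 x hx, hv.2 x hx]⟩
  smul_mem' := fun c v hv => ⟨by simpa using hv.1.smul_add hΩ hb memM0h_zero c,
    fun x hx => by simp [hv.2 x hx]⟩

theorem indicator_mem_velocitySpace (hΩ : IsOpen Ω) (hb : Bornology.IsBounded Ω)
    (hv : T.MemX0h v) : (closure Ω).indicator v ∈ T.velocitySpace hΩ hb := by
  have he : EqOn ((closure Ω).indicator v) v (closure Ω) := eqOn_indicator
  refine ⟨⟨⟨hv.1.1.congr he, fun k j => ?_⟩, (memX0_iff hΩ hb).2 fun j =>
    ((memX0_iff hΩ hb).1 hv.2 j).congr (ae_restrict_of_eqOn hΩ fun x hx => ?_)⟩,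
    fun x hx => indicator_of_notMem hx v⟩
  · obtain ⟨A, c, h⟩ := hv.1.2 k j
    exact ⟨A, c, fun x hx => by rw [he (T.elem_subset k hx), h x hx]⟩
  · simp only [he (subset_closure hx)]

theorem indicator_mem_pressureSpace (hΩ : IsOpen Ω) (hb : Bornology.IsBounded Ω)
    (hq : T.MemM0h q) : (closure Ω).indicator q ∈ T.pressureSpace hΩ hb := by
  have he : EqOn ((closure Ω).indicator q) q (closure Ω) := eqOn_indicator
  refine ⟨⟨⟨hq.1.1.congr he, fun k => ?_⟩, ?_⟩, fun x hx => indicator_of_notMem hx q⟩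
  · obtain ⟨A, h⟩ := hq.1.2 k
    exact ⟨A, fun x hx => by rw [he (T.elem_subset k hx), h x hx]⟩
  · rw [setIntegral_congr_fun hΩ.measurableSet (he.mono subset_closure), hq.2]

theorem affineMap_eq_zero (b : AffineBasis (Fin (d + 1)) ℝ (E d)) {A : E d →ᵃ[ℝ] ℝ}
    (h : ∀ i, A (b i) = 0) (x : E d) : A x = 0 := by
  have hx := b.affineCombination_coord_eq_self x
  rw [← hx, Finset.map_affineCombination _ _ _ (b.sum_coord_apply_eq_one x)]
  have : (A ∘ b : Fin (d + 1) → ℝ) = fun _ => 0 := funext h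
  rw [this, Finset.affineCombination_apply_const _ _ _ (b.sum_coord_apply_eq_one x)]

theorem bubble_vertex (hd : 0 < d) (k : Fin T.N) (i : Fin (d + 1)) :
    T.bubble k (T.vert k i) = 0 := by
  have : Nontrivial (Fin (d + 1)) := Fin.nontrivial_iff_two_le.2 (by omega)
  obtain ⟨j, hj⟩ := exists_ne i
  exact Finset.prod_eq_zero (Finset.mem_univ j) ((T.vert k).coord_apply_ne hj)

theorem finiteDimensional_velocitySpace (hd : 0 < d) (hΩ : IsOpen Ω)
    (hb : Bornology.IsBounded Ω) : FiniteDimensional ℝ (T.velocitySpace hΩ hb) := by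
  let c : Fin T.N → E d := fun k => Finset.univ.centroid ℝ (T.vert k)
  let Φ : (T.velocitySpace hΩ hb) →ₗ[ℝ] (Fin T.N → Fin (d + 1) → E d) × (Fin T.N → E d) :=
    { toFun := fun v => (fun k i => v.1 (T.vert k i), fun k => v.1 (c k))
      map_add' := fun _ _ => rfl
      map_smul' := fun _ _ => rfl }
  refine FiniteDimensional.of_injective Φ ((injective_iff_map_eq_zero Φ).2 fun v hv => ?_)
  have h1 : ∀ k i, v.1 (T.vert k i) = 0 := fun k i => congrFun (congrFun (congrArg Prod.fst hv) k) i
  have h2 : ∀ k, v.1 (c k) = 0 := fun k => congrFun (congrArg Prod.snd hv) k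
  ext x j
  by_cases hx : x ∈ closure Ω
  · obtain ⟨k, hk⟩ := T.exists_mem_elem hx
    obtain ⟨A, a, hA⟩ := v.2.1.1.2 k j
    have hA0 : ∀ y, A y = 0 := affineMap_eq_zero (T.vert k) fun i => by
      have := hA _ (subset_convexHull ℝ _ (mem_range_self i))
      rw [h1, T.bubble_vertex hd] at this
      simpa using this.symm
    have hck : c k ∈ interior (T.elem k) := (T.vert k).centroid_mem_interior_convexHull
    have hpos : 0 < T.bubble k (c k) := by
      rw [← bub_eq_bubble T (interior_subset hck)]; exact T.bub_pos_iff.2 hck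
    have ha : a = 0 := by
      have := hA _ (interior_subset hck)
      rw [h2, hA0] at this
      simpa [hpos.ne'] using this.symm
    rw [hA x hk, hA0, ha]; simp
  · rw [v.2.2 x hx]; simp

theorem finiteDimensional_pressureSpace (hΩ : IsOpen Ω) (hb : Bornology.IsBounded Ω) :
    FiniteDimensional ℝ (T.pressureSpace hΩ hb) := by
  let Φ : (T.pressureSpace hΩ hb) →ₗ[ℝ] (Fin T.N → Fin (d + 1) → ℝ) :=
    { toFun := fun v => fun k i => v.1 (T.vert k i)
      map_add' := fun _ _ => rfl
      map_smul' := fun _ _ => rfl }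
  refine FiniteDimensional.of_injective Φ ((injective_iff_map_eq_zero Φ).2 fun q hq => ?_)
  have h1 : ∀ k i, q.1 (T.vert k i) = 0 := fun k i => congrFun (congrFun hq k) i
  ext x
  by_cases hx : x ∈ closure Ω
  · obtain ⟨k, hk⟩ := T.exists_mem_elem hx
    obtain ⟨A, hA⟩ := q.2.1.1.2 k
    rw [hA x hk]
    exact affineMap_eq_zero (T.vert k) (fun i => by
      rw [← hA _ (subset_convexHull ℝ _ (mem_range_self i)), h1]) x
  · rw [q.2.2 x hx]; simp

theorem eqOn_zero_of_l2norm_eq_zero (hΩ : IsOpen Ω) {f : E d → ℝ}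
    (hf : MemLp f 2 (volume.restrict Ω)) (hc : ContinuousOn f (closure Ω))
    (h : l2norm Ω f = 0) : ∀ x ∈ closure Ω, f x = 0 := by
  have h0 : eLpNorm f 2 (volume.restrict Ω) = 0 := by
    rw [← ofReal_l2norm hf, h, ENNReal.ofReal_zero]
  have hae := (eLpNorm_eq_zero_iff hf.1 (by simp)).1 h0
  have := Measure.eqOn_open_of_ae_eq hae hΩ (hc.mono subset_closure) continuousOn_const
  exact EqOn.of_subset_closure (s := Ω) (g := fun _ => 0) this hc continuousOn_const subset_closure
    subset_rfl

end Triangulation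
end DiscreteSpaces

section SaddlePoint

variable {V M : Type*} [NormedAddCommGroup V] [NormedSpace ℝ V]
  [NormedAddCommGroup M] [NormedSpace ℝ M]

/-- `(z, p)` solves the linear saddle point problem with form `k w` and right-hand side `g w`. -/
def IsSaddleStep (k : V → V →ₗ[ℝ] V →ₗ[ℝ] ℝ) (B : V →ₗ[ℝ] M →ₗ[ℝ] ℝ) (g : V → V →ₗ[ℝ] ℝ)
    (w z : V) (p : M) : Prop :=
  (∀ v, k w z v - B v p = g w v) ∧ ∀ q, B z q = 0

/-- A family of coercive saddle point problems which depends on `w` in a Lipschitz way, with small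
data. -/
structure SaddleFamily (k : V → V →ₗ[ℝ] V →ₗ[ℝ] ℝ) (B : V →ₗ[ℝ] M →ₗ[ℝ] ℝ)
    (g : V → V →ₗ[ℝ] ℝ) (κ L L₁ A : ℝ) : Prop where
  κ_pos : 0 < κ
  L_nonneg : 0 ≤ L
  L₁_nonneg : 0 ≤ L₁
  A_nonneg : 0 ≤ A
  coercive : ∀ w v, κ * ‖v‖ ^ 2 ≤ k w v v
  injective : ∀ p, (∀ v, B v p = 0) → p = 0
  lip_k : ∀ w w' z v, |k w z v - k w' z v| ≤ L * ‖w - w'‖ * ‖z‖ * ‖v‖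
  bound_g : ∀ w v, |g w v| ≤ (A + L₁ * ‖w‖) * ‖v‖
  lip_g : ∀ w w' v, |g w v - g w' v| ≤ L₁ * ‖w - w'‖ * ‖v‖
  small : L₁ ≤ κ / 4
  small' : A * L ≤ κ ^ 2 / 8

variable {k : V → V →ₗ[ℝ] V →ₗ[ℝ] ℝ} {B : V →ₗ[ℝ] M →ₗ[ℝ] ℝ} {g : V → V →ₗ[ℝ] ℝ}
  {κ L L₁ A : ℝ} {w w' z z' : V} {p p' : M}

namespace SaddleFamily

theorem eq_zero_of_homogeneous (h : SaddleFamily k B g κ L L₁ A) (h1 : ∀ v, k w z v = B v p)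
    (h2 : ∀ q, B z q = 0) : z = 0 ∧ p = 0 := by
  have hz : z = 0 := by
    have := h.coercive w z
    rw [h1, h2] at this
    have h3 : ‖z‖ ^ 2 ≤ 0 := by nlinarith [h.κ_pos, sq_nonneg ‖z‖]
    exact norm_eq_zero.1 (pow_eq_zero_iff two_ne_zero |>.1 (le_antisymm h3 (sq_nonneg _)))
  refine ⟨hz, h.injective p fun v => ?_⟩
  rw [← h1, hz]; simp

theorem exists_step [FiniteDimensional ℝ V] [FiniteDimensional ℝ M]
    (h : SaddleFamily k B g κ L L₁ A) (w : V) :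
    ∃ z p, IsSaddleStep k B g w z p := by
  let Φ : V × M →ₗ[ℝ] Module.Dual ℝ V × Module.Dual ℝ M :=
    ((k w).comp (LinearMap.fst ℝ V M) - B.flip.comp (LinearMap.snd ℝ V M)).prod
      (B.comp (LinearMap.fst ℝ V M))
  have hΦ : ∀ z p, Φ (z, p) = (k w z - B.flip p, B z) := fun _ _ => rfl
  have hinj : Function.Injective Φ := (injective_iff_map_eq_zero Φ).2 fun ⟨z, p⟩ hz => by
    rw [hΦ] at hz
    have h1 : ∀ v, k w z v = B v p := fun v => by
      have := LinearMap.congr_fun (congrArg Prod.fst hz) v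
      simpa [sub_eq_zero] using this
    have h2 : ∀ q, B z q = 0 := fun q => LinearMap.congr_fun (congrArg Prod.snd hz) q
    obtain ⟨rfl, rfl⟩ := h.eq_zero_of_homogeneous h1 h2
    rfl
  have hfr : Module.finrank ℝ (V × M) =
      Module.finrank ℝ (Module.Dual ℝ V × Module.Dual ℝ M) := by
    rw [Module.finrank_prod, Module.finrank_prod, Subspace.dual_finrank_eq,
      Subspace.dual_finrank_eq]
  obtain ⟨⟨z, p⟩, hz⟩ :=
    (LinearMap.injective_iff_surjective_of_finrank_eq_finrank hfr).1 hinj (g w, 0)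
  rw [hΦ] at hz
  exact ⟨z, p, fun v => LinearMap.congr_fun (congrArg Prod.fst hz) v,
    fun q => LinearMap.congr_fun (congrArg Prod.snd hz) q⟩

theorem step_unique (h : SaddleFamily k B g κ L L₁ A) (h1 : IsSaddleStep k B g w z p)
    (h2 : IsSaddleStep k B g w z' p') : z = z' ∧ p = p' := by
  obtain ⟨h3, h4⟩ := h.eq_zero_of_homogeneous (w := w) (z := z - z') (p := p - p')
    (fun v => by
      have := h1.1 v
      have := h2.1 v
      simp only [map_sub, LinearMap.sub_apply]
      linarith) (fun q => by simp [h1.2 q, h2.2 q])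
  exact ⟨sub_eq_zero.1 h3, sub_eq_zero.1 h4⟩

theorem norm_step_le (h : SaddleFamily k B g κ L L₁ A) (h1 : IsSaddleStep k B g w z p) :
    κ * ‖z‖ ≤ A + L₁ * ‖w‖ := by
  have e := h1.1 z
  rw [h1.2 p, sub_zero] at e
  have h2 := h.coercive w z
  have h3 := (le_abs_self _).trans (h.bound_g w z)
  rcases (norm_nonneg z).eq_or_lt with h0 | h0
  · rw [← h0, mul_zero]
    exact add_nonneg h.A_nonneg (mul_nonneg h.L₁_nonneg (norm_nonneg _))
  · refine le_of_mul_le_mul_right ?_ h0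
    nlinarith

theorem norm_step_sub_le (h : SaddleFamily k B g κ L L₁ A) (h1 : IsSaddleStep k B g w z p)
    (h2 : IsSaddleStep k B g w' z' p') : κ * ‖z - z'‖ ≤ (L₁ + L * ‖z'‖) * ‖w - w'‖ := by
  set e := z - z' with he
  have h3 : k w e e = (g w e - g w' e) - (k w z' e - k w' z' e) := by
    have e1 := h1.1 e
    have e2 := h2.1 e
    have e3 : B e p = 0 := by simp [he, h1.2, h2.2]
    have e4 : B e p' = 0 := by simp [he, h1.2, h2.2]
    have e5 : ∀ y, k w e y = k w z y - k w z' y := fun y => by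
      rw [he, map_sub, LinearMap.sub_apply]
    rw [e5]; linarith
  have h4 := h.coercive w e
  have h5 := le_abs_self (k w e e)
  rw [h3] at h4 h5
  have h6 := (abs_sub _ _).trans (add_le_add (h.lip_g w w' e) (h.lip_k w w' z' e))
  rcases (norm_nonneg e).eq_or_lt with h0 | h0
  · rw [← h0, mul_zero]
    have := h.L_nonneg
    have := h.L₁_nonneg
    positivity
  · refine le_of_mul_le_mul_right ?_ h0
    nlinarith

theorem norm_fixed_le (h : SaddleFamily k B g κ L L₁ A) (h1 : IsSaddleStep k B g z z p) :
    ‖z‖ ≤ 2 * A / κ := by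
  have h2 := h.norm_step_le h1
  have h3 := mul_le_mul_of_nonneg_right h.small (norm_nonneg z)
  rw [le_div_iff₀ h.κ_pos]
  have := mul_nonneg h.κ_pos.le (norm_nonneg z)
  nlinarith

theorem contraction (h : SaddleFamily k B g κ L L₁ A) (hz' : ‖z'‖ ≤ 2 * A / κ)
    (h1 : IsSaddleStep k B g w z p) (h2 : IsSaddleStep k B g w' z' p') :
    ‖z - z'‖ ≤ 1 / 2 * ‖w - w'‖ := by
  have h3 := h.norm_step_sub_le h1 h2
  have hκ := h.κ_pos
  have h4 : L * ‖z'‖ ≤ κ / 4 := by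
    calc L * ‖z'‖ ≤ L * (2 * A / κ) := mul_le_mul_of_nonneg_left hz' h.L_nonneg
      _ = 2 * (A * L) / κ := by ring
      _ ≤ κ / 4 := by
        rw [div_le_iff₀ hκ]
        have := h.small'
        nlinarith
  have h5 := mul_le_mul_of_nonneg_right (add_le_add h.small h4) (norm_nonneg (w - w'))
  refine le_of_mul_le_mul_left ?_ hκ
  linarith

theorem exists_fixed [FiniteDimensional ℝ V] [FiniteDimensional ℝ M]
    (h : SaddleFamily k B g κ L L₁ A) : ∃ z p, IsSaddleStep k B g z z p := by
  choose S P hS using h.exists_step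
  have hκ := h.κ_pos
  have hρ : 0 ≤ 2 * A / κ := div_nonneg (mul_nonneg zero_le_two h.A_nonneg) hκ.le
  have hmaps : MapsTo S (Metric.closedBall 0 (2 * A / κ)) (Metric.closedBall 0 (2 * A / κ)) := by
    intro w hw
    rw [mem_closedBall_zero_iff] at hw ⊢
    have h1 := h.norm_step_le (hS w)
    have h2 := mul_le_mul h.small hw (norm_nonneg _) (by linarith : 0 ≤ κ / 4)
    rw [le_div_iff₀ hκ]
    have h3 : κ / 4 * (2 * A / κ) = A / 2 := by field_simp; norm_num
    have := h.A_nonneg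
    linarith
  have hc : ContractingWith (1 / 2) (hmaps.restrict S _ _) := by
    refine ⟨by norm_num, LipschitzWith.of_dist_le_mul fun x y => ?_⟩
    have := h.contraction (mem_closedBall_zero_iff.1 (hmaps y.2)) (hS x) (hS y)
    rw [← dist_eq_norm, ← dist_eq_norm] at this
    simpa [Subtype.dist_eq] using this
  have : CompleteSpace V := FiniteDimensional.complete ℝ V
  obtain ⟨y, -, hy, -⟩ := ContractingWith.exists_fixedPoint' Metric.isClosed_closedBall.isComplete
    hmaps hc (x := 0) (by simpa using hρ) (edist_ne_top _ _)
  refine ⟨y, P y, ?_⟩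
  have := hS y
  rwa [hy] at this

theorem fixed_unique (h : SaddleFamily k B g κ L L₁ A) (h1 : IsSaddleStep k B g z z p)
    (h2 : IsSaddleStep k B g z' z' p') : z = z' ∧ p = p' := by
  have h3 := h.contraction (h.norm_fixed_le h2) h1 h2
  have h4 : z = z' := by
    rw [← sub_eq_zero, ← norm_eq_zero]
    linarith [norm_nonneg (z - z')]
  subst h4
  exact h.step_unique h1 h2

theorem tendsto_velocity (h : SaddleFamily k B g κ L L₁ A) (h1 : IsSaddleStep k B g z z p)
    {W : ℕ → V} {Q : ℕ → M} (hW : ∀ i, IsSaddleStep k B g (W i) (W (i + 1)) (Q (i + 1))) :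
    Tendsto W atTop (𝓝 z) := by
  have hle : ∀ i, ‖W i - z‖ ≤ (1 / 2) ^ i * ‖W 0 - z‖ := by
    intro i
    induction i with
    | zero => simp
    | succ n ih =>
      refine (h.contraction (h.norm_fixed_le h1) (hW n) h1).trans ?_
      rw [pow_succ]; linarith
  rw [tendsto_iff_norm_sub_tendsto_zero]
  refine squeeze_zero (fun i => norm_nonneg _) hle ?_
  simpa using (tendsto_pow_atTop_nhds_zero_of_lt_one (by norm_num : (0 : ℝ) ≤ 1 / 2)
    (by norm_num)).mul_const ‖W 0 - z‖

theorem tendsto_pressure [FiniteDimensional ℝ V] [FiniteDimensional ℝ M]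
    (h : SaddleFamily k B g κ L L₁ A) (h1 : IsSaddleStep k B g z z p)
    {W : ℕ → V} {Q : ℕ → M} (hW : ∀ i, IsSaddleStep k B g (W i) (W (i + 1)) (Q (i + 1))) :
    Tendsto (fun i => Q (i + 1)) atTop (𝓝 p) := by
  have hlim := h.tendsto_velocity h1 hW
  have hn := tendsto_iff_norm_sub_tendsto_zero.1 hlim
  let b := Module.finBasis ℝ V
  let Φ : M →ₗ[ℝ] Fin (Module.finrank ℝ V) → ℝ := LinearMap.pi fun j => B (b j)
  have hker : LinearMap.ker Φ = ⊥ := by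
    refine LinearMap.ker_eq_bot'.2 fun q hq => h.injective q fun v => ?_
    have : B.flip q = 0 := b.ext fun j => congrFun hq j
    exact LinearMap.congr_fun this v
  obtain ⟨K, -, hK⟩ := Φ.exists_antilipschitzWith hker
  have key : ∀ v, Tendsto (fun i => B v (Q (i + 1))) atTop (𝓝 (B v p)) := by
    intro v
    have e : ∀ i, B v (Q (i + 1)) = B v p + (k z (W (i + 1)) v - k z z v) +
        (k (W i) (W (i + 1)) v - k z (W (i + 1)) v) - (g (W i) v - g z v) := fun i => by
      have := (hW i).1 v
      have := h1.1 v
      linarith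
    have t1 : Tendsto (fun i => k z (W (i + 1)) v - k z z v) atTop (𝓝 0) := by
      have hcont : Continuous fun y => k z y v :=
        ((k z).flip v).continuous_of_finiteDimensional
      have := (hcont.tendsto z).comp (hlim.comp (tendsto_add_atTop_nat 1))
      simpa using this.sub_const (k z z v)
    have t2 : Tendsto (fun i => k (W i) (W (i + 1)) v - k z (W (i + 1)) v) atTop (𝓝 0) := by
      refine squeeze_zero_norm (fun i => h.lip_k (W i) z (W (i + 1)) v) ?_
      have := ((hn.const_mul L).mul (hlim.comp (tendsto_add_atTop_nat 1)).norm).mul_const ‖v‖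
      simpa using this
    have t3 : Tendsto (fun i => g (W i) v - g z v) atTop (𝓝 0) := by
      refine squeeze_zero_norm (fun i => h.lip_g (W i) z v) ?_
      simpa using (hn.const_mul L₁).mul_const ‖v‖
    simp only [e]
    simpa using ((t1.const_add (B v p)).add t2).sub t3
  have hΦ : Tendsto (fun i => Φ (Q (i + 1))) atTop (𝓝 (Φ p)) :=
    tendsto_pi_nhds.2 fun j => key (b j)
  rw [tendsto_iff_dist_tendsto_zero] at hΦ ⊢
  refine squeeze_zero (fun _ => dist_nonneg) (fun i => hK.le_mul_dist _ _) ?_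
  simpa using hΦ.const_mul (K : ℝ)

end SaddleFamily
end SaddlePoint

section DiscreteProblem

theorem map_zero_of_smul_add {V : Type*} [AddCommGroup V] [Module ℝ V] {F : V → ℝ}
    (h : ∀ (c : ℝ) z z', F (c • z + z') = c * F z + F z') : F 0 = 0 := by
  have := h 1 0 0
  simp only [smul_zero, add_zero, one_mul] at this
  linarith

/-- The linear form of a real function compatible with `c • z + z'`. -/
def linOfSmulAdd {V : Type*} [AddCommGroup V] [Module ℝ V] (F : V → ℝ)
    (h : ∀ (c : ℝ) z z', F (c • z + z') = c * F z + F z') : V →ₗ[ℝ] ℝ where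
  toFun := F
  map_add' := fun z z' => by simpa using h 1 z z'
  map_smul' := fun c z => by simpa [map_zero_of_smul_add h] using h c z 0

/-- The bilinear form of a real function compatible with `c • z + z'` in each argument. -/
def bilinOfSmulAdd {V W : Type*} [AddCommGroup V] [Module ℝ V] [AddCommGroup W] [Module ℝ W]
    (F : V → W → ℝ) (h : ∀ (c : ℝ) z z' v, F (c • z + z') v = c * F z v + F z' v)
    (h' : ∀ z (c : ℝ) v v', F z (c • v + v') = c * F z v + F z v') : V →ₗ[ℝ] W →ₗ[ℝ] ℝ where
  toFun := fun z => linOfSmulAdd (F z) (h' z)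
  map_add' := fun z z' => LinearMap.ext fun v => by
    have := h 1 z z' v
    rw [one_smul, one_mul] at this
    exact this
  map_smul' := fun c z => LinearMap.ext fun v => by
    have h0 : F 0 v = 0 := map_zero_of_smul_add (F := fun z => F z v) fun c z z' => h c z z' v
    have := h c z 0 v
    rw [add_zero, h0, add_zero] at this
    exact this

variable {Ω : Set (E d)} {T : Triangulation Ω} {Re : ℝ} {α β : ℝ → ℝ} {εh : E d → ℝ}
  {f G w w' : E d → E d} {p : E d → ℝ}

/-- The regularity of the data of the discrete problem. -/
structure DiscreteData (Ω : Set (E d)) (α β : ℝ → ℝ) (εh : E d → ℝ) (f G : E d → E d) :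
    Prop where
  isOpen : IsOpen Ω
  bounded : Bornology.IsBounded Ω
  lip : IsW1Lip Ω εh
  memLp_α : MemLp (fun x => α (εh x)) ⊤ (volume.restrict Ω)
  memLp_β : MemLp (fun x => β (εh x)) ⊤ (volume.restrict Ω)
  memLp_f : MemLp f 2 (volume.restrict Ω)
  memXs : MemXs Ω G

theorem Triangulation.MemX0h.lipX (hΩ : IsOpen Ω) (hb : Bornology.IsBounded Ω)
    (hw : T.MemX0h w) : LipX Ω w := hw.1.isW1Lip hΩ hb

theorem DiscreteData.memX_add (D : DiscreteData Ω α β εh f G) (hw : T.MemX0h w) :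
    MemX Ω (w + G) := hw.2.1.add D.isOpen D.memXs.memX

theorem DiscreteData.isDiscreteSolution_iff (D : DiscreteData Ω α β εh f G) :
    IsDiscreteSolution T Re α β εh f G w p ↔ IsStep T Re α β εh f G w w p := by
  have key : ∀ v, T.MemX0h w → T.MemX0h v → formC Ω β εh (w + G) (w + G) v =
      formC Ω β εh (w + G) w v + formC Ω β εh (w + G) G v := fun v hw hv => by
    have := formC_smul_add_mid D.isOpen D.lip D.memLp_β (D.memX_add hw) hw.2.1 D.memXs.memX
      (hv.lipX D.isOpen D.bounded) 1
    simpa using this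
  constructor
  · rintro ⟨hw, hp, h1, h2⟩
    refine ⟨hw, hp, fun v hv => ?_, h2⟩
    have := h1 v hv
    rw [key v hw hv] at this
    linarith
  · rintro ⟨hw, hp, h1, h2⟩
    refine ⟨hw, hp, fun v hv => ?_, h2⟩
    have := h1 v hv
    rw [key v hw hv]
    linarith

variable (T Re) in
/-- The linearized form `a_h(z, v) + c_h(w + G, z, v)`. -/
def DiscreteData.form (D : DiscreteData Ω α β εh f G)
    (w : T.velocitySpace D.isOpen D.bounded) :
    T.velocitySpace D.isOpen D.bounded →ₗ[ℝ] T.velocitySpace D.isOpen D.bounded →ₗ[ℝ] ℝ :=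
  bilinOfSmulAdd (fun z v => formA Ω Re α εh z v + formC Ω β εh (w + G) z v)
    (fun c z z' v => by
      have h1 := formA_smul_add_left (Re := Re) D.isOpen D.lip D.memLp_α z.2.1.2.1 z'.2.1.2.1
        v.2.1.2.1 c
      have h2 := formC_smul_add_mid D.isOpen D.lip D.memLp_β (D.memX_add w.2.1) z.2.1.2.1
        z'.2.1.2.1 (v.2.1.lipX D.isOpen D.bounded) c
      simp only [Submodule.coe_add, Submodule.coe_smul, h1, h2]
      ring)
    (fun z c v v' => by
      have h1 := formA_smul_add_right (Re := Re) D.isOpen D.lip D.memLp_α z.2.1.2.1 v.2.1.2.1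
        v'.2.1.2.1 c
      have h2 := formC_smul_add_right D.isOpen D.lip D.memLp_β (D.memX_add w.2.1) z.2.1.2.1
        (v.2.1.lipX D.isOpen D.bounded) (v'.2.1.lipX D.isOpen D.bounded) c
      simp only [Submodule.coe_add, Submodule.coe_smul, h1, h2]
      ring)

variable (T) in
/-- The form `b_h`. -/
def DiscreteData.div (D : DiscreteData Ω α β εh f G) :
    T.velocitySpace D.isOpen D.bounded →ₗ[ℝ] T.pressureSpace D.isOpen D.bounded →ₗ[ℝ] ℝ :=
  bilinOfSmulAdd (fun v q => formB Ω εh v q)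
    (fun c v v' q => formB_smul_add_left D.isOpen D.lip v.2.1.2.1 v'.2.1.2.1
      (q.2.1.1.memLp D.isOpen D.bounded) c)
    (fun v c q q' => formB_smul_add_right D.isOpen D.lip v.2.1.2.1
      (q.2.1.1.memLp D.isOpen D.bounded) (q'.2.1.1.memLp D.isOpen D.bounded) c)

variable (T Re) in
/-- The right-hand side `ℓ_h(v) - a_h(G, v) - c_h(w + G, G, v)`. -/
def DiscreteData.rhs (D : DiscreteData Ω α β εh f G)
    (w : T.velocitySpace D.isOpen D.bounded) :
    T.velocitySpace D.isOpen D.bounded →ₗ[ℝ] ℝ :=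
  linOfSmulAdd
    (fun v => formL Ω εh f v - formA Ω Re α εh G v - formC Ω β εh (w + G) G v)
    (fun c v v' => by
      have h1 := formA_smul_add_right (Re := Re) D.isOpen D.lip D.memLp_α D.memXs.memX v.2.1.2.1
        v'.2.1.2.1 c
      have h2 := formC_smul_add_right D.isOpen D.lip D.memLp_β (D.memX_add w.2.1) D.memXs.memX
        (v.2.1.lipX D.isOpen D.bounded) (v'.2.1.lipX D.isOpen D.bounded) c
      have h3 := formL_smul_add D.isOpen D.lip D.memLp_f v.2.1.2.1 v'.2.1.2.1 c
      simp only [Submodule.coe_add, Submodule.coe_smul, h1, h2, h3]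
      ring)

/-- The normalization of a discrete velocity. -/
def toVelocity (hΩ : IsOpen Ω) (hb : Bornology.IsBounded Ω) (hw : T.MemX0h w) :
    T.velocitySpace hΩ hb := ⟨_, T.indicator_mem_velocitySpace hΩ hb hw⟩

/-- The normalization of a discrete pressure. -/
def toPressure (hΩ : IsOpen Ω) (hb : Bornology.IsBounded Ω) (hp : T.MemM0h p) :
    T.pressureSpace hΩ hb := ⟨_, T.indicator_mem_pressureSpace hΩ hb hp⟩

theorem eqOn_toVelocity (hΩ : IsOpen Ω) (hb : Bornology.IsBounded Ω) (hw : T.MemX0h w) :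
    EqOn (toVelocity hΩ hb hw : E d → E d) w (closure Ω) := eqOn_indicator

theorem eqOn_toPressure (hΩ : IsOpen Ω) (hb : Bornology.IsBounded Ω) (hp : T.MemM0h p) :
    EqOn (toPressure hΩ hb hp : E d → ℝ) p (closure Ω) := eqOn_indicator

theorem toVelocity_coe (hΩ : IsOpen Ω) (hb : Bornology.IsBounded Ω) (z : T.velocitySpace hΩ hb) :
    toVelocity hΩ hb z.2.1 = z := by
  refine Subtype.ext (indicator_eq_self.2 fun x hx => ?_)
  by_contra h
  exact hx (z.2.2 x h)

theorem toPressure_coe (hΩ : IsOpen Ω) (hb : Bornology.IsBounded Ω) (q : T.pressureSpace hΩ hb) :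
    toPressure hΩ hb q.2.1 = q := by
  refine Subtype.ext (indicator_eq_self.2 fun x hx => ?_)
  by_contra h
  exact hx (q.2.2 x h)

theorem DiscreteData.isStep_iff (D : DiscreteData Ω α β εh f G) (hw : T.MemX0h w)
    (hw' : T.MemX0h w') (hp : T.MemM0h p) :
    IsStep T Re α β εh f G w w' p ↔
      (∀ v, D.form T Re (toVelocity D.isOpen D.bounded hw) (toVelocity D.isOpen D.bounded hw') v -
        D.div T v (toPressure D.isOpen D.bounded hp) =
          D.rhs T Re (toVelocity D.isOpen D.bounded hw) v) ∧
      ∀ q, D.div T (toVelocity D.isOpen D.bounded hw') q = 0 := by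
  have hΩ := D.isOpen
  have ew := (eqOn_toVelocity hΩ D.bounded hw).mono subset_closure
  have ew' := (eqOn_toVelocity hΩ D.bounded hw').mono subset_closure
  have ep := (eqOn_toPressure hΩ D.bounded hp).mono subset_closure
  have ewG : EqOn ((toVelocity hΩ D.bounded hw : E d → E d) + G) (w + G) Ω := fun x hx => by
    simp only [Pi.add_apply, ew hx]
  have e1 : ∀ v : T.velocitySpace hΩ D.bounded, ∀ v', EqOn (v : E d → E d) v' Ω →
      D.form T Re (toVelocity hΩ D.bounded hw) (toVelocity hΩ D.bounded hw') v =
      formA Ω Re α εh w' v' + formC Ω β εh (w + G) w' v' := fun v v' h =>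
    congrArg₂ (· + ·) (formA_congr hΩ ew' h) (formC_congr hΩ ewG ew' h)
  have e2 : ∀ v : T.velocitySpace hΩ D.bounded, ∀ v', EqOn (v : E d → E d) v' Ω →
      D.div T v (toPressure hΩ D.bounded hp) = formB Ω εh v' p := fun v v' h =>
    formB_congr hΩ h ep
  have e3 : ∀ v : T.velocitySpace hΩ D.bounded, ∀ v', EqOn (v : E d → E d) v' Ω →
      D.rhs T Re (toVelocity hΩ D.bounded hw) v =
      formL Ω εh f v' - formA Ω Re α εh G v' - formC Ω β εh (w + G) G v' := fun v v' h =>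
    congrArg₂ (· - ·) (congrArg₂ (· - ·) (formL_congr hΩ h) (formA_congr hΩ (eqOn_refl _ _) h))
      (formC_congr hΩ ewG (eqOn_refl _ _) h)
  have e4 : ∀ q : T.pressureSpace hΩ D.bounded, ∀ q', EqOn (q : E d → ℝ) q' Ω →
      D.div T (toVelocity hΩ D.bounded hw') q = formB Ω εh w' q' := fun q q' h =>
    formB_congr hΩ ew' h
  constructor
  · rintro ⟨-, -, h1, h2⟩
    refine ⟨fun v => ?_, fun q => ?_⟩
    · rw [e1 v v (eqOn_refl _ _), e2 v v (eqOn_refl _ _), e3 v v (eqOn_refl _ _)]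
      exact h1 v v.2.1
    · rw [e4 q q (eqOn_refl _ _)]
      exact h2 q q.2.1
  · rintro ⟨h1, h2⟩
    refine ⟨hw', hp, fun v hv => ?_, fun q hq => ?_⟩
    · have h := (eqOn_toVelocity hΩ D.bounded hv).mono subset_closure
      rw [← e1 _ v h, ← e2 _ v h, ← e3 _ v h]
      exact h1 _
    · have h := (eqOn_toPressure hΩ D.bounded hq).mono subset_closure
      rw [← e4 _ q h]
      exact h2 _

theorem l2norm_smul (q : E d → ℝ) (c : ℝ) : l2norm Ω (c • q) = |c| * l2norm Ω q :=
  l2norm_const_mul q c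

theorem velocity_core {r s : ℝ≥0∞} {K : ℝ} (hK : SobolevBounds Ω r s K) (hΩ : IsOpen Ω)
    (hb : Bornology.IsBounded Ω) :
    @NormedSpace.Core ℝ (T.velocitySpace hΩ hb) _ _ _ ⟨fun v => gradN Ω v⟩ :=
  letI : Norm (T.velocitySpace hΩ hb) := ⟨fun v => gradN Ω v⟩
  { norm_nonneg := fun v => gradN_nonneg (v : E d → E d)
    norm_smul := fun c v => gradN_smul hΩ v.2.1.2.1 c
    norm_triangle := fun u v => gradN_add_le hΩ u.2.1.2.1 v.2.1.2.1
    norm_eq_zero_iff := fun v => by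
      constructor
      · intro h
        have h1 : gradN Ω (v : E d → E d) = 0 := h
        have h2 := hK.poincare v v.2.1.2
        rw [h1, mul_zero] at h2
        ext x j
        by_cases hx : x ∈ closure Ω
        · refine Triangulation.eqOn_zero_of_l2norm_eq_zero hΩ (v.2.1.2.1 j).1
            ((EuclideanSpace.proj (𝕜 := ℝ) j).continuous.comp_continuousOn v.2.1.1.1)
            (le_antisymm ((l2norm_comp_le_fullN j).trans h2) (l2norm_nonneg _)) x hx
        · rw [v.2.2 x hx]; simp
      · rintro rfl
        have := gradN_smul hΩ (memX0_zero hΩ hb).1 0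
        rw [abs_zero, zero_mul, zero_smul] at this
        exact this }

theorem pressure_core (hΩ : IsOpen Ω) (hb : Bornology.IsBounded Ω) :
    @NormedSpace.Core ℝ (T.pressureSpace hΩ hb) _ _ _ ⟨fun q => l2norm Ω (q : E d → ℝ)⟩ :=
  letI : Norm (T.pressureSpace hΩ hb) := ⟨fun q => l2norm Ω (q : E d → ℝ)⟩
  { norm_nonneg := fun q => l2norm_nonneg (q : E d → ℝ)
    norm_smul := fun c q => l2norm_smul (q : E d → ℝ) c
    norm_triangle := fun u v => l2norm_add_le (u.2.1.1.memLp hΩ hb) (v.2.1.1.memLp hΩ hb)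
    norm_eq_zero_iff := fun q => by
      constructor
      · intro h
        ext x
        by_cases hx : x ∈ closure Ω
        · exact Triangulation.eqOn_zero_of_l2norm_eq_zero hΩ (q.2.1.1.memLp hΩ hb) q.2.1.1.1 h x hx
        · rw [q.2.2 x hx]; simp
      · rintro rfl
        have := l2norm_smul (Ω := Ω) (0 : E d → ℝ) 0
        rw [abs_zero, zero_mul, zero_smul] at this
        exact this }

end DiscreteProblem

section Conclusion

variable {Ω : Set (E d)} {T : Triangulation Ω} {Re : ℝ} {α β : ℝ → ℝ} {εh : E d → ℝ}
  {f G : E d → E d}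

/-- The analytic properties of the discrete forms on which solvability and convergence rest. -/
structure FormBounds (T : Triangulation Ω) (Re : ℝ) (α β : ℝ → ℝ) (εh : E d → ℝ)
    (f G : E d → E d) (κ L L₁ A : ℝ) : Prop where
  coercive : ∀ w v, T.MemX0h w → T.MemX0h v →
    κ * gradN Ω v ^ 2 ≤ formA Ω Re α εh v v + formC Ω β εh (w + G) v v
  injective : ∀ q, T.MemM0h q → (∀ v, T.MemX0h v → formB Ω εh v q = 0) → ∀ x ∈ closure Ω, q x = 0
  lip_form : ∀ w w' z v, T.MemX0h w → T.MemX0h w' → T.MemX0h z → T.MemX0h v →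
    |formC Ω β εh (w + G) z v - formC Ω β εh (w' + G) z v| ≤
      L * gradN Ω (w - w') * gradN Ω z * gradN Ω v
  bound_rhs : ∀ w v, T.MemX0h w → T.MemX0h v →
    |formL Ω εh f v - formA Ω Re α εh G v - formC Ω β εh (w + G) G v| ≤
      (A + L₁ * gradN Ω w) * gradN Ω v
  lip_rhs : ∀ w w' v, T.MemX0h w → T.MemX0h w' → T.MemX0h v →
    |formC Ω β εh (w + G) G v - formC Ω β εh (w' + G) G v| ≤
      L₁ * gradN Ω (w - w') * gradN Ω v

theorem DiscreteData.solvability_and_convergence (D : DiscreteData Ω α β εh f G) (hd : 0 < d)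
    {r s : ℝ≥0∞} {K : ℝ} (hK : SobolevBounds Ω r s K) {κ L L₁ A : ℝ}
    (F : FormBounds T Re α β εh f G κ L L₁ A) (hκ : 0 < κ) (hL : 0 ≤ L) (hL₁ : 0 ≤ L₁)
    (hA : 0 ≤ A) (small : L₁ ≤ κ / 4) (small' : A * L ≤ κ ^ 2 / 8) :
    (∃ wh ph, IsDiscreteSolution T Re α β εh f G wh ph) ∧
    (∀ wh ph wh' ph', IsDiscreteSolution T Re α β εh f G wh ph →
      IsDiscreteSolution T Re α β εh f G wh' ph' →
      Set.EqOn wh wh' (closure Ω) ∧ Set.EqOn ph ph' (closure Ω)) ∧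
    (∀ w, T.MemX0h w →
      (∃ w' p', IsStep T Re α β εh f G w w' p') ∧
      ∀ w' p' w'' p'', IsStep T Re α β εh f G w w' p' → IsStep T Re α β εh f G w w'' p'' →
        Set.EqOn w' w'' (closure Ω) ∧ Set.EqOn p' p'' (closure Ω)) ∧
    ∀ wh ph, IsDiscreteSolution T Re α β εh f G wh ph →
    ∀ (w : ℕ → E d → E d) (p : ℕ → E d → ℝ), T.MemX0h (w 0) →
      (∀ i, IsStep T Re α β εh f G (w i) (w (i + 1)) (p (i + 1))) →
      Tendsto (fun i => l2norm Ω (w (i + 1) - wh)) atTop (𝓝 0) ∧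
      Tendsto (fun i => l2norm Ω (p (i + 1) - ph)) atTop (𝓝 0) := by
  have hΩ := D.isOpen
  have hb := D.bounded
  let iV : Norm (T.velocitySpace hΩ hb) := ⟨fun v => gradN Ω v⟩
  let iV1 : NormedAddCommGroup (T.velocitySpace hΩ hb) :=
    NormedAddCommGroup.ofCore (velocity_core (T := T) hK hΩ hb)
  let iV2 : NormedSpace ℝ (T.velocitySpace hΩ hb) :=
    NormedSpace.ofCore (velocity_core (T := T) hK hΩ hb)
  let iM : Norm (T.pressureSpace hΩ hb) := ⟨fun q => l2norm Ω (q : E d → ℝ)⟩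
  let iM1 : NormedAddCommGroup (T.pressureSpace hΩ hb) :=
    NormedAddCommGroup.ofCore (pressure_core (T := T) hΩ hb)
  let iM2 : NormedSpace ℝ (T.pressureSpace hΩ hb) :=
    NormedSpace.ofCore (pressure_core (T := T) hΩ hb)
  have fV := T.finiteDimensional_velocitySpace hd hΩ hb
  have fM := T.finiteDimensional_pressureSpace hΩ hb
  have S : SaddleFamily (D.form T Re) (D.div T) (D.rhs T Re) κ L L₁ A :=
    { κ_pos := hκ
      L_nonneg := hL
      L₁_nonneg := hL₁
      A_nonneg := hA
      coercive := fun w v => F.coercive w v w.2.1 v.2.1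
      injective := fun q hq => by
        have := F.injective q q.2.1 fun v hv => by
          have h1 := hq (toVelocity hΩ hb hv)
          rw [← formB_congr hΩ ((eqOn_toVelocity hΩ hb hv).mono subset_closure) (eqOn_refl _ _)]
          exact h1
        ext x
        by_cases hx : x ∈ closure Ω
        · exact this x hx
        · exact q.2.2 x hx
      lip_k := fun w w' z v => by
        have := F.lip_form w w' z v w.2.1 w'.2.1 z.2.1 v.2.1
        have e : D.form T Re w z v - D.form T Re w' z v =
            formC Ω β εh (w + G) z v - formC Ω β εh (w' + G) z v :=
          add_sub_add_left_eq_sub _ _ _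
        rw [e]
        exact this
      bound_g := fun w v => F.bound_rhs w v w.2.1 v.2.1
      lip_g := fun w w' v => by
        have := F.lip_rhs w w' v w.2.1 w'.2.1 v.2.1
        have e : D.rhs T Re w v - D.rhs T Re w' v =
            -(formC Ω β εh (w + G) G v - formC Ω β εh (w' + G) G v) := by
          have e0 : ∀ w v, D.rhs T Re w v = formL Ω εh f v - formA Ω Re α εh G v -
            formC Ω β εh (w + G) G v := fun _ _ => rfl
          rw [e0, e0]
          ring
        rw [e, abs_neg]
        exact this
      small := small
      small' := small' }
  have eqV : ∀ {u v : E d → E d} (hu : T.MemX0h u) (hv : T.MemX0h v),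
      toVelocity hΩ hb hu = toVelocity hΩ hb hv → EqOn u v (closure Ω) := fun hu hv h x hx => by
    rw [← eqOn_toVelocity hΩ hb hu hx, h, eqOn_toVelocity hΩ hb hv hx]
  have eqM : ∀ {p q : E d → ℝ} (hp : T.MemM0h p) (hq : T.MemM0h q),
      toPressure hΩ hb hp = toPressure hΩ hb hq → EqOn p q (closure Ω) := fun hp hq h x hx => by
    rw [← eqOn_toPressure hΩ hb hp hx, h, eqOn_toPressure hΩ hb hq hx]
  refine ⟨?_, ?_, ?_, ?_⟩
  · obtain ⟨z, p, h⟩ := S.exists_fixed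
    refine ⟨z, p, D.isDiscreteSolution_iff.2 ((D.isStep_iff z.2.1 z.2.1 p.2.1).2 ?_)⟩
    rw [toVelocity_coe, toPressure_coe]
    exact h
  · intro wh ph wh' ph' h h'
    rw [D.isDiscreteSolution_iff] at h h'
    have h1 := (D.isStep_iff h.1 h.1 h.2.1).1 h
    have h2 := (D.isStep_iff h'.1 h'.1 h'.2.1).1 h'
    obtain ⟨h3, h4⟩ := S.fixed_unique h1 h2
    exact ⟨eqV _ _ h3, eqM _ _ h4⟩
  · intro w hw
    constructor
    · obtain ⟨z, p, h⟩ := S.exists_step (toVelocity hΩ hb hw)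
      refine ⟨z, p, (D.isStep_iff hw z.2.1 p.2.1).2 ?_⟩
      rw [toVelocity_coe, toPressure_coe]
      exact h
    · intro w' p' w'' p'' h h'
      have h1 := (D.isStep_iff hw h.1 h.2.1).1 h
      have h2 := (D.isStep_iff hw h'.1 h'.2.1).1 h'
      obtain ⟨h3, h4⟩ := S.step_unique h1 h2
      exact ⟨eqV _ _ h3, eqM _ _ h4⟩
  · intro wh ph h w p hw0 hstep
    rw [D.isDiscreteSolution_iff] at h
    have h1 := (D.isStep_iff h.1 h.1 h.2.1).1 h
    have hw : ∀ i, T.MemX0h (w i) := fun i => by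
      cases i with
      | zero => exact hw0
      | succ n => exact (hstep n).1
    let W : ℕ → T.velocitySpace hΩ hb := fun i => toVelocity hΩ hb (hw i)
    let Q : ℕ → T.pressureSpace hΩ hb := fun i => toPressure hΩ hb (hstep (i - 1)).2.1
    have hWQ : ∀ i, IsSaddleStep (D.form T Re) (D.div T) (D.rhs T Re) (W i) (W (i + 1))
      (Q (i + 1)) := fun i => (D.isStep_iff (hw i) (hw (i + 1)) (hstep i).2.1).1 (hstep i)
    have tV := tendsto_iff_norm_sub_tendsto_zero.1
      ((S.tendsto_velocity h1 hWQ).comp (tendsto_add_atTop_nat 1))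
    have tM := tendsto_iff_norm_sub_tendsto_zero.1 (S.tendsto_pressure h1 hWQ)
    constructor
    · refine squeeze_zero (fun i => l2norm_nonneg _) (fun i => ?_) (by simpa using tV.const_mul K)
      let y := W (i + 1) - toVelocity hΩ hb h.1
      have e : w (i + 1) - wh =ᵐ[volume.restrict Ω] (y : E d → E d) :=
        ae_restrict_of_eqOn hΩ fun x hx => by
          have e1 := eqOn_toVelocity hΩ hb (hw (i + 1)) (subset_closure hx)
          have e2 := eqOn_toVelocity hΩ hb h.1 (subset_closure hx)
          change _ = (toVelocity hΩ hb (hw (i + 1)) : E d → E d) x -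
            (toVelocity hΩ hb h.1 : E d → E d) x
          rw [e1, e2]; rfl
      rw [l2norm_congr e]
      exact ((l2norm_le_normX _).trans (normX_le_fullN hΩ y.2.1.2.1)).trans
        (hK.poincare y y.2.1.2)
    · refine tM.congr fun i => ?_
      refine l2norm_congr (ae_restrict_of_eqOn hΩ fun x hx => ?_)
      have e1 := eqOn_toPressure hΩ hb (hstep i).2.1 (subset_closure hx)
      have e2 := eqOn_toPressure hΩ hb h.2.1 (subset_closure hx)
      change (toPressure hΩ hb (hstep i).2.1 : E d → ℝ) x -
            (toPressure hΩ hb h.2.1 : E d → ℝ) x = _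
      rw [e1, e2]; rfl

theorem DiscreteData.formC_zero (D : DiscreteData Ω α β εh f G)
    {z v : E d → E d} (hz : MemX Ω z) (hv : LipX Ω v) : formC Ω β εh 0 z v = 0 := by
  have h0 := (memX0_zero D.isOpen D.bounded).1
  have := formD_smul_add_left D.isOpen D.lip h0 h0 hz hv 1
  simp only [smul_zero, add_zero, one_mul] at this
  have h1 : formD Ω εh 0 z v = 0 := by linarith
  rw [formC, h1]
  simp

/-- The bounds of the discrete forms, with constants independent of the mesh. -/
theorem SobolevBounds.formBounds {r s : ℝ≥0∞} {K : ℝ} (hK : SobolevBounds Ω r s K)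
    (D : DiscreteData Ω α β εh f G) (hd : d = 2 ∨ d = 3) (hΩc : IsConnected Ω)
    (hreg : interior (closure Ω) = Ω) (hRe : 0 < Re) {ε₀ αM βM P N : ℝ} (hε₀ : 0 < ε₀)
    (hεb : ∀ x ∈ Ω, ε₀ ≤ εh x ∧ εh x ≤ 1) (hα : ∀ x ∈ Ω, 0 ≤ α (εh x) ∧ α (εh x) ≤ αM)
    (hβ : ∀ x ∈ Ω, 0 ≤ β (εh x) ∧ β (εh x) ≤ βM) (hαM : 0 ≤ αM) (hβM : 0 ≤ βM) (hP : 0 ≤ P)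
    (hεP : ∀ i, eLpNorm (weakPartial Ω i εh) r (volume.restrict Ω) ≤ ENNReal.ofReal P)
    (hN : fullN Ω G ≤ N) :
    FormBounds T Re α β εh f G (ε₀ / Re / (d * d) ^ 2)
      (d * d * (K ^ 3 * (2 + P + βM)) * K ^ 2) (d * d * (K ^ 3 * (2 + P + βM)) * (K * N))
      (d * d * (1 + P * K) * dualNorm Ω f + (d * d / Re + d * αM) * (K * N) +
        d * d * (K ^ 3 * (2 + P + βM)) * N ^ 2) := by
  have hΩ := D.isOpen
  have hb := D.bounded
  have hd0 : (0 : ℝ) < d := by rcases hd with rfl | rfl <;> norm_num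
  have hK0 : 0 ≤ K := by linarith [hK.one_le]
  have hN0 : 0 ≤ N := (fullN_nonneg G).trans hN
  have ae_of : ∀ {Q : E d → Prop}, (∀ x ∈ Ω, Q x) → ∀ᵐ x ∂(volume.restrict Ω), Q x := fun h =>
    (ae_restrict_iff' hΩ.measurableSet).2 (ae_of_all _ h)
  have hε1 : ∀ᵐ x ∂(volume.restrict Ω), |εh x| ≤ 1 := ae_of fun x hx => by
    rw [abs_of_nonneg (hε₀.le.trans (hεb x hx).1)]; exact (hεb x hx).2
  have hα' : ∀ᵐ x ∂(volume.restrict Ω), |α (εh x)| ≤ αM := ae_of fun x hx => by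
    rw [abs_of_nonneg (hα x hx).1]; exact (hα x hx).2
  have hβ' : ∀ᵐ x ∂(volume.restrict Ω), |β (εh x)| ≤ βM := ae_of fun x hx => by
    rw [abs_of_nonneg (hβ x hx).1]; exact (hβ x hx).2
  set C : ℝ := d * d * (K ^ 3 * (2 + P + βM)) with hC
  have hC0 : 0 ≤ C := by positivity
  have hXs : ∀ {w}, T.MemX0h w → MemXs Ω w := fun hw => hw.2.memXs hΩ hb
  have hGs := D.memXs
  have lipC : ∀ {u u' z v}, MemXs Ω u → MemXs Ω u' → MemXs Ω z → T.MemX0h v →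
      |formC Ω β εh u z v - formC Ω β εh u' z v| ≤
        C * (fullN Ω (u - u') * fullN Ω z * gradN Ω v) := fun hu hu' hz hv =>
    hK.abs_formC_sub_le hΩ hb D.lip hε1 hP hεP hβM D.memLp_β hβ' hu hu' hz
      (hv.lipX hΩ hb) hv.2
  have hsub : ∀ {w w'}, T.MemX0h w → T.MemX0h w' →
      fullN Ω ((w + G) - (w' + G)) ≤ K * gradN Ω (w - w') := fun {w w'} hw hw' => by
    have h := hw'.smul_add hΩ hb hw (-1)
    rw [show (-1 : ℝ) • w' + w = w - w' by rw [neg_one_smul]; abel] at h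
    rw [add_sub_add_right_eq_sub]
    exact hK.poincare _ h.2
  have ng := fun v => gradN_nonneg (Ω := Ω) v
  have nf := fun v => fullN_nonneg (Ω := Ω) v
  refine ⟨fun w v hw hv => ?_, fun q hq h => ?_, fun w w' z v hw hw' hz hv => ?_,
    fun w v hw hv => ?_, fun w w' v hw hw' hv => ?_⟩
  · have h1 := coercive (Re := Re) (α := α) (β := β) hΩ hb D.lip hRe (fun x hx => (hεb x hx).1)
      (fun x hx => (hα x hx).1) (fun x hx => (hβ x hx).1) (D.memX_add hw) (hv.lipX hΩ hb) hv.2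
    refine le_trans ?_ h1
    have h2 := gradN_le_seminormX hΩ hv.2.1
    rw [← mul_assoc] at h2
    have h3 := pow_le_pow_left₀ (ng v) h2 2
    rw [mul_pow] at h3
    rw [div_mul_eq_mul_div, div_le_iff₀ (by positivity), mul_assoc,
      mul_comm (seminormX Ω v ^ 2)]
    exact mul_le_mul_of_nonneg_left h3 (by positivity)
  · exact hq.eq_zero_of_formB hΩ hΩc hb hreg D.lip (fun x hx => hε₀.trans_le (hεb x hx).1) h
  · refine (lipC ((hXs hw).add hΩ hb hGs) ((hXs hw').add hΩ hb hGs) (hXs hz) hv).trans ?_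
    calc C * (fullN Ω ((w + G) - (w' + G)) * fullN Ω z * gradN Ω v)
        ≤ C * (K * gradN Ω (w - w') * (K * gradN Ω z) * gradN Ω v) := by
          have := ng v
          have := ng (w - w')
          have := nf z
          have := hsub hw hw'
          have := hK.poincare z hz.2
          gcongr
      _ = _ := by ring
  · have h1 := hK.abs_formL_le hd hΩ hb D.lip hε1 hP hεP D.memLp_f hv.2
    have h2 := abs_formA_le (Re := Re) hΩ D.lip hRe hε1 hαM D.memLp_α hα' hGs.memX hv.2.1
    have h3 := lipC ((hXs hw).add hΩ hb hGs) ((memX0_zero hΩ hb).memXs hΩ hb) hGs hv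
    rw [D.formC_zero hGs.memX (hv.lipX hΩ hb), sub_zero, sub_zero] at h3
    have h4 : fullN Ω (w + G) ≤ K * gradN Ω w + N :=
      (fullN_add_le hΩ hw.2.1 hGs.memX).trans (add_le_add (hK.poincare w hw.2) hN)
    have h5 := hK.poincare v hv.2
    have h2' : |formA Ω Re α εh G v| ≤ (d * d / Re + d * αM) * (N * (K * gradN Ω v)) := by
      refine h2.trans ?_
      have := nf v
      gcongr
    have h3' : |formC Ω β εh (w + G) G v| ≤ C * ((K * gradN Ω w + N) * N * gradN Ω v) := by
      refine h3.trans ?_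
      have := nf G
      have := ng v
      have := ng w
      gcongr
    refine (abs_sub _ _).trans ((add_le_add_left (abs_sub _ _) _).trans ?_)
    linarith
  · refine (lipC ((hXs hw).add hΩ hb hGs) ((hXs hw').add hΩ hb hGs) hGs hv).trans ?_
    calc C * (fullN Ω ((w + G) - (w' + G)) * fullN Ω G * gradN Ω v)
        ≤ C * (K * gradN Ω (w - w') * N * gradN Ω v) := by
          have := ng v
          have := ng (w - w')
          have := nf G
          have := hsub hw hw'
          gcongr
      _ = _ := by ring

theorem exists_small_data {κ C K N CL CA L : ℝ} (hκ : 0 < κ) (hC : 0 ≤ C) (hK : 0 ≤ K)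
    (hN : 0 ≤ N) (hCL : 0 ≤ CL) (hCA : 0 ≤ CA) (hL : 0 ≤ L) :
    ∃ δ > 0, ∀ x y : ℝ, 0 ≤ x → 0 ≤ y → x + y < δ → C * (K * (N * y)) ≤ κ / 4 ∧
      (CL * x + CA * (K * (N * y)) + C * (N * y) ^ 2) * L ≤ κ ^ 2 / 8 := by
  set B := C * K * N + 1 with hB
  set Q := (CL + CA * (K * N) + C * N ^ 2) * L + 1 with hQ
  have hB0 : 0 < B := by positivity
  have hQ0 : 0 < Q := by positivity
  refine ⟨min 1 (min (κ / 4 / B) (κ ^ 2 / 8 / Q)), by positivity, fun x y hx hy h => ?_⟩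
  have h1 : x + y < 1 := h.trans_le (min_le_left _ _)
  have h2 : x + y < κ / 4 / B := h.trans_le ((min_le_right _ _).trans (min_le_left _ _))
  have h3 : x + y < κ ^ 2 / 8 / Q := h.trans_le ((min_le_right _ _).trans (min_le_right _ _))
  rw [lt_div_iff₀ hB0] at h2
  rw [lt_div_iff₀ hQ0] at h3
  have hxB : 0 ≤ C * K * N * x := by positivity
  constructor
  · nlinarith
  · refine le_trans ?_ h3.le
    have e1 : CL * x ≤ CL * (x + y) := by gcongr; linarith
    have e2 : CA * (K * (N * y)) ≤ CA * (K * N) * (x + y) := by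
      rw [mul_assoc, mul_assoc]; gcongr; linarith
    have e3 : C * (N * y) ^ 2 ≤ C * N ^ 2 * (x + y) := by
      rw [mul_pow, mul_assoc]; gcongr; nlinarith
    have e4 := mul_le_mul_of_nonneg_right (add_le_add (add_le_add e1 e2) e3) hL
    refine e4.trans ?_
    rw [hQ]
    nlinarith

theorem exists_const_small {Re ε₀ cv C₂ δ : ℝ} (hRe : 0 < Re) (hε₀ : 0 < ε₀) (hcv : 0 < cv)
    (hδ : 0 < δ) :
    ∃ c₁ > 0, ∀ αM x y : ℝ, 0 ≤ αM → 0 ≤ x → 0 ≤ y →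
      c₁ * (R₁ Re ε₀ αM C₂ cv x y + y) < ε₀ / (2 * Re) → x + y < δ := by
  refine ⟨ε₀ / (2 * Re) / (min (2 * Re) 1 * δ), by positivity, fun αM x y hαM hx hy h => ?_⟩
  have h1 : min (2 * Re) 1 * (x + y) ≤ R₁ Re ε₀ αM C₂ cv x y + y := by
    have e : R₁ Re ε₀ αM C₂ cv x y = 2 * Re * x +
        2 * Re / ε₀ * (cv * y ^ 2 + (1 / Re + αM * C₂ ^ 2) * y) := by
      rw [R₁]; field_simp; ring
    have h2 : 0 ≤ 2 * Re / ε₀ * (cv * y ^ 2 + (1 / Re + αM * C₂ ^ 2) * y) := by positivity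
    have h3 := mul_le_mul_of_nonneg_right (min_le_left (2 * Re) 1) hx
    have h4 := mul_le_mul_of_nonneg_right (min_le_right (2 * Re) 1) hy
    rw [e]; linarith
  have hm : 0 < min (2 * Re) 1 := by positivity
  rw [div_mul_eq_mul_div, div_lt_iff₀ (by positivity)] at h
  have h5 := lt_of_mul_lt_mul_left h (by positivity)
  exact lt_of_mul_lt_mul_left (h1.trans_lt h5) hm.le

theorem normTrace_nonneg (g : E d → E d) : 0 ≤ normTrace Ω g :=
  Real.sInf_nonneg (by rintro t ⟨v, -, rfl⟩; exact Real.sqrt_nonneg _)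

end Conclusion

end BDF

end

theorem theorem3p4 {d : ℕ} (hd : d = 2 ∨ d = 3)
    -- the domain
    (Ω : Set (E d)) (hΩo : IsOpen Ω) (hΩc : IsConnected Ω) (hΩb : Bornology.IsBounded Ω)
    (hΩr : interior (closure Ω) = Ω)
    -- the Reynolds number, the Darcy and Forchheimer functions, the porosity
    (Re : ℝ) (hRe : 0 < Re) (ε₀ : ℝ) (hε₀ : 0 < ε₀)
    (α β : ℝ → ℝ) (hα : IsCoefficient ε₀ α) (hβ : IsCoefficient ε₀ β)
    (αM βM : ℝ) (hαM : ∀ t ∈ Set.Icc ε₀ 1, α t ≤ αM) (hβM : ∀ t ∈ Set.Icc ε₀ 1, β t ≤ βM)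
    (r : ℝ) (hr : (d : ℝ) < r) (ε : E d → ℝ) (hε : MemW1 Ω (ENNReal.ofReal r) ε)
    (hεb : ∀ᵐ x ∂(volume.restrict Ω), ε₀ ≤ ε x ∧ ε x ≤ 1)
    -- the constants of the approximation of the porosity and of the lifting of `g`
    (Cε CG : ℝ)
    -- the constants of the embeddings and of the bounds of the forms; any positive values do
    (C₂ S₂ C₄ S₄ cd cv : ℝ) (hC₂ : 0 < C₂) (hS₂ : 0 < S₂) (hC₄ : 0 < C₄) (hS₄ : 0 < S₄)
    (hcd : 0 < cd) (hcv : 0 < cv) :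
    ∃ c₁ : ℝ, 0 < c₁ ∧
      ∀ (T : Triangulation Ω)
        -- the discrete porosity
        (εh : E d → ℝ), T.MemMh εh → (∀ x ∈ Ω, ε₀ ≤ εh x ∧ εh x ≤ 1) →
        eLpNorm (ε - εh) ⊤ (volume.restrict Ω) ≤ ENNReal.ofReal (Cε * T.size) →
        eLpNorm (weakGrad Ω ε - weakGrad Ω εh) (ENNReal.ofReal r) (volume.restrict Ω)
          ≤ ENNReal.ofReal (Cε * T.size) →
      -- the data and the lifting
      ∀ (f g G : E d → E d), MemLp f 2 (volume.restrict Ω) → HasTrace Ω G g →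
        weakDiv Ω (fun x => ε x • G x) =ᵐ[volume.restrict Ω] 0 →
        normX Ω G ≤ CG * normTrace Ω g →
      -- smallness of the data
        normTrace Ω g < ε₀ / (2 * cv * Re) →
        ε₀ * dualNorm Ω f + cv * normTrace Ω g ^ 2
            + ((ε₀ + 2) / (2 * Re) + αM * C₂ ^ 2) * normTrace Ω g
          < ε₀ ^ 2 / (2 * Re ^ 2 * (cd + βM * C₂ * C₄ * S₄)) →
        c₁ * (R₁ Re ε₀ αM C₂ cv (dualNorm Ω f) (normTrace Ω g) + normTrace Ω g)
          < ε₀ / (2 * Re) →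
      -- the nonlinear discrete problem has exactly one solution
      (∃ wh ph, IsDiscreteSolution T Re α β εh f G wh ph) ∧
      (∀ wh ph wh' ph', IsDiscreteSolution T Re α β εh f G wh ph →
        IsDiscreteSolution T Re α β εh f G wh' ph' →
        Set.EqOn wh wh' (closure Ω) ∧ Set.EqOn ph ph' (closure Ω)) ∧
      -- every step of the iteration has exactly one solution
      (∀ w, T.MemX0h w →
        (∃ w' p', IsStep T Re α β εh f G w w' p') ∧
        ∀ w' p' w'' p'', IsStep T Re α β εh f G w w' p' → IsStep T Re α β εh f G w w'' p'' →
          Set.EqOn w' w'' (closure Ω) ∧ Set.EqOn p' p'' (closure Ω)) ∧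
      -- the iterates converge, for every interpolation operator `I` from `X` to `X_h`
      ∀ (I : (E d → E d) → E d → E d), (∀ v, MemX Ω v → T.MemXh (I v)) →
      ∀ wh ph, IsDiscreteSolution T Re α β εh f G wh ph →
      ∀ (w : ℕ → E d → E d) (p : ℕ → E d → ℝ), T.MemX0h (w 0) →
        seminormX Ω (w 0) ≤ F₁ Re ε₀ αM S₂ cv (dualNorm Ω f) (normTrace Ω g) →
        (∀ i, IsStep T Re α β εh f G (w i) (w (i + 1)) (p (i + 1))) →
        Tendsto (fun i => l2norm Ω ((w (i + 1) + I G) - (wh + I G))) atTop (𝓝 0) ∧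
        Tendsto (fun i => l2norm Ω (p (i + 1) - ph)) atTop (𝓝 0) := by
  by_cases hT : Nonempty (Triangulation Ω)
  swap
  · exact ⟨1, one_pos, fun T => (hT ⟨T⟩).elim⟩
  obtain ⟨T₀⟩ := hT
  obtain ⟨s, K, hK⟩ := exists_sobolevBounds hd hΩo hΩb hΩr T₀ hr
  have hd0 : 0 < d := by rcases hd with rfl | rfl <;> norm_num
  have hd1 : (0 : ℝ) < d := by exact_mod_cast hd0
  have hr1 : 1 ≤ r := by
    have : (1 : ℝ) ≤ d := by exact_mod_cast hd0
    linarith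
  have hK0 : 0 ≤ K := by linarith [hK.one_le]
  obtain ⟨P, hP⟩ : ∃ P, P = ∑ i, (eLpNorm (weakPartial Ω i ε) (ENNReal.ofReal r)
      (volume.restrict Ω)).toReal + |Cε| * Metric.diam Ω := ⟨_, rfl⟩
  have hP0 : 0 ≤ P := by
    rw [hP]
    exact add_nonneg (Finset.sum_nonneg fun _ _ => ENNReal.toReal_nonneg)
      (mul_nonneg (abs_nonneg _) Metric.diam_nonneg)
  obtain ⟨δ, hδ, hsmall⟩ := exists_small_data (κ := ε₀ / Re / (d * d) ^ 2)
    (C := d * d * (K ^ 3 * (2 + P + |βM|))) (K := K) (N := (d + d * d) * |CG|)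
    (CL := d * d * (1 + P * K)) (CA := d * d / Re + d * |αM|)
    (L := d * d * (K ^ 3 * (2 + P + |βM|)) * K ^ 2) (by positivity) (by positivity) hK0
    (by positivity) (by positivity) (by positivity) (by positivity)
  obtain ⟨c₁, hc₁, hc⟩ := exists_const_small (C₂ := C₂) hRe hε₀ hcv hδ
  refine ⟨c₁, hc₁, ?_⟩
  intro T εh hεh hεhb _ hgrad f g G hf hG _ hGn _ _ hdata
  have hlip := hεh.isW1Lip hΩo hΩb
  obtain ⟨x₀, hx₀⟩ := hΩc.nonempty
  have hαM0 : 0 ≤ αM := (hα.pos _ (hεhb x₀ hx₀)).le.trans (hαM _ (hεhb x₀ hx₀))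
  have hβM0 : 0 ≤ βM := (hβ.pos _ (hεhb x₀ hx₀)).le.trans (hβM _ (hεhb x₀ hx₀))
  rw [abs_of_nonneg hαM0, abs_of_nonneg hβM0] at hsmall
  have hng := normTrace_nonneg (Ω := Ω) g
  have hnf := (abs_integral_inner_le_dualNorm hd hΩo hΩb hf).1
  obtain ⟨small, small'⟩ := hsmall _ _ hnf hng (hc αM _ _ hαM0 hnf hng hdata)
  have D : DiscreteData Ω α β εh f G :=
    ⟨hΩo, hΩb, hlip, hα.memLp_top hαM hΩo hlip hεhb, hβ.memLp_top hβM hΩo hlip hεhb, hf,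
      hG.memHs hΩo hΩb⟩
  have hN : fullN Ω G ≤ (d + d * d) * |CG| * normTrace Ω g := by
    calc fullN Ω G ≤ (d + d * d) * normX Ω G := fullN_le_normX hΩo hG.1
      _ ≤ (d + d * d) * (|CG| * normTrace Ω g) := by
        gcongr
        exact hGn.trans (mul_le_mul_of_nonneg_right (le_abs_self _) hng)
      _ = _ := by ring
  have F := hK.formBounds (T := T) D hd hΩc hΩr hRe hε₀ hεhb
    (fun x hx => ⟨(hα.pos _ (hεhb x hx)).le, hαM _ (hεhb x hx)⟩)
    (fun x hx => ⟨(hβ.pos _ (hεhb x hx)).le, hβM _ (hεhb x hx)⟩) hαM0 hβM0 hP0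
    (fun i => hP ▸ T.eLpNorm_weakPartial_le hΩo hΩb hr1 hε hlip hgrad i) hN
  obtain ⟨h1, h2, h3, h4⟩ := D.solvability_and_convergence hd0 hK F (by positivity)
    (by positivity) (by positivity) (by positivity) small small'
  refine ⟨h1, h2, h3, fun I _ wh ph hsol w p hw0 _ hstep => ?_⟩
  simp only [add_sub_add_right_eq_sub]
  exact h4 wh ph hsol w p hw0 hstep
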